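/- **Setting.** Let $G=(V,E)$ be a finite simple undirected graph and $\epsilon\in(0,1]$ with $1/\epsilon$ a power of $2$; put $\ell_{\max}=3/\epsilon$. A matching $M$ of $G$ is a $c$-approximate maximum matching if $|N|\le c\,|M|$ for every matching $N$ of $G$. An augmenting path is a simple path with two distinct free (unmatched) endpoints whose edges are alternately unmatched and matched. Each edge $\{u,v\}$ is read as two arcs $(u,v),(v,u)$; a pass reads every arc once, in an arbitrary order that may differ from pass to pass. **Algorithm.** Start with any $2$-approximate maximum matching $M$. For the scales $h=\frac12,\frac14,\frac18,\dots,\frac{\epsilon^2}{64}$ in this order, execute $\frac{144}{h\epsilon}$ phases. Each phase computes a set $\mathcal P$ of vertex-disjoint $M$-augmenting paths as described below, and then replaces $M$ by the symmetric difference of $M$ and $\bigcup_{P\in\mathcal P}E(P)$. **A phase.** Every free vertex $\alpha$ keeps a structure: a subgraph $G_\alpha$ (the $G_\alpha$ are vertex-disjoint), a partition of $V(G_\alpha)$ into blossoms, and a working vertex (possibly $\emptyset$). Write $\Omega(v)$ for the blossom containing $v$, with $\Omega(v)=\{v\}$ if $v$ is in no structure ("unvisited"). Contracting the blossoms turns $G_\alpha$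 into a tree $T'_\alpha$ rooted at $\Omega(\alpha)$, with arcs directed from parent to child; its vertices at even depth are outer, those at odd depth inner. Initially $G_\alpha$ is the single vertex $\alpha$, the working vertex is $\{\alpha\}$, every matched arc $a$ has label $\ell(a)=\ell_{\max}+1$, $\mathcal P=\emptyset$, and no vertex is removed. A phase consists of $\frac{72}{h\epsilon}$ pass-bundles, each of which does the following. 1. Mark $S_\alpha$ on hold iff $|V(G_\alpha)|\ge \frac6h+1$; mark all structures as not modified. 2. (Extend) For every arc $g=(u,v)$ of a pass: ignore $g$ if $u$ or $v$ is removed, if $\Omega(u)=\Omega(v)$, if $\Omega(u)$ is not the working vertex of a structure, if $g$ is matched, or if the structure $S_\alpha$ of $u$ is modified or on hold. Otherwise: if $\Omega(v)$ is an outer vertex of $S_\alpha$, Contract $g$; if it is an outer vertex of another structure, Augment with $g$; otherwise let $a=(v,t)$ be the matched arc with tail $v$, let $d=0$ if $\Omega(u)$ contains a free vertex and let $d$ be the label of the matched arc entering $\Omega(u)$ otherwise, and if $d+1<\ell(a)$, Overtake with $(g,a,d+1)$. 3. (Contract and augment) As long as there is an arc $(u,v)$ of $G$ with both ends in the same $G_\alpha$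 such that $\Omega(u)$ is the working vertex of $S_\alpha$ and $\Omega(v)\ne\Omega(u)$ is outer, Contract it. Then, for every arc $(u,v)$ of a pass such that $\Omega(u),\Omega(v)$ are outer vertices of different structures, Augment with it. 4. (Backtrack) In every structure that is neither on hold nor modified and has a working vertex, move the working vertex to the parent of its parent in $T'_\alpha$, or to $\emptyset$ if it is the root. *Contract* $(u,v)$ in $S_\alpha$: add $(u,v)$ to $G_\alpha$, merge all blossoms on the cycle that $(\Omega(u),\Omega(v))$ closes in $T'_\alpha$ into one blossom $B$, set the labels of all matched arcs inside $B$ to $0$, make $B$ the working vertex, mark $S_\alpha$ modified. *Augment* $(u,v)$ between $S_\alpha$ and $S_\beta$: add to $\mathcal P$ an augmenting path between $\alpha$ and $\beta$ in $G_\alpha\cup G_\beta\cup\{(u,v)\}$; delete both structures and remove their vertices until the end of the phase. *Overtake* $(g,a,k)$ with $g=(u,v)$, $a=(v,t)$, $\Omega(u)$ the working vertex of $S_\alpha$: set $\ell(a)=k$. If $a$ is in no structure, add $g$ and $a$ to $G_\alpha$ and make $\Omega(t)$ the working vertex. If $a$ is in $S_\beta$, let $(p,v)$ be the arc of $G_\beta$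 joining $v$ to its parent; replace it by $g$, so that the subtree at $\Omega(v)$, with its vertices, arcs and blossoms, hangs below $\Omega(u)$ in $S_\alpha$. If $\beta\ne\alpha$ and the working vertex of $S_\beta$ was in the subtree of $\Omega(t)$, it becomes the working vertex of $S_\alpha$ and $\Omega(p)$ becomes that of $S_\beta$; otherwise $\Omega(t)$ becomes the working vertex of $S_\alpha$. Mark $S_\alpha$ and $S_\beta$ modified. **Lemma.** Let $h\in\{\frac12,\frac14,\dots,\frac{\epsilon^2}{64}\}$. For all arc orders in the passes, whatever matching the algorithm holds at the beginning of scale $h$, scale $h$ can be executed to its end; and however the free choices of the algorithm (the order of contractions, the augmenting paths) are made, the matching $M$ at the end of scale $h$ is a $$\bigl(1+4h\ell_{\max}\bigr)\Bigl(1+\frac1{\ell_{\max}}\Bigr)\text{-approximate maximum matching of } G.$$ -/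

import Mathlib

open SimpleGraph

namespace StreamMatching

/-! ### Matchings, approximation, augmenting paths -/

/-- `M` is a matching of `G` such that every matching of `G` has at most `c * |M|` edges. -/
def IsApproxMaxMatching {V : Type*} (G : SimpleGraph V) (c : ℝ) (M : G.Subgraph) : Prop :=
  M.IsMatching ∧
    ∀ N : G.Subgraph, N.IsMatching → (N.edgeSet.ncard : ℝ) ≤ c * (M.edgeSet.ncard : ℝ)

/-- A vertex is free if it has no incident matched edge. -/
def IsFree {V : Type*} {G : SimpleGraph V} (M : G.Subgraph) (v : V) : Prop :=
  ∀ u, ¬ M.Adj v u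

/-- An alternating path: a simple path whose edges are alternately matched and unmatched. -/
def IsAlternatingPath {V : Type*} {G : SimpleGraph V} (M : G.Subgraph) {u v : V}
    (p : G.Walk u v) : Prop :=
  p.IsPath ∧ p.edges.IsChain (fun e f => (e ∈ M.edgeSet ↔ f ∉ M.edgeSet))

/-- An augmenting path: an alternating path whose two endpoints are both free. -/
def IsAugmentingPath {V : Type*} {G : SimpleGraph V} (M : G.Subgraph) {u v : V}
    (p : G.Walk u v) : Prop :=
  IsAlternatingPath M p ∧ u ≠ v ∧ IsFree M u ∧ IsFree M v

/-- A path of `G` bundled with its two endpoints. -/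
abbrev BundledPath {V : Type*} (G : SimpleGraph V) : Type _ := Σ e : V × V, G.Walk e.1 e.2

/-- Augmenting `M` along all paths of the list `P`: the subgraph whose edges are those in
exactly one of `M` and `⋃ E(P)`. -/
def augmentBy {V : Type*} {G : SimpleGraph V} (M : G.Subgraph) (P : List (BundledPath G)) :
    G.Subgraph where
  verts := {x | ∃ y, G.Adj x y ∧ ¬ (M.Adj x y ↔ ∃ p ∈ P, s(x, y) ∈ p.2.edges)}
  Adj x y := G.Adj x y ∧ ¬ (M.Adj x y ↔ ∃ p ∈ P, s(x, y) ∈ p.2.edges)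
  adj_sub h := h.1
  edge_vert h := ⟨_, h⟩
  symm := by
    constructor
    intro x y h
    refine ⟨h.1.symm, ?_⟩
    rw [M.adj_comm, Sym2.eq_swap]
    exact h.2

/-! ### Streams -/

/-- One pass over the stream: a list in which every arc of `G` occurs exactly once. -/
def IsStream {V : Type*} (G : SimpleGraph V) (l : List (V × V)) : Prop :=
  l.Nodup ∧ ∀ x y, (x, y) ∈ l ↔ G.Adj x y

/-- `Scan R l s s'`: processing the items of `l` one after the other, each by a step of `R`,
leads from `s` to `s'`. -/
inductive Scan {σ ι : Type*} (R : ι → σ → σ → Prop) : List ι → σ → σ → Prop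
  | nil (s : σ) : Scan R [] s s
  | cons {a : ι} {l : List ι} {s s' s'' : σ} :
      R a s s' → Scan R l s' s'' → Scan R (a :: l) s s''

/-! ### Parameters -/

/-- `ℓ_max = 3 / ε`. -/
noncomputable def ellMax (ε : ℝ) : ℝ := 3 / ε

/-- `limit_h = 6 / h + 1`. -/
noncomputable def limitSize (h : ℝ) : ℝ := 6 / h + 1

/-- Number of pass-bundles in a phase, `72 / (h ε)` (an integer for the values in use). -/
noncomputable def numBundles (ε h : ℝ) : ℕ := ⌊72 / (h * ε)⌋₊

/-- Number of phases in a scale, `144 / (h ε)` (an integer for the values in use). -/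
noncomputable def numPhases (ε h : ℝ) : ℕ := ⌊144 / (h * ε)⌋₊

/-! ### The data maintained during a phase -/

/-- The data maintained during a phase.  The vertex-disjoint structures
`S_α = (G_α, Ω_α, w'_α)` of the free vertices `α` are stored jointly:
`V(G_α) = {x | owner x = some α}`, and `E(G_α)` consists of the arcs in `arcs` with both ends
in `V(G_α)`.  Of the laminar family `Ω` of blossoms, the map `v ↦ Ω(v)` to the root blossom
(the largest blossom that contains `v`) is stored; blossoms nested in a root blossom `B` are
never inspected, and the edge set `E_B` consists of the arcs of `G_α` inside `B`. -/
structure PhaseState {V : Type*} (G : SimpleGraph V) where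
  /-- `some α` for the vertices of `G_α`; `none` for unvisited and for removed vertices -/
  owner : V → Option V
  /-- the arcs of all the graphs `G_α` -/
  arcs : Set (V × V)
  /-- the root blossom `Ω(v)` containing `v`, as a set of vertices -/
  root : V → Set V
  /-- the working vertex `w'_α`; `none` stands for `∅` -/
  work : V → Option (Set V)
  /-- the label of the arc `(x, y)`; used for matched arcs only -/
  label : V → V → ℕ
  /-- the vertices removed in this phase -/
  removed : Set V
  /-- the free vertices whose structure is marked as on hold -/
  onHold : Set V
  /-- the free vertices whose structure is marked as modified -/
  modified : Set V
  /-- the set of augmenting paths found so far -/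
  paths : List (BundledPath G)

namespace PhaseState

/-- The vertex set of `G_α`. -/
def vertsOf {V : Type*} {G : SimpleGraph V} (s : PhaseState G) (α : V) : Set V :=
  {x | s.owner x = some α}

/-- The arc set of `G_α`. -/
def arcsOf {V : Type*} {G : SimpleGraph V} (s : PhaseState G) (α : V) : Set (V × V) :=
  {a | a ∈ s.arcs ∧ a.1 ∈ s.vertsOf α ∧ a.2 ∈ s.vertsOf α}

/-- The arcs of the contracted graph `T'_α = G_α / Ω_α`, directed from parent to child. -/
def TreeArc {V : Type*} {G : SimpleGraph V} (s : PhaseState G) (α : V) (B C : Set V) : Prop :=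
  B ≠ C ∧ ∃ x y, (x, y) ∈ s.arcsOf α ∧ s.root x = B ∧ s.root y = C

/-- `B` is an ancestor of `C` in `T'_α` (every vertex is an ancestor of itself). -/
def IsAncestor {V : Type*} {G : SimpleGraph V} (s : PhaseState G) (α : V) (B C : Set V) : Prop :=
  Relation.ReflTransGen (s.TreeArc α) B C

/-- `B` is a vertex of `T'_α` at distance `n` from the root `Ω(α)`. -/
inductive AtDepth {V : Type*} {G : SimpleGraph V} (s : PhaseState G) (α : V) : ℕ → Set V → Prop
  | base : s.owner α = some α → AtDepth s α 0 (s.root α)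
  | step {n : ℕ} {B C : Set V} : AtDepth s α n B → s.TreeArc α B C → AtDepth s α (n + 1) C

/-- `B` is an outer vertex of `T'_α`. -/
def IsOuter {V : Type*} {G : SimpleGraph V} (s : PhaseState G) (α : V) (B : Set V) : Prop :=
  ∃ n, Even n ∧ s.AtDepth α n B

/-- `Ω(u)` is the working vertex of the structure `S_α` containing `u`. -/
def IsWorkingAt {V : Type*} {G : SimpleGraph V} (s : PhaseState G) (α u : V) : Prop :=
  s.owner u = some α ∧ s.work α = some (s.root u)

/-- `distance(u) = d`: `0` if `Ω(u)` contains a free vertex, otherwise the label of the matched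
arc of the contracted graph whose head is `Ω(u)`. -/
def Distance {V : Type*} {G : SimpleGraph V} (M : G.Subgraph) (s : PhaseState G)
    (u : V) (d : ℕ) : Prop :=
  ((∃ f ∈ s.root u, IsFree M f) ∧ d = 0) ∨
  ((∀ f ∈ s.root u, ¬ IsFree M f) ∧
    ∃ x y, M.Adj x y ∧ x ∉ s.root u ∧ y ∈ s.root u ∧ d = s.label x y)

/-- The vertices on the cycle that the arc `(Ω(u), Ω(v))` closes in `T'_α`, with all blossoms on
it expanded: `Ω(x)` lies on the tree path between `Ω(u)` and `Ω(v)` if and only if it is an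
ancestor of one of them and a descendant of all their common ancestors. -/
def cycleBlossom {V : Type*} {G : SimpleGraph V} (s : PhaseState G) (α u v : V) : Set V :=
  {x | x ∈ s.vertsOf α ∧
    (s.IsAncestor α (s.root x) (s.root u) ∨ s.IsAncestor α (s.root x) (s.root v)) ∧
    ∀ D, s.IsAncestor α D (s.root u) → s.IsAncestor α D (s.root v) →
      s.IsAncestor α D (s.root x)}

/-- The vertices `x` of `G_β` such that `Ω(x)` is in the subtree of `T'_β` rooted at `Ω(v)`. -/
def subtree {V : Type*} {G : SimpleGraph V} (s : PhaseState G) (β v : V) : Set V :=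
  {x | x ∈ s.vertsOf β ∧ s.IsAncestor β (s.root v) (s.root x)}

open Classical in
/-- Procedure `Contract` on the arc `(u, v)` in the structure `S_α`. -/
noncomputable def contract {V : Type*} {G : SimpleGraph V} (M : G.Subgraph) (s : PhaseState G)
    (α u v : V) : PhaseState G :=
  let B := s.cycleBlossom α u v
  { s with
    arcs := insert (u, v) s.arcs
    root := fun x => if x ∈ B then B else s.root x
    work := Function.update s.work α (some B)
    label := fun x y => if M.Adj x y ∧ x ∈ B ∧ y ∈ B then 0 else s.label x y
    modified := insert α s.modified }

open Classical in
/-- Removal of the structures `S_α` and `S_β` after the augmenting path `P` was found. -/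
noncomputable def removeStructures {V : Type*} {G : SimpleGraph V} (s : PhaseState G) (α β : V)
    (P : BundledPath G) : PhaseState G :=
  let R := s.vertsOf α ∪ s.vertsOf β
  { s with
    owner := fun x => if x ∈ R then none else s.owner x
    arcs := {a | a ∈ s.arcs ∧ a.1 ∉ R ∧ a.2 ∉ R}
    root := fun x => if x ∈ R then {x} else s.root x
    work := fun γ => if γ = α ∨ γ = β then none else s.work γ
    removed := s.removed ∪ R
    modified := insert α (insert β s.modified)
    paths := P :: s.paths }

/-- Procedure `Augment` on the arc `(u, v)` joining the structures `S_α` and `S_β`.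
The augmenting path found is an `M`-augmenting path between `α` and `β` in the subgraph
`G_α ∪ G_β` together with `(u, v)`.  Contracting the blossoms turns such a path into the unique
path between the two roots in `T'_α ∪ T'_β` together with `(Ω(u), Ω(v))`, so these are the paths
obtained from the latter on replacing each blossom `B` by an alternating path in `E_B`. -/
def AugmentStep {V : Type*} {G : SimpleGraph V} (M : G.Subgraph) (α β u v : V)
    (s s' : PhaseState G) : Prop :=
  ∃ P : G.Walk α β, IsAugmentingPath M P ∧
    (∀ e ∈ P.edges, e = s(u, v) ∨
      ∃ x y, (x, y) ∈ s.arcsOf α ∪ s.arcsOf β ∧ e = s(x, y)) ∧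
    s' = s.removeStructures α β ⟨(α, β), P⟩

open Classical in
/-- Procedure `Overtake` on `g = (u, v)`, `a = (v, t)` and `k`, when `a` is in no structure. -/
noncomputable def overtakeUnvisited {V : Type*} {G : SimpleGraph V} (s : PhaseState G)
    (α u v t : V) (k : ℕ) : PhaseState G :=
  { s with
    owner := fun x => if x = v ∨ x = t then some α else s.owner x
    arcs := insert (u, v) (insert (v, t) s.arcs)
    work := Function.update s.work α (some (s.root t))
    label := fun x y => if x = v ∧ y = t then k else s.label x y
    modified := insert α s.modified }

open Classical in
/-- Procedure `Overtake` on `g = (u, v)`, `a = (v, t)` and `k`, when `a` is in `S_α` itself;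
`(p, v)` is the arc that joins `v` to its parent in `T'_α`. -/
noncomputable def overtakeSame {V : Type*} {G : SimpleGraph V} (s : PhaseState G)
    (α p u v t : V) (k : ℕ) : PhaseState G :=
  { s with
    arcs := insert (u, v) (s.arcs \ {(p, v)})
    work := Function.update s.work α (some (s.root t))
    label := fun x y => if x = v ∧ y = t then k else s.label x y
    modified := insert α s.modified }

open Classical in
/-- Procedure `Overtake` on `g = (u, v)`, `a = (v, t)` and `k`, when `a` is in `S_β`, `β ≠ α`;
`(p, v)` is the arc that joins `v` to its parent in `T'_β`.  The subtree rooted at `Ω(v)`, with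
its arcs and blossoms, moves from `S_β` to `S_α`; if the working vertex of `S_β` is in the
subtree rooted at `Ω(t)`, it becomes that of `S_α`, and `S_β` continues with `Ω(p)`. -/
noncomputable def overtakeOther {V : Type*} {G : SimpleGraph V} (s : PhaseState G)
    (α β p u v t : V) (k : ℕ) : PhaseState G :=
  { s with
    owner := fun x => if x ∈ s.subtree β v then some α else s.owner x
    arcs := insert (u, v) (s.arcs \ {(p, v)})
    work :=
      if ∃ W, s.work β = some W ∧ s.IsAncestor β (s.root t) W then
        Function.update (Function.update s.work α (s.work β)) β (some (s.root p))
      else Function.update s.work α (some (s.root t))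
    label := fun x y => if x = v ∧ y = t then k else s.label x y
    modified := insert α (insert β s.modified) }

/-- Procedure `Overtake`, all cases. -/
inductive OvertakeStep {V : Type*} {G : SimpleGraph V} (α u v t : V) (k : ℕ) (s : PhaseState G) :
    PhaseState G → Prop
  | unvisited : s.owner v = none → OvertakeStep α u v t k s (s.overtakeUnvisited α u v t k)
  | same {p : V} : s.owner v = some α → (p, v) ∈ s.arcsOf α → s.root p ≠ s.root v →
      OvertakeStep α u v t k s (s.overtakeSame α p u v t k)
  | other {β p : V} : s.owner v = some β → β ≠ α → (p, v) ∈ s.arcsOf β → s.root p ≠ s.root v →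
      OvertakeStep α u v t k s (s.overtakeOther α β p u v t k)

/-- The conditions under which `Extend-Active-Path` ignores the arc `(u, v)`. -/
def Ignored {V : Type*} {G : SimpleGraph V} (M : G.Subgraph) (s : PhaseState G) (u v : V) : Prop :=
  u ∈ s.removed ∨ v ∈ s.removed ∨ s.root u = s.root v ∨ (∀ α, ¬ s.IsWorkingAt α u) ∨ M.Adj u v ∨
    ∃ α, s.owner u = some α ∧ (α ∈ s.modified ∨ α ∈ s.onHold)

/-- What `Extend-Active-Path` does when it reads the arc `g = (u, v)`. -/
inductive ExtendStep {V : Type*} {G : SimpleGraph V} (M : G.Subgraph) (g : V × V)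
    (s : PhaseState G) : PhaseState G → Prop
  | ignore : s.Ignored M g.1 g.2 → ExtendStep M g s s
  | contract {α : V} : ¬ s.Ignored M g.1 g.2 → s.IsWorkingAt α g.1 →
      s.IsOuter α (s.root g.2) → ExtendStep M g s (s.contract M α g.1 g.2)
  | augment {α β : V} {s' : PhaseState G} : ¬ s.Ignored M g.1 g.2 → s.IsWorkingAt α g.1 →
      s.IsOuter β (s.root g.2) → β ≠ α → AugmentStep M α β g.1 g.2 s s' → ExtendStep M g s s'
  | overtake {α t : V} {d : ℕ} {s' : PhaseState G} : ¬ s.Ignored M g.1 g.2 →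
      s.IsWorkingAt α g.1 → (∀ β, ¬ s.IsOuter β (s.root g.2)) → M.Adj g.2 t →
      s.Distance M g.1 d → d + 1 < s.label g.2 t →
      OvertakeStep α g.1 g.2 t (d + 1) s s' → ExtendStep M g s s'
  | noReduction {t : V} {d : ℕ} : ¬ s.Ignored M g.1 g.2 →
      (∀ β, ¬ s.IsOuter β (s.root g.2)) → M.Adj g.2 t →
      s.Distance M g.1 d → ¬ d + 1 < s.label g.2 t → ExtendStep M g s s

/-- One contraction in the first step of `Contract-and-Augment`. -/
inductive ContractOnce {V : Type*} {G : SimpleGraph V} (M : G.Subgraph) (s : PhaseState G) :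
    PhaseState G → Prop
  | mk {α u v : V} : G.Adj u v → s.IsWorkingAt α u → v ∈ s.vertsOf α → s.root v ≠ s.root u →
      s.IsOuter α (s.root v) → ContractOnce M s (s.contract M α u v)

/-- The first step of `Contract-and-Augment`: contract as long as possible. -/
def ContractAll {V : Type*} {G : SimpleGraph V} (M : G.Subgraph) (s s' : PhaseState G) : Prop :=
  Relation.ReflTransGen (ContractOnce M) s s' ∧ ∀ s'', ¬ ContractOnce M s' s''

/-- `Ω(x)` and `Ω(y)` are outer vertices of the two different structures `S_α` and `S_β`. -/
def OuterPair {V : Type*} {G : SimpleGraph V} (s : PhaseState G) (α β x y : V) : Prop :=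
  α ≠ β ∧ s.IsOuter α (s.root x) ∧ s.IsOuter β (s.root y)

/-- What the second step of `Contract-and-Augment` does when it reads the arc `g = (u, v)`. -/
inductive CheckStep {V : Type*} {G : SimpleGraph V} (M : G.Subgraph) (g : V × V)
    (s : PhaseState G) : PhaseState G → Prop
  | ignore : (∀ α β, ¬ s.OuterPair α β g.1 g.2) → CheckStep M g s s
  | augment {α β : V} {s' : PhaseState G} : s.OuterPair α β g.1 g.2 →
      AugmentStep M α β g.1 g.2 s s' → CheckStep M g s s'

/-- The new working vertex `w` of `S_α` after `Backtrack-Stuck-Structures`. -/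
inductive BacktrackTo {V : Type*} {G : SimpleGraph V} (s : PhaseState G) (α : V) :
    Option (Set V) → Prop
  | keep : (α ∈ s.onHold ∨ α ∈ s.modified ∨ s.work α = none) → BacktrackTo s α (s.work α)
  | toEmpty : α ∉ s.onHold → α ∉ s.modified → s.work α = some (s.root α) → BacktrackTo s α none
  | toGrandparent {B C W : Set V} : α ∉ s.onHold → α ∉ s.modified → s.work α = some W →
      W ≠ s.root α → s.TreeArc α B C → s.TreeArc α C W → BacktrackTo s α (some B)

/-- Procedure `Backtrack-Stuck-Structures`. -/
def Backtrack {V : Type*} {G : SimpleGraph V} (s s' : PhaseState G) : Prop :=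
  ∃ w : V → Option (Set V), (∀ α, s.BacktrackTo α (w α)) ∧ s' = { s with work := w }

/-- The marking of the structures at the beginning of a pass-bundle. -/
def mark {V : Type*} {G : SimpleGraph V} (h : ℝ) (s : PhaseState G) : PhaseState G :=
  { s with
    onHold := {α | limitSize h ≤ ((s.vertsOf α).ncard : ℝ)}
    modified := ∅ }

/-- One pass-bundle; `l₁` and `l₂` are the orders in which the arcs arrive in
`Extend-Active-Path` and in the second step of `Contract-and-Augment`. -/
def Bundle {V : Type*} {G : SimpleGraph V} (M : G.Subgraph) (h : ℝ) (l₁ l₂ : List (V × V))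
    (s s' : PhaseState G) : Prop :=
  ∃ s₁ s₂ s₃ : PhaseState G,
    Scan (ExtendStep M) l₁ (s.mark h) s₁ ∧ ContractAll M s₁ s₂ ∧
    Scan (CheckStep M) l₂ s₂ s₃ ∧ s₃.Backtrack s'

open Classical in
/-- The initialization of a phase: the structure of a free vertex `α` consists of `α` alone, and
its working vertex is the root; all labels are `ℓ_max + 1`. -/
noncomputable def init {V : Type*} {G : SimpleGraph V} (M : G.Subgraph) (ε : ℝ) : PhaseState G where
  owner x := if IsFree M x then some x else none
  arcs := ∅
  root x := {x}
  work α := if IsFree M α then some {α} else none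
  label _ _ := ⌊ellMax ε⌋₊ + 1
  removed := ∅
  onHold := ∅
  modified := ∅
  paths := []

end PhaseState

/-! ### Phases and scales -/

/-- `Alg-Phase` with matching `M` can return the set `P` of augmenting paths, when `str τ 0` and
`str τ 1` are the arc orders of the two passes of the `τ`-th pass-bundle. -/
def PhaseRun {V : Type*} {G : SimpleGraph V} (ε h : ℝ) (str : ℕ → Fin 2 → List (V × V))
    (M : G.Subgraph) (P : List (BundledPath G)) : Prop :=
  ∃ s : ℕ → PhaseState G, s 0 = PhaseState.init M ε ∧
    (∀ τ < numBundles ε h, (s τ).Bundle M h (str τ 0) (str τ 1) (s (τ + 1))) ∧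
    (s (numBundles ε h)).paths = P

/-- Scale `h`, started with the matching `M`, can end with the matching `M'`; `str t` are the
streams of the `t`-th phase. -/
def ScaleRun {V : Type*} {G : SimpleGraph V} (ε h : ℝ) (str : ℕ → ℕ → Fin 2 → List (V × V))
    (M M' : G.Subgraph) : Prop :=
  ∃ N : ℕ → G.Subgraph, N 0 = M ∧
    (∀ t < numPhases ε h, ∃ P, PhaseRun ε h (str t) (N t) P ∧ N (t + 1) = augmentBy (N t) P) ∧
    N (numPhases ε h) = M'

/-- `AfterScales ε str M₀ j M`: started with the initial matching `M₀`, the algorithm can hold the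
matching `M` after the first `j` scales `1/2, 1/4, …, 1/2^j`. -/
inductive AfterScales {V : Type*} {G : SimpleGraph V} (ε : ℝ)
    (str : ℕ → ℕ → ℕ → Fin 2 → List (V × V)) (M₀ : G.Subgraph) : ℕ → G.Subgraph → Prop
  | start : AfterScales ε str M₀ 0 M₀
  | scale {j : ℕ} {M M' : G.Subgraph} : AfterScales ε str M₀ j M →
      ScaleRun ε ((1 / 2) ^ (j + 1)) (str j) M M' → AfterScales ε str M₀ (j + 1) M'

end StreamMatching

set_option linter.unusedSectionVars false

/-! Write E = 1/ε, H = 1/h, ℓ = ℓ_max = 3E and L = 6H + 1, and let N be any matching of G. The heart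
of the matter is that a phase started with M finds at least |M|/(8H²) augmenting paths as long as
|N| exceeds the claimed factor times |M| (`Params.phase_gain`). Sizes never decrease, so if the last
matching of the scale violated the bound, every phase would gain at least 1/(8H²) of the initial
size. The 144HE phases would enlarge the matching by the factor 1 + 18E/H, which contradicts the
guarantee with 8h in place of 4h inherited from the previous scale (`Params.scaleRun`).

Gain of a phase. Walks that alternate between N and M are started at the M-free vertices. Walks with
more than ℓ steps in M account for at most 2|M|/(ℓ+1) of 2|N| (`card_starts_le`). At the end of the
phase every short augmenting walk meets a removed vertex or the base of a blossom on an active path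
(`Good.exists_blocked`). Indeed no edge joins different outer blossoms any more, and an outer
blossom off the active paths has given its neighbours labels at most its distance plus one. An
unblocked walk would therefore stay in outer blossoms whose distance is at most the number of steps,
and its last edge would join two different outer blossoms. Removed vertices are charged to the paths
found, since a structure has at most (ℓ+1)L vertices (`Sizes`). An active path carries at most ℓ+1
bases, since distances increase strictly along it.

Few structures stay active. The potential is three times the sum of the labels plus the number of
non-root bases on active paths. Overtaking lowers a label, which pays for the new base on the path
and for the two structures it marks as modified. Contraction lowers a label as well, and
backtracking takes a base off a path. Hence each pass-bundle lowers the potential by the number of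
structures that remain active and are not on hold. Those on hold are few because they are large
(`Good.bundle`).

All this is proved for a `Forest` that describes the structures by bases, parents and mates
(`Core`). The rank 2·distance for outer and 2·label − 1 for inner vertices increases strictly from
parents to children, and this excludes cycles: the condition d + 1 < ℓ(a) ensures that an overtaken
subtree never contains the vertex it is hung on. Even alternating paths from the base of a blossom
to all its vertices (`BlossomPaths`) supply the augmenting paths. Together with the termination of
contraction this shows that the scale can be executed. -/

namespace StreamMatching

/-! ### Matchings as involutions of the vertex set -/

section Mate

variable {V : Type*} {G : SimpleGraph V}

open Classical in
/-- The vertex matched to `x`, or `x` itself if `x` is free. -/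
noncomputable def mate (M : G.Subgraph) (x : V) : V :=
  if h : ∃ y, M.Adj x y then h.choose else x

variable {M : G.Subgraph}

theorem isFree_iff_mate {x : V} : IsFree M x ↔ mate M x = x := by
  unfold mate IsFree
  constructor
  · intro h
    rw [dif_neg]
    rintro ⟨y, hy⟩
    exact h y hy
  · intro h y hy
    have hex : ∃ y, M.Adj x y := ⟨y, hy⟩
    rw [dif_pos hex] at h
    have := hex.choose_spec
    rw [h] at this
    exact this.ne rfl

theorem adj_iff_mate (hM : M.IsMatching) {x y : V} : M.Adj x y ↔ mate M x = y ∧ mate M x ≠ x := by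
  constructor
  · intro h
    have hex : ∃ y, M.Adj x y := ⟨y, h⟩
    have h1 : mate M x = y := by
      unfold mate
      rw [dif_pos hex]
      exact hM.eq_of_adj_left hex.choose_spec h
    refine ⟨h1, ?_⟩
    rw [h1]
    exact h.ne.symm
  · rintro ⟨h1, h2⟩
    have hex : ∃ y, M.Adj x y := by
      by_contra hne
      apply h2
      unfold mate
      rw [dif_neg hne]
    have := hex.choose_spec
    unfold mate at h1
    rw [dif_pos hex] at h1
    rwa [h1] at this

theorem mate_mate (hM : M.IsMatching) (x : V) : mate M (mate M x) = x := by
  by_cases h : mate M x = x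
  · rw [h, h]
  · have : M.Adj x (mate M x) := (adj_iff_mate hM).2 ⟨rfl, h⟩
    exact ((adj_iff_mate hM).1 this.symm).1

/-- The degree sum of the matching counts the vertices moved by `mate`. From here on matchings are
compared through these vertex sets. -/
theorem two_mul_ncard_edgeSet [Fintype V] (hM : M.IsMatching) :
    2 * M.edgeSet.ncard = {x | mate M x ≠ x}.ncard := by
  classical
  have h := M.spanningCoe.sum_degrees_eq_twice_card_edges
  have h1 : M.spanningCoe.edgeFinset.card = M.edgeSet.ncard := by
    rw [← Set.ncard_coe_finset]
    simp
  have h2 : ∀ v, M.spanningCoe.degree v = if mate M v ≠ v then 1 else 0 := by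
    intro v
    split_ifs with hv
    · rw [← SimpleGraph.card_neighborFinset_eq_degree, Finset.card_eq_one]
      refine ⟨mate M v, ?_⟩
      ext y
      simp only [mem_neighborFinset, Subgraph.spanningCoe_adj, Finset.mem_singleton]
      rw [adj_iff_mate hM]
      constructor
      · rintro ⟨h, -⟩; exact h.symm
      · rintro rfl; exact ⟨rfl, hv⟩
    · rw [← SimpleGraph.card_neighborFinset_eq_degree, Finset.card_eq_zero]
      ext y
      simp only [mem_neighborFinset, Subgraph.spanningCoe_adj, Finset.notMem_empty, iff_false]
      rw [adj_iff_mate hM]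
      exact fun h => hv h.2
  rw [← h1, ← h, Finset.sum_congr rfl (fun v _ => h2 v)]
  rw [Finset.sum_boole, Set.ncard_eq_toFinset_card']
  simp

end Mate

/-! ### Alternating walks between two matchings -/

section Walks

variable {V : Type*} {a b : V → V}

/-- The `i`-th outer vertex on the walk from `f` that alternates between the involutions
`b` and `a`. -/
def altIter (a b : V → V) (f : V) (i : ℕ) : V := (a ∘ b)^[i] f

theorem altIter_succ (f : V) (i : ℕ) : altIter a b f (i + 1) = a (b (altIter a b f i)) := by
  unfold altIter
  rw [Function.iterate_succ_apply']
  rfl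

/-- The alternating walk from `f` does not stop before its `i`-th outer vertex. -/
def Running (a b : V → V) (f : V) (i : ℕ) : Prop :=
  ∀ j < i, b (altIter a b f j) ≠ altIter a b f j ∧
    a (b (altIter a b f j)) ≠ b (altIter a b f j)

/-- The alternating walk from `f` ends at a fixpoint of `a` after at most `ℓ` steps of `a`. -/
def ShortAug (a b : V → V) (ℓ : ℕ) (f : V) : Prop :=
  a f = f ∧ ∃ k ≤ ℓ, Running a b f k ∧ b (altIter a b f k) ≠ altIter a b f k ∧
    a (b (altIter a b f k)) = b (altIter a b f k)

/-- Such a vertex was just reached by a step of `a` that moved, and `a` is an involution. -/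
theorem altIter_not_fixed (ha : ∀ x, a (a x) = x) {f : V} {i : ℕ} (hr : Running a b f i)
    (hi : 0 < i) : a (altIter a b f i) ≠ altIter a b f i := by
  obtain ⟨j, rfl⟩ : ∃ j, i = j + 1 := ⟨i - 1, by omega⟩
  have := (hr j (by omega)).2
  rw [altIter_succ, ha]
  exact this.symm

/-- As `a ∘ b` is injective, two walks that meet can be run backwards in parallel until one of them
is at its start. The start is fixed by `a` and later outer vertices are not, so the other one is at
its start as well. -/
theorem altIter_injective (ha : ∀ x, a (a x) = x) (hb : ∀ x, b (b x) = x) {f g : V} {i j : ℕ}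
    (hf : a f = f) (hg : a g = g) (hi : Running a b f i) (hj : Running a b g j)
    (h : altIter a b f i = altIter a b g j) : f = g ∧ i = j := by
  have hinj : Function.Injective (a ∘ b) := by
    intro x y hxy
    have : b x = b y := by rw [← ha (b x), ← ha (b y)]; exact congrArg a hxy
    rw [← hb x, ← hb y, this]
  have key : ∀ {f g : V} {i j : ℕ}, a f = f → Running a b g j → i ≤ j →
      altIter a b f i = altIter a b g j → f = g ∧ i = j := by
    intro f g i j hf hj hij h
    obtain ⟨d, rfl⟩ := Nat.exists_eq_add_of_le hij
    have h2 : f = altIter a b g d := by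
      apply (hinj.iterate i)
      change altIter a b f i = _
      rw [h]
      unfold altIter
      rw [Function.iterate_add_apply]
    rcases Nat.eq_zero_or_pos d with rfl | hd
    · exact ⟨h2, by simp⟩
    · exfalso
      have := altIter_not_fixed (f := g) (i := d) ha (fun k hk => hj k (by omega)) hd
      rw [← h2] at this
      exact this hf
  rcases le_total i j with hij | hij
  · exact key hf hj hij h
  · obtain ⟨h1, h2⟩ := key hg hi hij h.symm
    exact ⟨h1.symm, h2.symm⟩

/-- A start (fixed by `a`, moved by `b`) gives a short augmenting walk, or a walk that stops at a
fixpoint of `b`, or one with ℓ+1 complete rounds. Walks of the second kind inject into the vertices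
moved by `a` only, which offset them in the comparison of the two supports. Walks of the third kind
each own ℓ+1 vertices moved by `a`. -/
theorem card_starts_le [Fintype V] (ha : ∀ x, a (a x) = x) (hb : ∀ x, b (b x) = x) (ℓ : ℕ) :
    (ℓ + 1) * {x | b x ≠ x}.ncard ≤ (ℓ + 1) * ({x | a x ≠ x}.ncard +
      {f | ShortAug a b ℓ f}.ncard) + {x | a x ≠ x}.ncard := by
  classical
  let S : Set V := {f | a f = f ∧ b f ≠ f}
  let D : Set V := {x | a x ≠ x ∧ b x = x}
  let Gd : Set V := {f | ShortAug a b ℓ f}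
  let B1 : Set V := {f | a f = f ∧ ∃ i, 0 < i ∧ Running a b f i ∧ b (altIter a b f i) = altIter a b f i}
  let B2 : Set V := {f | a f = f ∧ Running a b f (ℓ + 1)}
  have hS : S ⊆ Gd ∪ (B1 ∪ B2) := by
    rintro f ⟨hf, hbf⟩
    by_cases hrun : Running a b f (ℓ + 1)
    · exact Or.inr (Or.inr ⟨hf, hrun⟩)
    · have hex : ∃ j, ¬ (b (altIter a b f j) ≠ altIter a b f j ∧
          a (b (altIter a b f j)) ≠ b (altIter a b f j)) := by
        by_contra hne
        push Not at hne
        exact hrun fun j _ => hne j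
      -- The first round that cannot be completed; which half of it fails decides between `B1` and
      -- `Gd`.
      let k := Nat.find hex
      have hk : Running a b f k := fun j hj => not_not.1 (Nat.find_min hex hj)
      have hkl : k ≤ ℓ := by
        by_contra hlt
        exact hrun fun j hj => hk j (by omega)
      have hspec := Nat.find_spec hex
      by_cases hb' : b (altIter a b f k) = altIter a b f k
      · refine Or.inr (Or.inl ⟨hf, k, ?_, hk, hb'⟩)
        rcases Nat.eq_zero_or_pos k with h0 | h0
        · rw [h0] at hb'
          exact absurd hb' hbf
        · exact h0
      · refine Or.inl ⟨hf, k, hkl, hk, hb', ?_⟩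
        by_contra hne
        exact hspec ⟨hb', hne⟩
  have hB1 : B1.ncard ≤ D.ncard := by
    choose! i hi using fun f (hf : f ∈ B1) => hf.2
    refine Set.ncard_le_ncard_of_injOn (fun f => altIter a b f (i f)) ?_ ?_
    · intro f hf
      exact ⟨altIter_not_fixed ha (hi f hf).2.1 (hi f hf).1, (hi f hf).2.2⟩
    · intro f hf g hg hfg
      exact (altIter_injective ha hb hf.1 hg.1 (hi f hf).2.1 (hi g hg).2.1 hfg).1
  have hB2 : (ℓ + 1) * B2.ncard ≤ {x | a x ≠ x}.ncard := by
    have hc : ((Finset.range (ℓ + 1) : Finset ℕ) ×ˢ B2.toFinset).card = (ℓ + 1) * B2.ncard := by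
      rw [Finset.card_product, Finset.card_range, Set.ncard_eq_toFinset_card']
    rw [← hc, ← Set.ncard_coe_finset]
    -- The shift by one skips the start, which `a` fixes.
    refine Set.ncard_le_ncard_of_injOn (fun p => altIter a b p.2 (p.1 + 1)) ?_ ?_
    · rintro ⟨i, f⟩ hp
      simp only [Finset.coe_product, Set.mem_prod, Finset.mem_coe, Finset.mem_range,
        Set.mem_toFinset] at hp
      exact altIter_not_fixed ha (fun j hj => hp.2.2 j (by omega)) (by omega)
    · rintro ⟨i, f⟩ hp ⟨j, g⟩ hq hpq
      simp only [Finset.coe_product, Set.mem_prod, Finset.mem_coe, Finset.mem_range,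
        Set.mem_toFinset] at hp hq
      obtain ⟨h1, h2⟩ := altIter_injective ha hb hp.2.1 hq.2.1
        (fun j hj => hp.2.2 j (by omega)) (fun j hj => hq.2.2 j (by omega)) hpq
      simp only [Prod.mk.injEq]
      exact ⟨by omega, h1⟩
  have hSc : S.ncard ≤ Gd.ncard + (B1.ncard + B2.ncard) :=
    (Set.ncard_le_ncard hS).trans ((Set.ncard_union_le _ _).trans
      (Nat.add_le_add_left (Set.ncard_union_le _ _) _))
  let C : Set V := {x | a x ≠ x ∧ b x ≠ x}
  have e1 : {x | b x ≠ x}.ncard = S.ncard + C.ncard := by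
    rw [← Set.ncard_union_eq]
    · congr 1; ext x; simp only [S, C, Set.mem_union, Set.mem_ofPred_eq]; tauto
    · rw [Set.disjoint_left]; rintro x ⟨h1, _⟩ ⟨h2, _⟩; exact h2 h1
  have e2 : {x | a x ≠ x}.ncard = D.ncard + C.ncard := by
    rw [← Set.ncard_union_eq]
    · congr 1; ext x; simp only [D, C, Set.mem_union, Set.mem_ofPred_eq]; tauto
    · rw [Set.disjoint_left]; rintro x ⟨_, h1⟩ ⟨_, h2⟩; exact h2 h1
  change _ ≤ (ℓ + 1) * (_ + Gd.ncard) + _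
  have h3 : S.ncard + C.ncard ≤ D.ncard + C.ncard + Gd.ncard + B2.ncard := by omega
  calc (ℓ + 1) * {x | b x ≠ x}.ncard ≤ (ℓ + 1) * (D.ncard + C.ncard + Gd.ncard + B2.ncard) := by
        rw [e1]; exact Nat.mul_le_mul_left _ h3
    _ = (ℓ + 1) * (D.ncard + C.ncard + Gd.ncard) + (ℓ + 1) * B2.ncard := by ring
    _ ≤ _ := by rw [← e2]; exact Nat.add_le_add_left hB2 _

/-- By `altIter_injective` a vertex is an outer vertex of at most one walk and the `b`-image of an
outer vertex of at most one. A vertex of `C` thus blocks one walk, and a vertex of `R` at most two.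
-/
theorem card_shortAug_le [Fintype V] (ha : ∀ x, a (a x) = x) (hb : ∀ x, b (b x) = x) (ℓ : ℕ)
    (C R : Set V) (h : ∀ f k, k ≤ ℓ → a f = f → Running a b f k → b (altIter a b f k) ≠ altIter a b f k →
      a (b (altIter a b f k)) = b (altIter a b f k) →
      ∃ i ≤ k, altIter a b f i ∈ C ∨ altIter a b f i ∈ R ∨ b (altIter a b f i) ∈ R) :
    {f | ShortAug a b ℓ f}.ncard ≤ C.ncard + 2 * R.ncard := by
  classical
  let G1 : Set V := {f | a f = f ∧ ∃ i, Running a b f i ∧ altIter a b f i ∈ C ∪ R}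
  let G2 : Set V := {f | a f = f ∧ ∃ i, Running a b f i ∧ b (altIter a b f i) ∈ R}
  have hsub : {f | ShortAug a b ℓ f} ⊆ G1 ∪ G2 := by
    rintro f ⟨hf, k, hk, hr, h1, h2⟩
    obtain ⟨i, hi, h3⟩ := h f k hk hf hr h1 h2
    have hr' : Running a b f i := fun j hj => hr j (by omega)
    rcases h3 with h3 | h3 | h3
    · exact Or.inl ⟨hf, i, hr', Or.inl h3⟩
    · exact Or.inl ⟨hf, i, hr', Or.inr h3⟩
    · exact Or.inr ⟨hf, i, hr', h3⟩
  have h1 : G1.ncard ≤ (C ∪ R).ncard := by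
    choose! i hi using fun f (hf : f ∈ G1) => hf.2
    refine Set.ncard_le_ncard_of_injOn (fun f => altIter a b f (i f)) (fun f hf => (hi f hf).2) ?_
    intro f hf g hg hfg
    exact (altIter_injective ha hb hf.1 hg.1 (hi f hf).1 (hi g hg).1 hfg).1
  have h2 : G2.ncard ≤ R.ncard := by
    choose! i hi using fun f (hf : f ∈ G2) => hf.2
    refine Set.ncard_le_ncard_of_injOn (fun f => b (altIter a b f (i f)))
      (fun f hf => (hi f hf).2) ?_
    intro f hf g hg hfg
    have : altIter a b f (i f) = altIter a b g (i g) := by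
      rw [← hb (altIter a b f (i f)), ← hb (altIter a b g (i g))]; exact congrArg b hfg
    exact (altIter_injective ha hb hf.1 hg.1 (hi f hf).1 (hi g hg).1 this).1
  have := Set.ncard_le_ncard hsub
  have h3 := Set.ncard_union_le G1 G2
  have h4 := Set.ncard_union_le C R
  omega

/-- The walk never closes up on itself. If `b` sent the i-th outer vertex to the j-th one, it would
send the (i−1)-st to the (j+1)-st. The gap shrinks by two until it is 0 or 1, where `b` or `a` would
have a fixpoint on the running part of the walk. -/
theorem b_altIter_ne (ha : ∀ x, a (a x) = x) (hb : ∀ x, b (b x) = x) {f : V} {i j : ℕ}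
    (hji : j ≤ i) (hr : Running a b f i) (hi : b (altIter a b f i) ≠ altIter a b f i) :
    b (altIter a b f i) ≠ altIter a b f j := by
  induction hn : i - j using Nat.strong_induction_on generalizing i j with
  | _ n ih =>
    intro heq
    rcases hji.eq_or_lt with rfl | hlt
    · exact hi heq
    have h1 : altIter a b f i = b (altIter a b f j) := by rw [← heq, hb]
    rcases Nat.lt_or_ge (j + 1) i with h2 | h2
    · obtain ⟨m, rfl⟩ : ∃ m, i = m + 1 := ⟨i - 1, by omega⟩
      refine ih (m - (j + 1)) (by omega) (i := m) (j := j + 1) (by omega)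
        (fun q hq => hr q (by omega)) (hr m (by omega)).1 rfl ?_
      rw [altIter_succ f j, ← h1, altIter_succ, ha]
    · obtain rfl : i = j + 1 := by omega
      apply (hr j (by omega)).2
      rwa [altIter_succ] at h1

end Walks

/-! ### Alternating walks in a graph -/

section Alt

variable {V : Type*} {G : SimpleGraph V}

/-- The edges of the walk are alternately matched and unmatched, the first one being matched
if and only if `c` is true. -/
def Alt (M : G.Subgraph) : Bool → {x y : V} → G.Walk x y → Prop
  | _, _, _, Walk.nil => True
  | c, _, _, Walk.cons (u := x) (v := y) _ p => (M.Adj x y ↔ c = true) ∧ Alt M (!c) p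

variable {M : G.Subgraph}

theorem alt_nil {c : Bool} {x : V} : Alt M c (Walk.nil : G.Walk x x) := trivial

theorem alt_cons {c : Bool} {x y z : V} (h : G.Adj x y) (p : G.Walk y z) :
    Alt M c (Walk.cons h p) ↔ (M.Adj x y ↔ c = true) ∧ Alt M (!c) p := Iff.rfl

theorem Alt.append {c : Bool} {x y z : V} {p : G.Walk x y} {q : G.Walk y z} (hp : Alt M c p)
    (hq : Alt M (not^[p.length] c) q) : Alt M c (p.append q) := by
  induction p generalizing c with
  | nil => exact hq
  | cons h p ih =>
    rw [Walk.cons_append, alt_cons]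
    refine ⟨hp.1, ih hp.2 ?_⟩
    rwa [Walk.length_cons, Function.iterate_succ_apply] at hq

theorem not_iterate_of_even {n : ℕ} (hn : Even n) (c : Bool) : not^[n] c = c := by
  obtain ⟨k, rfl⟩ := hn
  induction k with
  | zero => rfl
  | succ k ih =>
    rw [show k + 1 + (k + 1) = (k + k) + 1 + 1 by ring, Function.iterate_succ_apply,
      Function.iterate_succ_apply, Bool.not_not, ih]

theorem not_iterate_of_odd {n : ℕ} (hn : Odd n) (c : Bool) : not^[n] c = !c := by
  obtain ⟨k, rfl⟩ := hn
  rw [Function.iterate_add_apply, not_iterate_of_even ⟨k, by ring⟩, Function.iterate_one]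

/-- The last edge of the walk has the colour `c` flipped length − 1 times; flipping two more times
changes nothing and avoids the subtraction. -/
theorem Alt.reverse {c : Bool} {x y : V} {p : G.Walk x y} (hp : Alt M c p) :
    Alt M (not^[p.length + 1] c) p.reverse := by
  induction p generalizing c with
  | nil => exact alt_nil
  | cons h p ih =>
    rw [Walk.reverse_cons, Walk.length_cons]
    have h1 := ih hp.2
    rw [← Function.iterate_succ_apply] at h1
    refine h1.append ?_
    rw [alt_cons]
    refine ⟨?_, alt_nil⟩
    rw [M.adj_comm, hp.1, Walk.length_reverse, ← Function.iterate_add_apply,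
      not_iterate_of_even ⟨p.length + 1, by simp; ring⟩]

theorem Alt.isChain {c : Bool} {x y : V} {p : G.Walk x y} (hp : Alt M c p) :
    p.edges.IsChain (fun e f => (e ∈ M.edgeSet ↔ f ∉ M.edgeSet)) := by
  induction p generalizing c with
  | nil => simp
  | cons h p ih =>
    cases p with
    | nil => simp
    | cons h' p =>
      rw [Walk.edges_cons, Walk.edges_cons, List.isChain_cons_cons, ← Walk.edges_cons h']
      refine ⟨?_, ih hp.2⟩
      have h1 := hp.1
      have h2 := hp.2.1
      simp only [Subgraph.mem_edgeSet]
      rw [h1, h2]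
      cases c <;> simp

theorem alt_of_isChain {c : Bool} {x y : V} {p : G.Walk x y}
    (hp : p.edges.IsChain (fun e f => (e ∈ M.edgeSet ↔ f ∉ M.edgeSet)))
    (h1 : ∀ e, p.edges.head? = some e → (e ∈ M.edgeSet ↔ c = true)) : Alt M c p := by
  induction p generalizing c with
  | nil => exact alt_nil
  | cons h p ih =>
    have h2 := h1 _ (by rw [Walk.edges_cons]; rfl)
    refine ⟨h2, ?_⟩
    cases p with
    | nil => exact alt_nil
    | cons h' p =>
      rw [Walk.edges_cons, Walk.edges_cons, List.isChain_cons_cons, ← Walk.edges_cons h'] at hp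
      apply ih hp.2
      intro e he
      rw [Walk.edges_cons, List.head?_cons, Option.some_inj] at he
      subst he
      have := hp.1
      rw [h2] at this
      revert this
      cases c <;> simp

/-- An alternating path that starts with an unmatched edge and ends with one, at free vertices. -/
theorem isAugmentingPath_of_alt {x y : V} {p : G.Walk x y} (h1 : p.IsPath) (h2 : Alt M false p)
    (hxy : x ≠ y) (hx : IsFree M x) (hy : IsFree M y) : IsAugmentingPath M p :=
  ⟨⟨h1, h2.isChain⟩, hxy, hx, hy⟩

theorem IsAugmentingPath.alt {x y : V} {p : G.Walk x y} (h : IsAugmentingPath M p) :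
    Alt M false p := by
  apply alt_of_isChain h.1.2
  intro e he
  cases p with
  | nil => exact absurd rfl h.2.1
  | cons h' p =>
    rw [Walk.edges_cons, List.head?_cons, Option.some_inj] at he
    subst he
    simp only [Subgraph.mem_edgeSet, Bool.false_eq_true, iff_false]
    exact h.2.2.1 _

/-- Along an alternating path that ends in a free vertex, the path contains all matched edges
at its vertices and exactly one unmatched edge at each of them; the start vertex is exempt from
one of the conditions, depending on the first edge. -/
theorem Alt.edges_at {x y : V} {p : G.Walk x y} {c : Bool} (h : Alt M c p) (hp : p.IsPath)
    (hM : M.IsMatching) (hy : IsFree M y) (hnil : p.length = 0 → c = true) :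
    (∀ z ∈ p.support, (z = x → c = true) → ∀ w, M.Adj z w → s(z, w) ∈ p.edges) ∧
    (∀ z ∈ p.support, (z = x → c = false) → ∃! w, s(z, w) ∈ p.edges ∧ ¬ M.Adj z w) ∧
    (c = true → ∀ w, s(x, w) ∈ p.edges → M.Adj x w) ∧
    (∀ z ∈ p.support, (z = x → c = true) → z ≠ y → ∃ w, M.Adj z w) := by
  induction p generalizing c with
  | nil =>
    have hc := hnil rfl
    subst hc
    refine ⟨?_, ?_, ?_, ?_⟩
    · intro z hz _ w hw
      rw [Walk.support_nil, List.mem_singleton] at hz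
      subst hz
      exact absurd hw (hy w)
    · intro z hz h1
      rw [Walk.support_nil, List.mem_singleton] at hz
      exact absurd (h1 hz) (by simp)
    · simp
    · intro z hz _ hzy
      rw [Walk.support_nil, List.mem_singleton] at hz
      exact absurd hz hzy
  | @cons x x' y hadj p ih =>
    rw [Walk.cons_isPath_iff] at hp
    have hnil' : p.length = 0 → (!c) = true := by
      intro h0
      have : x' = y := Walk.eq_of_length_eq_zero h0
      subst this
      cases c with
      | false => rfl
      | true => exact absurd (h.1.2 rfl).symm (hy x)
    obtain ⟨h1, h2, h3, h4⟩ := ih h.2 hp.1 hy hnil'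
    have hxe : ∀ w, s(x, w) ∉ p.edges := fun w hw => hp.2 (p.fst_mem_support_of_mem_edges hw)
    have hx' : x' ∈ p.support := p.start_mem_support
    have hfst := h.1
    have hstart : ∀ w, s(x, w) ∈ (Walk.cons hadj p).edges ↔ w = x' := by
      intro w
      rw [Walk.edges_cons, List.mem_cons]
      constructor
      · rintro (h | h)
        · rw [Sym2.eq_iff] at h
          rcases h with ⟨-, h⟩ | ⟨h, -⟩
          · exact h
          · exact absurd h hadj.ne
        · exact absurd h (hxe w)
      · rintro rfl; exact Or.inl rfl
    have hx'e : ∀ w, s(x', w) ∈ (Walk.cons hadj p).edges ↔ w = x ∨ s(x', w) ∈ p.edges := by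
      intro w
      rw [Walk.edges_cons, List.mem_cons]
      refine or_congr_left ?_
      rw [Sym2.eq_iff]
      constructor
      · rintro (⟨h, -⟩ | ⟨-, h⟩)
        · exact absurd h hadj.ne.symm
        · exact h
      · rintro rfl; exact Or.inr ⟨rfl, rfl⟩
    have hother : ∀ z w, z ≠ x → z ≠ x' → (s(z, w) ∈ (Walk.cons hadj p).edges ↔ s(z, w) ∈ p.edges) := by
      intro z w hz hz'
      rw [Walk.edges_cons, List.mem_cons, Sym2.eq_iff]
      constructor
      · rintro ((⟨h, -⟩ | ⟨h, -⟩) | h)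
        · exact absurd h hz
        · exact absurd h hz'
        · exact h
      · exact Or.inr
    have hne : x ≠ x' := hadj.ne
    refine ⟨?_, ?_, ?_, ?_⟩
    · intro z hz hzc w hzw
      rw [Walk.support_cons, List.mem_cons] at hz
      by_cases hzx : z = x
      · subst hzx
        rw [hstart]
        exact hM.eq_of_adj_left hzw (hfst.2 (hzc rfl))
      · have hz' := hz.resolve_left hzx
        by_cases hzx' : z = x'
        · subst hzx'
          rw [hx'e]
          cases c with
          | true => exact Or.inl (hM.eq_of_adj_left hzw (hfst.2 rfl).symm)
          | false => exact Or.inr (h1 z hz' (fun _ => rfl) w hzw)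
        · rw [hother z w hzx hzx']
          exact h1 z hz' (fun h => absurd h hzx') w hzw
    · intro z hz hzc
      rw [Walk.support_cons, List.mem_cons] at hz
      by_cases hzx : z = x
      · subst hzx
        have hc := hzc rfl
        subst hc
        refine ⟨x', ⟨(hstart x').2 rfl, fun h => by simpa using hfst.1 h⟩, ?_⟩
        rintro w ⟨hw, -⟩
        exact (hstart w).1 hw
      · have hz' := hz.resolve_left hzx
        by_cases hzx' : z = x'
        · subst hzx'
          cases c with
          | true =>
            obtain ⟨w, ⟨hw1, hw2⟩, hw3⟩ := h2 z hz' (fun _ => rfl)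
            refine ⟨w, ⟨(hx'e w).2 (Or.inr hw1), hw2⟩, ?_⟩
            rintro w' ⟨hw', hw''⟩
            rcases (hx'e w').1 hw' with rfl | h
            · exact absurd (hfst.2 rfl).symm hw''
            · exact hw3 w' ⟨h, hw''⟩
          | false =>
            refine ⟨x, ⟨(hx'e x).2 (Or.inl rfl), fun h => by simpa using hfst.1 h.symm⟩, ?_⟩
            rintro w' ⟨hw', hw''⟩
            rcases (hx'e w').1 hw' with rfl | h
            · rfl
            · exact absurd (h3 rfl w' h) hw''
        · obtain ⟨w, ⟨hw1, hw2⟩, hw3⟩ := h2 z hz' (fun h => absurd h hzx')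
          refine ⟨w, ⟨(hother z w hzx hzx').2 hw1, hw2⟩, ?_⟩
          rintro w' ⟨hw', hw''⟩
          exact hw3 w' ⟨(hother z w' hzx hzx').1 hw', hw''⟩
    · rintro rfl w hw
      rw [(hstart w).1 hw]
      exact hfst.2 rfl
    · intro z hz hzc hzy
      rw [Walk.support_cons, List.mem_cons] at hz
      by_cases hzx : z = x
      · exact ⟨x', hzx ▸ hfst.2 (hzc hzx)⟩
      · have hz' := hz.resolve_left hzx
        by_cases hzx' : z = x'
        · cases c with
          | true => exact ⟨x, hzx' ▸ (hfst.2 rfl).symm⟩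
          | false => exact h4 z hz' (fun _ => rfl) hzy
        · exact h4 z hz' (fun h => absurd h hzx') hzy

/-- For an augmenting path both exemptions in `Alt.edges_at` disappear: its first edge is unmatched
and its start has no matched edge. -/
theorem IsAugmentingPath.edges_at {x y : V} {p : G.Walk x y} (h : IsAugmentingPath M p)
    (hM : M.IsMatching) {z : V} (hz : z ∈ p.support) :
    (∀ w, M.Adj z w → s(z, w) ∈ p.edges) ∧ (∃! w, s(z, w) ∈ p.edges ∧ ¬ M.Adj z w) ∧
      (z ≠ x → z ≠ y → ∃ w, M.Adj z w) := by
  obtain ⟨h1, h2, -, h4⟩ := h.alt.edges_at h.1.1 hM h.2.2.2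
    (fun h0 => absurd (Walk.eq_of_length_eq_zero h0) h.2.1)
  refine ⟨?_, h2 z hz (fun _ => rfl), fun hx => h4 z hz (fun h => absurd h hx)⟩
  intro w hw
  refine h1 z hz ?_ w hw
  rintro rfl
  exact absurd hw (h.2.2.1 w)

/-- The vertex sets of the paths in the list are pairwise disjoint. -/
def DisjointPaths (P : List (BundledPath G)) : Prop :=
  P.Pairwise fun p q => ∀ x, x ∈ p.2.support → x ∉ q.2.support

variable {P : List (BundledPath G)}

theorem DisjointPaths.eq (hd : DisjointPaths P) {p q : BundledPath G} (hp : p ∈ P) (hq : q ∈ P)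
    {x : V} (h1 : x ∈ p.2.support) (h2 : x ∈ q.2.support) : p = q := by
  by_contra hne
  unfold DisjointPaths at hd
  have : Std.Symm (fun p q : BundledPath G => ∀ x, x ∈ p.2.support → x ∉ q.2.support) :=
    ⟨fun p q h x hx hx' => h x hx' hx⟩
  exact hd.forall hp hq hne x h1 h2

/-- The path through `x` contains every matched edge at `x` and no other path visits `x`, so the
symmetric difference at `x` keeps precisely the unmatched edges of the path. -/
theorem augmentBy_adj_of_mem (hM : M.IsMatching) (hP : ∀ p ∈ P, IsAugmentingPath M p.2)
    (hd : DisjointPaths P) {p : BundledPath G} (hp : p ∈ P) {x : V} (hx : x ∈ p.2.support) (y : V) :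
    (augmentBy M P).Adj x y ↔ s(x, y) ∈ p.2.edges ∧ ¬ M.Adj x y := by
  have h1 : (∃ q ∈ P, s(x, y) ∈ q.2.edges) ↔ s(x, y) ∈ p.2.edges := by
    constructor
    · rintro ⟨q, hq, h⟩
      rwa [hd.eq hp hq hx (q.2.fst_mem_support_of_mem_edges h)]
    · exact fun h => ⟨p, hp, h⟩
  have h2 := (hP p hp).edges_at hM hx
  change G.Adj x y ∧ ¬ (M.Adj x y ↔ _) ↔ _
  rw [h1]
  constructor
  · rintro ⟨-, h⟩
    by_cases h3 : M.Adj x y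
    · exact absurd (iff_of_true h3 (h2.1 y h3)) h
    · refine ⟨?_, h3⟩
      by_contra h4
      exact h (iff_of_false h3 h4)
  · rintro ⟨h3, h4⟩
    exact ⟨p.2.adj_of_mem_edges h3, fun h => h4 (h.2 h3)⟩

theorem augmentBy_adj_of_notMem {x : V} (hx : ∀ p ∈ P, x ∉ p.2.support) (y : V) :
    (augmentBy M P).Adj x y ↔ M.Adj x y := by
  have h1 : ¬ ∃ q ∈ P, s(x, y) ∈ q.2.edges := by
    rintro ⟨q, hq, h⟩
    exact hx q hq (q.2.fst_mem_support_of_mem_edges h)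
  change G.Adj x y ∧ ¬ (M.Adj x y ↔ _) ↔ _
  constructor
  · rintro ⟨-, h⟩
    by_contra h2
    exact h (iff_of_false h2 h1)
  · exact fun h => ⟨M.adj_sub h, fun h' => h1 (h'.1 h)⟩

theorem augmentBy_isMatching (hM : M.IsMatching) (hP : ∀ p ∈ P, IsAugmentingPath M p.2)
    (hd : DisjointPaths P) : (augmentBy M P).IsMatching := by
  rintro x ⟨y, hy⟩
  change (augmentBy M P).Adj x y at hy
  by_cases hx : ∃ p ∈ P, x ∈ p.2.support
  · obtain ⟨p, hp, hx⟩ := hx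
    obtain ⟨w, hw1, hw2⟩ := ((hP p hp).edges_at hM hx).2.1
    refine ⟨w, (augmentBy_adj_of_mem hM hP hd hp hx w).2 hw1, ?_⟩
    intro z hz
    exact hw2 z ((augmentBy_adj_of_mem hM hP hd hp hx z).1 hz)
  · push Not at hx
    refine ⟨y, hy, ?_⟩
    intro z hz
    rw [augmentBy_adj_of_notMem hx] at hy hz
    exact hM.eq_of_adj_left hz hy

theorem mate_augmentBy_ne_iff (hM : M.IsMatching) (hP : ∀ p ∈ P, IsAugmentingPath M p.2)
    (hd : DisjointPaths P) (x : V) :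
    mate (augmentBy M P) x ≠ x ↔ mate M x ≠ x ∨ ∃ p ∈ P, x = p.1.1 ∨ x = p.1.2 := by
  have key : ∀ {N : G.Subgraph}, N.IsMatching → (mate N x ≠ x ↔ ∃ y, N.Adj x y) := by
    intro N hN
    rw [Ne, ← isFree_iff_mate, IsFree]
    push Not
    rfl
  have hfree : (∃ p ∈ P, x = p.1.1 ∨ x = p.1.2) → ∃ p ∈ P, x ∈ p.2.support := by
    rintro ⟨p, hp, rfl | rfl⟩
    · exact ⟨p, hp, p.2.start_mem_support⟩
    · exact ⟨p, hp, p.2.end_mem_support⟩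
  rw [key (augmentBy_isMatching hM hP hd), key hM]
  by_cases hx : ∃ p ∈ P, x ∈ p.2.support
  · obtain ⟨p, hp, hx⟩ := hx
    have h2 := (hP p hp).edges_at hM hx
    obtain ⟨w, hw1, hw2⟩ := h2.2.1
    refine iff_of_true ⟨w, (augmentBy_adj_of_mem hM hP hd hp hx w).2 hw1⟩ ?_
    by_contra hcon
    push Not at hcon
    obtain ⟨w', hw'⟩ := h2.2.2 (hcon.2 p hp).1 (hcon.2 p hp).2
    exact hcon.1 w' hw'
  · push Not at hx
    rw [exists_congr (augmentBy_adj_of_notMem hx)]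
    constructor
    · exact Or.inl
    · rintro (h | h)
      · exact h
      · obtain ⟨p, hp, h'⟩ := hfree h
        exact absurd h' (hx p hp)

/-- Counted by matched vertices: each path contributes its two endpoints, which were free, and
disjointness prevents any endpoint from being counted twice. -/
theorem ncard_edgeSet_augmentBy [Fintype V] (hM : M.IsMatching)
    (hP : ∀ p ∈ P, IsAugmentingPath M p.2) (hd : DisjointPaths P) :
    (augmentBy M P).edgeSet.ncard = M.edgeSet.ncard + P.length := by
  classical
  have h1 := two_mul_ncard_edgeSet (augmentBy_isMatching hM hP hd)
  have h2 := two_mul_ncard_edgeSet hM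
  have key : ∀ Q : List (BundledPath G), (∀ p ∈ Q, IsAugmentingPath M p.2) → DisjointPaths Q →
      {x | mate M x ≠ x ∨ ∃ p ∈ Q, x = p.1.1 ∨ x = p.1.2}.ncard =
        {x | mate M x ≠ x}.ncard + 2 * Q.length := by
    intro Q
    induction Q with
    | nil => intro _ _; simp
    | cons p Q ih =>
      intro hQ hdQ
      have hdQ' := List.pairwise_cons.1 hdQ
      have hp := hQ p (by simp)
      have hins : {x | mate M x ≠ x ∨ ∃ q ∈ p :: Q, x = q.1.1 ∨ x = q.1.2} =
          insert p.1.1 (insert p.1.2 {x | mate M x ≠ x ∨ ∃ q ∈ Q, x = q.1.1 ∨ x = q.1.2}) := by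
        ext x
        simp only [Set.mem_ofPred_eq, List.mem_cons, Set.mem_insert_iff, exists_eq_or_imp]
        generalize (∃ q ∈ Q, x = q.1.1 ∨ x = q.1.2) = A
        rw [or_assoc, or_left_comm (b := x = p.1.1)]
        exact or_congr_right or_left_comm
      have hnot : ∀ x, IsFree M x → x ∈ p.2.support →
          x ∉ {x | mate M x ≠ x ∨ ∃ q ∈ Q, x = q.1.1 ∨ x = q.1.2} := by
        rintro x hx hxp (h | ⟨q, hq, h⟩)
        · exact h (isFree_iff_mate.1 hx)
        · refine hdQ'.1 q hq x hxp ?_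
          rcases h with rfl | rfl
          · exact q.2.start_mem_support
          · exact q.2.end_mem_support
      rw [hins, Set.ncard_insert_of_notMem, Set.ncard_insert_of_notMem,
        ih (fun q hq => hQ q (List.mem_cons_of_mem _ hq)) hdQ'.2, List.length_cons]
      · ring
      · exact hnot _ hp.2.2.2 p.2.end_mem_support
      · rw [Set.mem_insert_iff]
        rintro (h | h)
        · exact hp.2.1 h
        · exact hnot _ hp.2.2.1 p.2.start_mem_support h
  have h3 : {x | mate (augmentBy M P) x ≠ x} =
      {x | mate M x ≠ x ∨ ∃ p ∈ P, x = p.1.1 ∨ x = p.1.2} := by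
    ext x
    exact mate_augmentBy_ne_iff hM hP hd x
  rw [h3, key P hP hd] at h1
  omega

end Alt

/-! ### The alternating forest behind a phase state -/

/-- The outer vertices, the base of the blossom of each outer vertex, and the tree parent of each
inner vertex. -/
structure Forest (V : Type*) where
  /-- the vertices in outer blossoms -/
  out : Set V
  /-- the base of the blossom of an outer vertex -/
  base : V → V
  /-- the tail of the arc of the forest that enters an inner vertex -/
  par : V → V

namespace Forest

variable {V : Type*} {G : SimpleGraph V}

open Classical in
/-- The representative of the vertex of the contracted forest that contains `x`. -/
noncomputable def nd (F : Forest V) (x : V) : V := if x ∈ F.out then F.base x else x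

open Classical in
/-- The parent map of the contracted forest on representatives; the roots are its fixpoints. -/
noncomputable def up (F : Forest V) (M : G.Subgraph) (b : V) : V :=
  if b ∈ F.out then mate M b else F.base (F.par b)

/-- `a` is an ancestor of `b` in the contracted forest. -/
def Desc (F : Forest V) (M : G.Subgraph) (b a : V) : Prop :=
  Relation.ReflTransGen (fun x y => F.up M x = y) b a

theorem nd_of_mem {F : Forest V} {x : V} (h : x ∈ F.out) : F.nd x = F.base x := if_pos h

theorem nd_of_notMem {F : Forest V} {x : V} (h : x ∉ F.out) : F.nd x = x := if_neg h

theorem up_of_mem {F : Forest V} {M : G.Subgraph} {x : V} (h : x ∈ F.out) :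
    F.up M x = mate M x := if_pos h

theorem up_of_notMem {F : Forest V} {M : G.Subgraph} {x : V} (h : x ∉ F.out) :
    F.up M x = F.base (F.par x) := if_neg h

variable {F : Forest V} {M : G.Subgraph}

theorem Desc.refl (b : V) : F.Desc M b b := Relation.ReflTransGen.refl

theorem Desc.trans {a b c : V} (h : F.Desc M a b) (h' : F.Desc M b c) : F.Desc M a c :=
  Relation.ReflTransGen.trans h h'

theorem desc_up (b : V) : F.Desc M b (F.up M b) := Relation.ReflTransGen.single rfl

theorem Desc.up_of_ne {a b : V} (h : F.Desc M b a) (hne : b ≠ a) : F.Desc M (F.up M b) a := by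
  rcases Relation.ReflTransGen.cases_head h with h | ⟨c, rfl, h⟩
  · exact absurd h hne
  · exact h

theorem Desc.total {a b c : V} (h : F.Desc M b a) (h' : F.Desc M b c) :
    F.Desc M a c ∨ F.Desc M c a :=
  Relation.ReflTransGen.total_of_right_unique (fun _ _ _ h1 h2 => h1.symm.trans h2) h h'

/-- Climb from `b` to the first ancestor of `w`. Anything above both `b` and `w` is above that
vertex, because the parent map is single-valued. -/
theorem exists_lowest_common {b w r : V} (h : F.Desc M b r) (h' : F.Desc M w r) :
    ∃ c, F.Desc M b c ∧ F.Desc M w c ∧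
      ∀ d, F.Desc M b d → F.Desc M w d → F.Desc M c d := by
  induction h using Relation.ReflTransGen.head_induction_on with
  | refl => exact ⟨r, .refl r, h', fun d hd _ => hd⟩
  | @head b b' hb _ ih =>
    by_cases hw : F.Desc M w b
    · exact ⟨b, .refl b, hw, fun d hd _ => hd⟩
    · obtain ⟨c, h1, h2, h3⟩ := ih
      refine ⟨c, .head hb h1, h2, fun d hd hd' => h3 d ?_ hd'⟩
      rw [← hb]
      apply hd.up_of_ne
      rintro rfl
      exact hw hd'

end Forest

/-! ### The invariants linking forest and phase state, and the contracted trees -/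

section

variable {V : Type*} {G : SimpleGraph V}

/-- The label of the matched arc with tail `v`. -/
noncomputable def lab (M : G.Subgraph) (s : PhaseState G) (v : V) : ℕ := s.label v (mate M v)

open Classical in
/-- The distance of the outer blossom with base `b`. -/
noncomputable def dist (M : G.Subgraph) (s : PhaseState G) (b : V) : ℕ :=
  if mate M b = b then 0 else s.label (mate M b) b

open Classical in
/-- A rank that increases strictly from parents to children. -/
noncomputable def rk (M : G.Subgraph) (s : PhaseState G) (F : Forest V) (b : V) : ℕ :=
  if b ∈ F.out then 2 * dist M s b else 2 * lab M s b - 1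

/-- The forest `F` describes the structures stored in the phase state `s`, and the labels are
consistent with it. -/
structure Core (M : G.Subgraph) (s : PhaseState G) (F : Forest V) (ℓ : ℕ) : Prop where
  isMatching : M.IsMatching
  free_owner : ∀ x, mate M x = x → x ∉ s.removed → s.owner x = some x
  owner_free : ∀ x α, s.owner x = some α → mate M α = α ∧ s.owner α = some α
  owner_eq : ∀ x α, s.owner x = some α → mate M x = x → x = α
  free_out : ∀ x, mate M x = x → s.owner x ≠ none → x ∈ F.out
  out_owner : ∀ x ∈ F.out, s.owner x ≠ none
  removed_owner : ∀ x ∈ s.removed, s.owner x = none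
  mate_removed : ∀ x ∈ s.removed, mate M x ∈ s.removed
  mate_owner : ∀ x, s.owner (mate M x) = s.owner x
  base_out : ∀ x ∈ F.out, F.base x ∈ F.out
  base_base : ∀ x ∈ F.out, F.base (F.base x) = F.base x
  base_owner : ∀ x ∈ F.out, s.owner (F.base x) = s.owner x
  mate_out : ∀ x ∈ F.out, F.base x ≠ x →
    mate M x ∈ F.out ∧ F.base (mate M x) = F.base x ∧ mate M x ≠ x
  mate_base : ∀ x ∈ F.out, F.base x = x → mate M x ≠ x → mate M x ∉ F.out
  mate_inner : ∀ v ∉ F.out, s.owner v ≠ none → mate M v ∈ F.out ∧ F.base (mate M v) = mate M v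
  par_out : ∀ v ∉ F.out, s.owner v ≠ none → F.par v ∈ F.out ∧ s.owner (F.par v) = s.owner v ∧
    (F.par v, v) ∈ s.arcs ∧ (v, mate M v) ∈ s.arcs
  root_out : ∀ x ∈ F.out, s.root x = {y | y ∈ F.out ∧ F.base y = F.base x}
  root_notOut : ∀ x ∉ F.out, s.root x = {x}
  arcs_adj : ∀ x y, (x, y) ∈ s.arcs → G.Adj x y
  arcs_owner : ∀ x y, (x, y) ∈ s.arcs → s.owner x ≠ none ∧ s.owner x = s.owner y
  arcs_char : ∀ x y, (x, y) ∈ s.arcs → (x ∈ F.out ∧ y ∈ F.out ∧ F.base x = F.base y) ∨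
    (y ∉ F.out ∧ x = F.par y) ∨ (x ∉ F.out ∧ y = mate M x)
  lab_lt : ∀ v ∉ F.out, s.owner v ≠ none → dist M s (F.base (F.par v)) < lab M s v
  lab_le : ∀ v ∉ F.out, s.owner v ≠ none → lab M s v ≤ ℓ
  lab_none : ∀ v, s.owner v = none → v ∉ s.removed → mate M v ≠ v → lab M s v = ℓ + 1
  work_eq : ∀ α W, s.work α = some W → ∃ x ∈ F.out, s.owner x = some α ∧ W = s.root x

/-- `b` represents a vertex of the contracted forest. -/
def Rep (s : PhaseState G) (F : Forest V) (b : V) : Prop := s.owner b ≠ none ∧ F.nd b = b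

variable {M : G.Subgraph} {s : PhaseState G} {F : Forest V} {ℓ : ℕ}

theorem Rep.base_eq {b : V} (hb : Rep s F b) (h : b ∈ F.out) : F.base b = b := by
  rw [← Forest.nd_of_mem h]; exact hb.2

theorem rep_of_notOut {v : V} (h : v ∉ F.out) (hv : s.owner v ≠ none) : Rep s F v :=
  ⟨hv, Forest.nd_of_notMem h⟩

namespace Core

variable (C : Core M s F ℓ)
include C

theorem mate_mate (x : V) : mate M (mate M x) = x := StreamMatching.mate_mate C.isMatching x

theorem lab_mate (x : V) : lab M s (mate M x) = s.label (mate M x) x := by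
  unfold lab
  rw [C.mate_mate]

theorem dist_eq {b : V} (h : mate M b ≠ b) : dist M s b = lab M s (mate M b) := by
  rw [C.lab_mate, dist, if_neg h]

theorem owner_nd (x : V) : s.owner (F.nd x) = s.owner x := by
  by_cases h : x ∈ F.out
  · rw [Forest.nd_of_mem h, C.base_owner x h]
  · rw [Forest.nd_of_notMem h]

theorem nd_mem_iff (x : V) : F.nd x ∈ F.out ↔ x ∈ F.out := by
  by_cases h : x ∈ F.out
  · rw [Forest.nd_of_mem h]
    exact iff_of_true (C.base_out x h) h
  · rw [Forest.nd_of_notMem h]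

theorem nd_nd (x : V) : F.nd (F.nd x) = F.nd x := by
  by_cases h : x ∈ F.out
  · rw [Forest.nd_of_mem h, Forest.nd_of_mem (C.base_out x h), C.base_base x h]
  · rw [Forest.nd_of_notMem h, Forest.nd_of_notMem h]

theorem rep_nd {x : V} (h : s.owner x ≠ none) : Rep s F (F.nd x) :=
  ⟨by rwa [C.owner_nd], C.nd_nd x⟩

theorem mem_root_self (x : V) : x ∈ s.root x := by
  by_cases h : x ∈ F.out
  · rw [C.root_out x h]; exact ⟨h, rfl⟩
  · rw [C.root_notOut x h]; rfl

theorem mem_root_iff {x y : V} : y ∈ s.root x ↔ F.nd y = F.nd x := by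
  by_cases h : x ∈ F.out
  · rw [C.root_out x h, Forest.nd_of_mem h]
    constructor
    · rintro ⟨h1, h2⟩
      rw [Forest.nd_of_mem h1, h2]
    · intro h1
      have : y ∈ F.out := by
        rw [← C.nd_mem_iff, h1]
        exact C.base_out x h
      exact ⟨this, by rw [← h1, Forest.nd_of_mem this]⟩
  · rw [C.root_notOut x h, Forest.nd_of_notMem h, Set.mem_singleton_iff]
    constructor
    · rintro rfl
      exact Forest.nd_of_notMem h
    · intro h1
      have : y ∉ F.out := by
        rw [← C.nd_mem_iff, h1]
        exact h
      rw [← h1, Forest.nd_of_notMem this]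

theorem root_eq_iff {x y : V} : s.root x = s.root y ↔ F.nd x = F.nd y := by
  constructor
  · intro h
    rw [← C.mem_root_iff, ← h]
    exact C.mem_root_self x
  · intro h
    ext z
    rw [C.mem_root_iff, C.mem_root_iff, h]

theorem root_nd (x : V) : s.root (F.nd x) = s.root x := C.root_eq_iff.2 (C.nd_nd x)

theorem mem_out_of_nd_eq {x y : V} (h : F.nd x = F.nd y) : x ∈ F.out ↔ y ∈ F.out := by
  rw [← C.nd_mem_iff, h, C.nd_mem_iff]

theorem mate_ne_of_notOut {v : V} (h : v ∉ F.out) (hv : s.owner v ≠ none) : mate M v ≠ v :=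
  fun h' => h (C.free_out v h' hv)

theorem owner_up {b : V} (hb : s.owner b ≠ none) : s.owner (F.up M b) = s.owner b := by
  by_cases h : b ∈ F.out
  · rw [Forest.up_of_mem h, C.mate_owner]
  · rw [Forest.up_of_notMem h, C.base_owner _ (C.par_out b h hb).1, (C.par_out b h hb).2.1]

theorem rep_up {b : V} (hb : Rep s F b) : Rep s F (F.up M b) := by
  refine ⟨by rw [C.owner_up hb.1]; exact hb.1, ?_⟩
  by_cases h : b ∈ F.out
  · rw [Forest.up_of_mem h]
    by_cases h1 : mate M b = b
    · rw [h1]; exact hb.2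
    · exact Forest.nd_of_notMem (C.mate_base b h (hb.base_eq h) h1)
  · rw [Forest.up_of_notMem h]
    have := (C.par_out b h hb.1).1
    rw [Forest.nd_of_mem (C.base_out _ this), C.base_base _ this]

/-- An outer blossom at distance d has inner children with labels k > d, and the outer child of an
inner vertex with label k has distance k; so 2d < 2k − 1 < 2k. This is the substitute for
acyclicity, and inductions on the forest run on this rank. -/
theorem rk_up {b : V} (hb : Rep s F b) (hne : F.up M b ≠ b) : rk M s F (F.up M b) < rk M s F b := by
  by_cases h : b ∈ F.out
  · rw [Forest.up_of_mem h] at hne ⊢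
    have h1 := C.mate_base b h (hb.base_eq h) hne
    have h2 := C.lab_lt _ h1 (by rw [C.mate_owner]; exact hb.1)
    rw [rk, if_neg h1, rk, if_pos h, C.dist_eq hne]
    omega
  · rw [Forest.up_of_notMem h]
    have h1 := (C.par_out b h hb.1).1
    have h2 := C.lab_lt b h hb.1
    have e : rk M s F b = 2 * lab M s b - 1 := if_neg h
    rw [e, rk, if_pos (C.base_out _ h1)]
    omega

theorem desc_rep {b a : V} (h : F.Desc M b a) (hb : Rep s F b) :
    Rep s F a ∧ s.owner a = s.owner b := by
  induction h with
  | refl => exact ⟨hb, rfl⟩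
  | tail _ h ih =>
    subst h
    exact ⟨C.rep_up ih.1, by rw [C.owner_up ih.1.1, ih.2]⟩

theorem desc_rk {b a : V} (h : F.Desc M b a) (hb : Rep s F b) :
    a = b ∨ rk M s F a < rk M s F b := by
  induction h with
  | refl => exact Or.inl rfl
  | @tail c d h1 h ih =>
    subst h
    have hc := (C.desc_rep h1 hb).1
    by_cases hne : F.up M c = c
    · rw [hne]; exact ih
    · have := C.rk_up hc hne
      rcases ih with rfl | ih
      · exact Or.inr this
      · exact Or.inr (this.trans ih)

theorem desc_antisymm {b a : V} (h : F.Desc M b a) (h' : F.Desc M a b) (hb : Rep s F b) :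
    a = b := by
  rcases C.desc_rk h hb with h1 | h1
  · exact h1
  · rcases C.desc_rk h' (C.desc_rep h hb).1 with h2 | h2
    · exact h2.symm
    · omega

theorem desc_of_free {b a : V} (hb : mate M b = b) (ho : s.owner b ≠ none) (h : F.Desc M b a) :
    a = b := by
  induction h with
  | refl => rfl
  | tail _ h5 h6 => rw [← h5, h6, Forest.up_of_mem (C.free_out b hb ho), hb]

/-- Climbing must stop because the rank falls. A fixpoint of `up` cannot be inner, as parents of
inner vertices are outer; so it is a free outer vertex, and the only free vertex of a structure is
its owner. -/
theorem desc_root {b α : V} (hb : Rep s F b) (hα : s.owner b = some α) : F.Desc M b α := by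
  induction hn : rk M s F b using Nat.strong_induction_on generalizing b with
  | _ n ih =>
    by_cases hne : F.up M b = b
    · have hbo : b ∈ F.out := by
        by_contra h
        apply h
        rw [← hne, Forest.up_of_notMem h]
        exact C.base_out _ (C.par_out b h hb.1).1
      rw [Forest.up_of_mem hbo] at hne
      rw [C.owner_eq b α hα hne]
      exact .refl α
    · refine (Forest.desc_up b).trans (ih _ (hn ▸ C.rk_up hb hne) (C.rep_up hb) ?_ rfl)
      rw [C.owner_up hb.1, hα]

theorem rep_base {x : V} (h : x ∈ F.out) : Rep s F (F.base x) := by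
  rw [← Forest.nd_of_mem h]
  exact C.rep_nd (C.out_owner x h)

theorem rep_root {x α : V} (hα : s.owner x = some α) : Rep s F α ∧ α ∈ F.out ∧ F.base α = α := by
  obtain ⟨h1, h2⟩ := C.owner_free x α hα
  have h3 := C.free_out α h1 (by rw [h2]; simp)
  have h4 : F.base α = α := by
    by_contra h
    exact (C.mate_out α h3 h).2.2 h1
  refine ⟨?_, h3, h4⟩
  have := C.rep_base h3
  rwa [h4] at this

/-- Below an inner vertex there is only its mate. -/
theorem desc_mate_of_desc {b x : V} (h : F.Desc M b x) (hb : Rep s F b) (hne : b ≠ x)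
    (hx : x ∉ F.out) : F.Desc M b (mate M x) := by
  rcases Relation.ReflTransGen.cases_tail h with h1 | ⟨c, h1, h2⟩
  · exact absurd h1.symm hne
  · have hc := (C.desc_rep h1 hb).1
    by_cases hco : c ∈ F.out
    · rw [Forest.up_of_mem hco] at h2
      rw [← h2, C.mate_mate]
      exact h1
    · rw [Forest.up_of_notMem hco] at h2
      exact absurd (h2 ▸ C.base_out _ (C.par_out c hco hc.1).1) hx

theorem up_mate {v : V} (h : v ∉ F.out) (hv : s.owner v ≠ none) : F.up M (mate M v) = v := by
  rw [Forest.up_of_mem (C.mate_inner v h hv).1, C.mate_mate]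

/-! ### Comparison with the contracted graphs of the phase state -/

/-- By `arcs_char` a stored arc lies inside a blossom, enters an inner vertex from its parent, or
leads from an inner vertex to its mate. The last two kinds contract to the steps of `up`, and every
such step has its arc by `par_out`. -/
theorem treeArc_iff {α : V} {B D : Set V} : s.TreeArc α B D ↔
    ∃ x y, s.owner x = some α ∧ s.owner y = some α ∧ B = s.root x ∧ D = s.root y ∧
      F.nd y ≠ F.nd x ∧ F.up M (F.nd y) = F.nd x := by
  constructor
  · rintro ⟨hne, x, y, ⟨ha, hx, hy⟩, rfl, rfl⟩
    have hne' : F.nd x ≠ F.nd y := fun h => hne (C.root_eq_iff.2 h)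
    refine ⟨x, y, hx, hy, rfl, rfl, hne'.symm, ?_⟩
    rcases C.arcs_char x y ha with ⟨h1, h2, h3⟩ | ⟨h1, h2⟩ | ⟨h1, h2⟩
    · rw [Forest.nd_of_mem h1, Forest.nd_of_mem h2] at hne'
      exact absurd h3 hne'
    · have h3 := (C.par_out y h1 (by simp [show s.owner y = some α from hy])).1
      rw [Forest.nd_of_notMem h1, Forest.up_of_notMem h1, h2, Forest.nd_of_mem h3]
    · have hx' : s.owner x ≠ none := by simp [show s.owner x = some α from hx]
      have h3 := C.mate_inner x h1 hx'
      rw [Forest.nd_of_notMem h1, h2, Forest.nd_of_mem h3.1, h3.2, C.up_mate h1 hx']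
  · rintro ⟨x, y, hx, hy, rfl, rfl, hne, h⟩
    refine ⟨fun h' => hne (C.root_eq_iff.1 h').symm, ?_⟩
    have hy' : s.owner y ≠ none := by simp [hy]
    by_cases hyo : y ∈ F.out
    · have hb := C.rep_base hyo
      have hbo := C.base_out y hyo
      rw [Forest.nd_of_mem hyo] at h hne
      have h0 := h
      rw [Forest.up_of_mem hbo] at h
      have h1 : mate M (F.base y) ∉ F.out :=
        C.mate_base _ hbo (C.base_base y hyo) (by rw [h]; exact hne.symm)
      have hxo : x ∉ F.out := by
        rw [← C.nd_mem_iff, ← h]; exact h1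
      rw [Forest.nd_of_notMem hxo] at h
      have hx' : s.owner x ≠ none := by simp [hx]
      have hm : mate M x = F.base y := by rw [← h, C.mate_mate]
      refine ⟨x, F.base y, ⟨?_, hx, ?_⟩, rfl, ?_⟩
      · rw [← hm]
        exact (C.par_out x hxo hx').2.2.2
      · change s.owner (F.base y) = some α
        rw [C.base_owner y hyo, hy]
      · rw [C.root_eq_iff, Forest.nd_of_mem hbo, Forest.nd_of_mem hyo, C.base_base y hyo]
    · have hp := C.par_out y hyo hy'
      rw [Forest.nd_of_notMem hyo, Forest.up_of_notMem hyo] at h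
      refine ⟨F.par y, y, ⟨hp.2.2.1, ?_, hy⟩, ?_, rfl⟩
      · change s.owner (F.par y) = some α
        rw [hp.2.1, hy]
      · rw [C.root_eq_iff, ← h, Forest.nd_of_mem hp.1]

/-- `B` is an arbitrary set, since `cycleBlossom` quantifies over ancestors given as sets. -/
theorem isAncestor_iff {α y : V} {B : Set V} (hy : s.owner y = some α) :
    s.IsAncestor α B (s.root y) ↔
      ∃ x, s.owner x = some α ∧ B = s.root x ∧ F.Desc M (F.nd y) (F.nd x) := by
  constructor
  · intro h
    induction h using Relation.ReflTransGen.head_induction_on with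
    | refl => exact ⟨y, hy, rfl, .refl _⟩
    | head h1 _ ih =>
      obtain ⟨x, hx, rfl, hd⟩ := ih
      obtain ⟨x', y', hx', hy', rfl, h2, h3, h4⟩ := C.treeArc_iff.1 h1
      refine ⟨x', hx', rfl, hd.trans ?_⟩
      rw [C.root_eq_iff.1 h2, ← h4]
      exact Forest.desc_up _
  · rintro ⟨x, hx, rfl, h⟩
    have hb := C.rep_nd (x := y) (by simp [hy])
    have key : ∀ a, F.Desc M (F.nd y) a → s.IsAncestor α (s.root a) (s.root y) := by
      intro a ha
      induction ha with
      | refl => rw [C.root_nd]; exact .refl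
      | @tail c d h1 h2 ih =>
        subst h2
        have hc := C.desc_rep h1 hb
        by_cases hne : F.up M c = c
        · rw [hne]; exact ih
        · refine .head (C.treeArc_iff.2 ⟨F.up M c, c, ?_, ?_, rfl, rfl, ?_, ?_⟩) ih
          · rw [C.owner_up hc.1.1, hc.2, C.owner_nd, hy]
          · rw [hc.2, C.owner_nd, hy]
          · rw [hc.1.2, (C.rep_up hc.1).2]; exact Ne.symm hne
          · rw [hc.1.2, (C.rep_up hc.1).2]
    have := key _ h
    rwa [C.root_nd] at this

theorem isAncestor_root_iff {α x y : V} (hx : s.owner x = some α) (hy : s.owner y = some α) :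
    s.IsAncestor α (s.root x) (s.root y) ↔ F.Desc M (F.nd y) (F.nd x) := by
  rw [C.isAncestor_iff hy]
  constructor
  · rintro ⟨x', _, h1, h2⟩
    rwa [C.root_eq_iff.1 h1]
  · exact fun h => ⟨x, hx, rfl, h⟩

/-- Tree arcs alternate between outer and inner vertices and the root is outer. Only the parity of
the depth matters, so uniqueness of the depth is not needed. -/
theorem atDepth_parity {α : V} {n : ℕ} {B : Set V} (h : s.AtDepth α n B) :
    ∃ x, s.owner x = some α ∧ B = s.root x ∧ (Even n ↔ x ∈ F.out) := by
  induction h with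
  | base h => exact ⟨α, h, rfl, iff_of_true (by simp) (C.rep_root h).2.1⟩
  | @step n B D _ h ih =>
    obtain ⟨x, hx, rfl, hp⟩ := ih
    obtain ⟨x', y, hx', hy, h1, rfl, h2, h3⟩ := C.treeArc_iff.1 h
    refine ⟨y, hy, rfl, ?_⟩
    rw [Nat.even_add_one, hp, C.mem_out_of_nd_eq (C.root_eq_iff.1 h1)]
    have hy' : s.owner y ≠ none := by simp [hy]
    have hb := C.rep_nd hy'
    rw [← C.nd_mem_iff, ← h3]
    by_cases hyo : y ∈ F.out
    · rw [Forest.nd_of_mem hyo] at h3 h2 ⊢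
      rw [Forest.up_of_mem (C.base_out y hyo)] at h3 ⊢
      exact iff_of_true (C.mate_base _ (C.base_out y hyo) (C.base_base y hyo)
        (by rw [h3]; exact h2.symm)) hyo
    · rw [Forest.nd_of_notMem hyo, Forest.up_of_notMem hyo]
      exact iff_of_false (not_not.2 (C.base_out _ (C.par_out y hyo hy').1)) hyo

/-- This translates the algorithm's test for outer vertices into membership in `F.out`. -/
theorem isOuter_iff {α x : V} : s.IsOuter α (s.root x) ↔ x ∈ F.out ∧ s.owner x = some α := by
  constructor
  · rintro ⟨n, hn, h⟩
    obtain ⟨y, hy, h1, h2⟩ := C.atDepth_parity h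
    have h3 := C.root_eq_iff.1 h1
    have h4 := h2.1 hn
    refine ⟨(C.mem_out_of_nd_eq h3).2 h4, ?_⟩
    rw [← C.owner_nd, h3, C.owner_nd, hy]
  · rintro ⟨hx, ho⟩
    -- Every vertex of the contracted tree has some depth, by climbing to the root.
    have key : ∀ b, Rep s F b → s.owner b = some α → ∃ n, s.AtDepth α n (s.root b) := by
      intro b
      induction hn : rk M s F b using Nat.strong_induction_on generalizing b with
      | _ n ih =>
        intro hb hbo
        by_cases hne : F.up M b = b
        · have h1 := C.desc_root hb hbo
          have : b = α := by
            by_contra h2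
            rcases C.desc_rk (h1.up_of_ne h2) (C.rep_up hb) with h3 | h3
            · exact h2 (by rw [h3, hne])
            · rcases C.desc_rk h1 hb with h4 | h4
              · exact h2 h4.symm
              · clear ih
                have : ∀ a, F.Desc M b a → a = b := by
                  intro a ha
                  induction ha with
                  | refl => rfl
                  | tail _ h5 h6 => rw [← h5, h6, hne]
                exact h2 (this α h1).symm
          subst this
          exact ⟨0, .base hbo⟩
        · obtain ⟨m, hm⟩ := ih _ (hn ▸ C.rk_up hb hne) _ rfl (C.rep_up hb)
            (by rw [C.owner_up hb.1, hbo])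
          refine ⟨m + 1, .step hm (C.treeArc_iff.2 ⟨F.up M b, b, ?_, hbo, rfl, rfl, ?_, ?_⟩)⟩
          · rw [C.owner_up hb.1, hbo]
          · rw [hb.2, (C.rep_up hb).2]; exact Ne.symm hne
          · rw [hb.2, (C.rep_up hb).2]
    obtain ⟨n, hn⟩ := key _ (C.rep_nd (x := x) (by simp [ho])) (by rw [C.owner_nd, ho])
    rw [C.root_nd] at hn
    obtain ⟨y, _, h1, h2⟩ := C.atDepth_parity hn
    exact ⟨n, h2.2 ((C.mem_out_of_nd_eq (C.root_eq_iff.1 h1)).1 hx), hn⟩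

/-- All vertices of a blossom other than the base are matched inside it. So only the base can be
free, and only the matched arc at the base can enter the blossom. -/
theorem distance_iff {u : V} {d : ℕ} (hu : u ∈ F.out) :
    s.Distance M u d ↔ d = dist M s (F.base u) := by
  have hbo := C.base_out u hu
  have hbb := C.base_base u hu
  have hfree : (∃ f ∈ s.root u, IsFree M f) ↔ mate M (F.base u) = F.base u := by
    rw [C.root_out u hu]
    constructor
    · rintro ⟨f, ⟨h1, h2⟩, h3⟩
      rw [isFree_iff_mate] at h3
      have : F.base f = f := by
        by_contra h
        exact (C.mate_out f h1 h).2.2 h3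
      rw [← h2, this, h3]
    · intro h
      exact ⟨F.base u, ⟨hbo, hbb⟩, isFree_iff_mate.2 h⟩
  unfold PhaseState.Distance
  by_cases hf : mate M (F.base u) = F.base u
  · rw [dist, if_pos hf]
    have hf' := hfree.2 hf
    constructor
    · rintro (h | ⟨h, _⟩)
      · exact h.2
      · obtain ⟨f, h1, h2⟩ := hf'
        exact absurd h2 (h f h1)
    · exact fun h => Or.inl ⟨hf', h⟩
  · rw [dist, if_neg hf]
    have hf' := fun h => hf (hfree.1 h)
    have hm := C.mate_base _ hbo hbb hf
    constructor
    · rintro (h | ⟨_, x, y, h1, h2, h3, h4⟩)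
      · exact absurd h.1 hf'
      · rw [C.root_out u hu] at h2 h3
        have hxy := (adj_iff_mate C.isMatching).1 h1.symm
        have : F.base y = y := by
          by_contra h
          have h5 := C.mate_out y h3.1 h
          rw [hxy.1] at h5
          exact h2 ⟨h5.1, h5.2.1.trans h3.2⟩
        rw [← h3.2, this, hxy.1, h4]
    · intro h
      refine Or.inr ⟨fun f h1 h2 => hf' ⟨f, h1, h2⟩, mate M (F.base u), F.base u, ?_, ?_, ?_, h⟩
      · exact ((adj_iff_mate C.isMatching).2 ⟨rfl, hf⟩).symm
      · rw [C.root_out u hu]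
        exact fun h => hm h.1
      · rw [C.root_out u hu]
        exact ⟨hbo, hbb⟩

theorem isWorkingAt_iff {α u : V} : s.IsWorkingAt α u ↔
    u ∈ F.out ∧ s.owner u = some α ∧ s.work α = some (s.root u) := by
  constructor
  · rintro ⟨h1, h2⟩
    obtain ⟨x, hx, _, h3⟩ := C.work_eq α _ h2
    exact ⟨(C.mem_out_of_nd_eq (C.root_eq_iff.1 h3)).2 hx, h1, h2⟩
  · rintro ⟨_, h1, h2⟩
    exact ⟨h1, h2⟩

end Core

end

/-! ### Overtaking -/

section

variable {V : Type*} {G : SimpleGraph V}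

open Classical in
/-- The forest after the subtree at `v`, with `t` the mate of `v`, was hung below `u`. -/
noncomputable def Forest.reparent (F : Forest V) (u v t : V) : Forest V :=
  ⟨insert t F.out, fun x => if x = t then t else F.base x, fun x => if x = v then u else F.par x⟩

/-- The arc `(u, v)` is ready for overtaking the matched arc `(v, t)`. -/
structure Overtaking (M : G.Subgraph) (s : PhaseState G) (F : Forest V) (α u v t : V) (k : ℕ) :
    Prop where
  u_out : u ∈ F.out
  u_owner : s.owner u = some α
  u_work : s.work α = some (s.root u)
  v_notOut : v ∉ F.out
  v_notRemoved : v ∉ s.removed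
  adj : G.Adj u v
  mate_v : mate M v = t
  ne : v ≠ t
  k_eq : k = dist M s (F.base u) + 1
  k_lt : k < lab M s v

/-- The vertices in the subtree at `v`. -/
def movedSet (M : G.Subgraph) (s : PhaseState G) (F : Forest V) (v t : V) : Set V :=
  {x | x = v ∨ x = t ∨ (s.owner x ≠ none ∧ s.owner v ≠ none ∧ F.Desc M (F.nd x) v)}

open Classical in
/-- A common description of the three cases of `Overtake`. -/
structure Reparented (M : G.Subgraph) (s : PhaseState G) (F : Forest V) (α u v t : V) (k : ℕ)
    (s' : PhaseState G) : Prop where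
  owner : ∀ x, s'.owner x = if x ∈ movedSet M s F v t then some α else s.owner x
  arcs : ∀ x y, (x, y) ∈ s'.arcs ↔
    (x = u ∧ y = v) ∨ (x = v ∧ y = t) ∨ ((x, y) ∈ s.arcs ∧ y ≠ v)
  root : s'.root = s.root
  label : ∀ x y, s'.label x y = if x = v ∧ y = t then k else s.label x y
  removed : s'.removed = s.removed
  onHold : s'.onHold = s.onHold
  paths : s'.paths = s.paths
  modified : ∀ β, β ∈ s'.modified ↔ β ∈ s.modified ∨ β = α ∨ s.owner v = some β
  work : (∃ β y, s.owner v = some β ∧ β ≠ α ∧ s.work β = some (s.root y) ∧ y ∈ F.out ∧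
      s.owner y = some β ∧ F.Desc M (F.nd y) t ∧
      ∀ γ, s'.work γ = if γ = α then some (s.root y) else if γ = β then some (s.root (F.par v))
        else s.work γ) ∨
    ((∀ β y, s.owner v = some β → β ≠ α → s.work β = some (s.root y) → s.owner y = some β →
      ¬ F.Desc M (F.nd y) t) ∧ ∀ γ, s'.work γ = if γ = α then some (s.root t) else s.work γ)

variable {M : G.Subgraph} {s s' : PhaseState G} {F : Forest V} {ℓ k : ℕ} {α u v t : V}

namespace Core

/-- Matched vertices lie below the same inner vertices. -/
theorem desc_mate_iff (C : Core M s F ℓ) {x w : V} (hx : s.owner x ≠ none) (hw : w ∉ F.out) :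
    F.Desc M (F.nd (mate M x)) w ↔ F.Desc M (F.nd x) w := by
  have inner : ∀ y ∉ F.out, s.owner y ≠ none →
      (F.Desc M (F.nd (mate M y)) w ↔ F.Desc M (F.nd y) w) := by
    intro y hy hyo
    have h1 := C.mate_inner y hy hyo
    rw [Forest.nd_of_mem h1.1, h1.2, Forest.nd_of_notMem hy]
    constructor
    · intro h
      have := h.up_of_ne (by rintro rfl; exact hw h1.1)
      rwa [C.up_mate hy hyo] at this
    · intro h
      have := Forest.desc_up (F := F) (M := M) (mate M y)
      rw [C.up_mate hy hyo] at this
      exact this.trans h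
  by_cases hxo : x ∈ F.out
  · by_cases hb : F.base x = x
    · by_cases hf : mate M x = x
      · rw [hf]
      · have h1 := inner (mate M x) (C.mate_base x hxo hb hf) (by rwa [C.mate_owner])
        rw [C.mate_mate] at h1
        exact h1.symm
    · have := C.mate_out x hxo hb
      rw [Forest.nd_of_mem this.1, this.2.1, Forest.nd_of_mem hxo]
  · exact inner x hxo hx

end Core

namespace Overtaking

variable (O : Overtaking M s F α u v t k) (C : Core M s F ℓ)
include O C

theorem mate_t : mate M t = v := by rw [← O.mate_v, C.mate_mate]

theorem owner_t : s.owner t = s.owner v := by rw [← O.mate_v, C.mate_owner]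

theorem t_notRemoved : t ∉ s.removed := by
  intro h
  have := C.mate_removed t h
  rw [O.mate_t C] at this
  exact O.v_notRemoved this

theorem t_of_visited (h : s.owner v ≠ none) : t ∈ F.out ∧ F.base t = t := by
  rw [← O.mate_v]; exact C.mate_inner v O.v_notOut h

theorem base_t (h : t ∈ F.out) : F.base t = t := by
  refine (O.t_of_visited C ?_).2
  rw [← O.owner_t C]
  exact C.out_owner t h

theorem base_reparent {x : V} (hx : x ∈ F.out) : (F.reparent u v t).base x = F.base x := by
  unfold Forest.reparent
  dsimp only
  split_ifs with h
  · subst h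
    exact (O.base_t C hx).symm
  · rfl

theorem base_reparent_self : (F.reparent u v t).base t = t := if_pos rfl

theorem mem_reparent {x : V} : x ∈ (F.reparent u v t).out ↔ x = t ∨ x ∈ F.out := Iff.rfl

theorem nd_reparent (x : V) : (F.reparent u v t).nd x = F.nd x := by
  by_cases hx : x ∈ F.out
  · rw [Forest.nd_of_mem hx, Forest.nd_of_mem (Or.inr hx), O.base_reparent C hx]
  · rw [Forest.nd_of_notMem hx]
    by_cases h : x = t
    · subst h
      rw [Forest.nd_of_mem (Or.inl rfl), O.base_reparent_self C]
    · exact Forest.nd_of_notMem (by rintro (h' | h'); exacts [h h', hx h'])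

theorem dist_t (h : s.owner v ≠ none) : dist M s t = lab M s v := by
  rw [C.dist_eq, O.mate_t C]
  rw [O.mate_t C]
  exact O.ne

/-- The blossom of `u` has distance k − 1, whereas `t` has the distance `lab M s v`, which exceeds
k. -/
theorem base_u_ne : F.base u ≠ t := by
  intro h
  have h1 : s.owner v ≠ none := by
    rw [← O.owner_t C, ← h]
    exact C.out_owner _ (C.base_out u O.u_out)
  have h2 := O.k_eq
  have h3 := O.k_lt
  rw [h, O.dist_t C h1] at h2
  omega

theorem u_ne_t : u ≠ t := by
  intro h
  apply O.base_u_ne C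
  have h1 := O.u_out
  rw [h] at h1 ⊢
  exact O.base_t C h1

/-- An ancestor `v` of `u` would have smaller rank than the blossom of `u`, hence a label at most k
− 1; but its label exceeds k. So hanging `v` below `u` closes no cycle. -/
theorem not_desc_u (h : s.owner v ≠ none) : ¬ F.Desc M (F.nd u) v := by
  intro hd
  have hu := O.u_out
  have h1 := C.desc_rk hd (C.rep_nd (C.out_owner u hu))
  rw [Forest.nd_of_mem hu] at h1
  have h2 := O.k_eq
  have h3 := O.k_lt
  rcases h1 with h1 | h1
  · exact O.v_notOut (h1 ▸ C.base_out u hu)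
  · rw [rk, if_neg O.v_notOut, rk, if_pos (C.base_out u hu)] at h1
    omega

theorem mem_movedSet_iff {x : V} (hv : s.owner v ≠ none) :
    x ∈ movedSet M s F v t ↔ s.owner x ≠ none ∧ F.Desc M (F.nd x) v := by
  constructor
  · rintro (rfl | rfl | ⟨h1, _, h2⟩)
    · refine ⟨hv, ?_⟩
      rw [Forest.nd_of_notMem O.v_notOut]
      exact .refl _
    · refine ⟨by rwa [O.owner_t C], ?_⟩
      rw [← O.mate_v, C.desc_mate_iff hv O.v_notOut, Forest.nd_of_notMem O.v_notOut]
      exact .refl _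
    · exact ⟨h1, h2⟩
  · rintro ⟨h1, h2⟩
    exact Or.inr (Or.inr ⟨h1, hv, h2⟩)

theorem mem_movedSet_of_unvisited {x : V} (hv : s.owner v = none) :
    x ∈ movedSet M s F v t ↔ x = v ∨ x = t := by
  constructor
  · rintro (h | h | ⟨_, h, _⟩)
    exacts [Or.inl h, Or.inr h, absurd hv h]
  · rintro (h | h)
    exacts [Or.inl h, Or.inr (Or.inl h)]

theorem owner_of_moved {x : V} (hx : x ∈ movedSet M s F v t) : s.owner x = s.owner v := by
  rcases hx with rfl | rfl | ⟨h1, _, h2⟩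
  · rfl
  · exact O.owner_t C
  · rw [← C.owner_nd, (C.desc_rep h2 (C.rep_nd h1)).2]

theorem u_notMoved : u ∉ movedSet M s F v t := by
  rintro (h | h | ⟨_, h1, h2⟩)
  · exact O.v_notOut (h ▸ O.u_out)
  · exact O.u_ne_t C h
  · exact O.not_desc_u C h1 h2

theorem free_notMoved {x : V} (hx : mate M x = x) : x ∉ movedSet M s F v t := by
  rintro (h | h | ⟨h1, h2, h3⟩)
  · rw [h, O.mate_v] at hx; exact O.ne hx.symm
  · rw [h, O.mate_t C] at hx; exact O.ne hx
  · have hxo := C.free_out x hx h1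
    have hb : F.base x = x := by
      by_contra h
      exact (C.mate_out x hxo h).2.2 hx
    rw [Forest.nd_of_mem hxo, hb] at h3
    have := C.desc_of_free hx h1 h3
    exact O.v_notOut (this ▸ hxo)

/-- This and the next two lemmas: the moved set is a union of blossoms, closed under mates, and
compatible with parents except at `v`. Hence changing the owner on it tears apart no blossom, no
matched pair and no tree arc other than the one entering `v`. -/
theorem moved_of_nd_eq {x y : V} (h : F.nd x = F.nd y) (hx : s.owner x ≠ none) :
    x ∈ movedSet M s F v t ↔ y ∈ movedSet M s F v t := by
  have hy : s.owner y ≠ none := by rwa [← C.owner_nd, ← h, C.owner_nd]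
  by_cases hv : s.owner v = none
  · refine iff_of_false ?_ ?_ <;> intro h
    · exact hx (by rw [O.owner_of_moved C h, hv])
    · exact hy (by rw [O.owner_of_moved C h, hv])
  · rw [O.mem_movedSet_iff C hv, O.mem_movedSet_iff C hv, h]
    exact and_congr_left fun _ => iff_of_true hx hy

theorem moved_mate {x : V} : mate M x ∈ movedSet M s F v t ↔ x ∈ movedSet M s F v t := by
  by_cases hv : s.owner v = none
  · rw [O.mem_movedSet_of_unvisited C hv, O.mem_movedSet_of_unvisited C hv]
    constructor
    · rintro (h | h)
      · right; rw [← O.mate_v, ← h, C.mate_mate]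
      · left; rw [← C.mate_mate x, h, O.mate_t C]
    · rintro (rfl | rfl)
      · right; exact O.mate_v
      · left; exact O.mate_t C
  · rw [O.mem_movedSet_iff C hv, O.mem_movedSet_iff C hv, C.mate_owner]
    exact and_congr_right fun h => C.desc_mate_iff h O.v_notOut

theorem moved_par {w : V} (hw : w ∉ F.out) (hwo : s.owner w ≠ none) (hne : w ≠ v) :
    F.par w ∈ movedSet M s F v t ↔ w ∈ movedSet M s F v t := by
  have hp := C.par_out w hw hwo
  by_cases hv : s.owner v = none
  · refine iff_of_false ?_ ?_ <;> intro h
    · exact hwo (by rw [← hp.2.1, O.owner_of_moved C h, hv])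
    · exact hwo (by rw [O.owner_of_moved C h, hv])
  · rw [O.mem_movedSet_iff C hv, O.mem_movedSet_iff C hv, hp.2.1, Forest.nd_of_notMem hw,
      Forest.nd_of_mem hp.1, ← Forest.up_of_notMem (M := M) hw]
    refine and_congr_right fun _ => ⟨fun h => (Forest.desc_up w).trans h, fun h => h.up_of_ne hne⟩

/-- Needed because the structure that loses the subtree may continue with the blossom of `F.par v`
as its working vertex. -/
theorem par_v_notMoved (hv : s.owner v ≠ none) : F.par v ∉ movedSet M s F v t := by
  rw [O.mem_movedSet_iff C hv]
  rintro ⟨_, h⟩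
  have hp := C.par_out v O.v_notOut hv
  rw [Forest.nd_of_mem hp.1, ← Forest.up_of_notMem (M := M) O.v_notOut] at h
  have hr := rep_of_notOut O.v_notOut hv
  have := C.desc_antisymm h (Forest.desc_up v) (C.rep_up hr)
  apply O.v_notOut
  rw [this, Forest.up_of_notMem O.v_notOut]
  exact C.base_out _ hp.1

end Overtaking

namespace Reparented

variable (R : Reparented M s F α u v t k s') (O : Overtaking M s F α u v t k) (C : Core M s F ℓ)
include R O C

theorem owner_moved {x : V} (h : x ∈ movedSet M s F v t) : s'.owner x = some α := by
  rw [R.owner, if_pos h]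

theorem owner_notMoved {x : V} (h : x ∉ movedSet M s F v t) : s'.owner x = s.owner x := by
  rw [R.owner, if_neg h]

theorem owner_ne_none {x : V} : s'.owner x ≠ none ↔ x = v ∨ x = t ∨ s.owner x ≠ none := by
  by_cases h : x ∈ movedSet M s F v t
  · rw [R.owner_moved O C h]
    refine iff_of_true (by simp) ?_
    rcases h with h | h | h
    exacts [Or.inl h, Or.inr (Or.inl h), Or.inr (Or.inr h.1)]
  · rw [R.owner_notMoved O C h]
    constructor
    · exact fun h => Or.inr (Or.inr h)
    · rintro (h' | h' | h')
      · exact absurd (Or.inl h') h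
      · exact absurd (Or.inr (Or.inl h')) h
      · exact h'

theorem lab_eq {x : V} (h : x ≠ v) : lab M s' x = lab M s x := by
  rw [lab, R.label, if_neg (fun h' => h h'.1)]
  rfl

theorem lab_v : lab M s' v = k := by
  rw [lab, R.label, if_pos ⟨rfl, O.mate_v⟩]

theorem dist_eq {b : V} (h : b ≠ t) : dist M s' b = dist M s b := by
  unfold dist
  split_ifs
  · rfl
  · rw [R.label, if_neg (fun h' => h h'.2)]

theorem dist_t : dist M s' t = k := by
  have : mate M t ≠ t := by rw [O.mate_t C]; exact O.ne
  rw [dist, if_neg this, R.label, if_pos ⟨O.mate_t C, rfl⟩]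

theorem lab_v_le : lab M s v ≤ ℓ + 1 := by
  by_cases hv : s.owner v = none
  · exact (C.lab_none v hv O.v_notRemoved (by rw [O.mate_v]; exact O.ne.symm)).le
  · exact (C.lab_le v O.v_notOut hv).trans (Nat.le_succ _)

/-- Besides owners and working vertices, only the parent of `v`, the label of `v` (equivalently the
distance of `t`) and possibly the status of `t` change. The label inequality holds at `v` since k is
the distance of `u` plus one. -/
theorem core : Core M s' (F.reparent u v t) ℓ := by
  have hvis : ∀ w, w ∉ (F.reparent u v t).out → s'.owner w ≠ none → w ≠ v →
      w ∉ F.out ∧ s.owner w ≠ none := by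
    intro w hw hwo hne
    refine ⟨fun h => hw (Or.inr h), ?_⟩
    rcases (R.owner_ne_none O C).1 hwo with h | h | h
    · exact absurd h hne
    · exact absurd (Or.inl h) hw
    · exact h
  have howner_iff : ∀ {x y : V}, s.owner x = s.owner y →
      (x ∈ movedSet M s F v t ↔ y ∈ movedSet M s F v t) → s'.owner x = s'.owner y := by
    intro x y h1 h2
    by_cases h : x ∈ movedSet M s F v t
    · rw [R.owner_moved O C h, R.owner_moved O C (h2.1 h)]
    · rw [R.owner_notMoved O C h, R.owner_notMoved O C (fun h' => h (h2.2 h')), h1]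
  have hpar : ∀ w, w ≠ v → (F.reparent u v t).par w = F.par w :=
    fun w hw => if_neg hw
  have hparv : (F.reparent u v t).par v = u := if_pos rfl
  refine
    { isMatching := C.isMatching
      free_owner := ?_, owner_free := ?_, owner_eq := ?_, free_out := ?_, out_owner := ?_
      removed_owner := ?_, mate_removed := ?_, mate_owner := ?_, base_out := ?_, base_base := ?_
      base_owner := ?_, mate_out := ?_, mate_base := ?_, mate_inner := ?_, par_out := ?_
      root_out := ?_, root_notOut := ?_, arcs_adj := ?_, arcs_owner := ?_, arcs_char := ?_
      lab_lt := ?_, lab_le := ?_, lab_none := ?_, work_eq := ?_ }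
  · intro x hx hr
    rw [R.owner_notMoved O C (O.free_notMoved C hx)]
    exact C.free_owner x hx (R.removed ▸ hr)
  · intro x β hx
    have h1 : mate M β = β ∧ s.owner β = some β := by
      by_cases h : x ∈ movedSet M s F v t
      · rw [R.owner_moved O C h, Option.some_inj] at hx
        subst hx
        exact C.owner_free u α O.u_owner
      · rw [R.owner_notMoved O C h] at hx
        exact C.owner_free x β hx
    refine ⟨h1.1, ?_⟩
    rw [R.owner_notMoved O C (O.free_notMoved C h1.1), h1.2]
  · intro x β hx hf
    rw [R.owner_notMoved O C (O.free_notMoved C hf)] at hx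
    exact C.owner_eq x β hx hf
  · intro x hf hx
    rw [R.owner_notMoved O C (O.free_notMoved C hf)] at hx
    exact Or.inr (C.free_out x hf hx)
  · intro x hx
    rw [R.owner_ne_none O C]
    rcases hx with h | h
    · exact Or.inr (Or.inl h)
    · exact Or.inr (Or.inr (C.out_owner x h))
  · intro x hx
    rw [R.removed] at hx
    by_contra h
    rcases (R.owner_ne_none O C).1 h with rfl | rfl | h
    · exact O.v_notRemoved hx
    · exact O.t_notRemoved C hx
    · exact h (C.removed_owner x hx)
  · rw [R.removed]; exact C.mate_removed
  · intro x
    exact howner_iff (C.mate_owner x) (O.moved_mate C)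
  · rintro x (rfl | hx)
    · rw [O.base_reparent_self C]; exact Or.inl rfl
    · rw [O.base_reparent C hx]; exact Or.inr (C.base_out x hx)
  · rintro x (rfl | hx)
    · rw [O.base_reparent_self C, O.base_reparent_self C]
    · rw [O.base_reparent C hx, O.base_reparent C (C.base_out x hx), C.base_base x hx]
  · rintro x (rfl | hx)
    · rw [O.base_reparent_self C]
    · rw [O.base_reparent C hx]
      refine howner_iff (C.base_owner x hx) (O.moved_of_nd_eq C ?_ ?_)
      · rw [← Forest.nd_of_mem hx, C.nd_nd]
      · rw [C.base_owner x hx]; exact C.out_owner x hx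
  · rintro x (rfl | hx) h
    · exact absurd (O.base_reparent_self C) h
    · rw [O.base_reparent C hx] at h ⊢
      have := C.mate_out x hx h
      rw [O.base_reparent C this.1]
      exact ⟨Or.inr this.1, this.2⟩
  · rintro x (rfl | hx) h hm
    · rw [O.mate_t C]
      rintro (h' | h')
      · exact O.ne h'
      · exact O.v_notOut h'
    · rw [O.base_reparent C hx] at h
      have := C.mate_base x hx h hm
      rintro (h' | h')
      · have hxv : x = v := by rw [← O.mate_t C, ← h', C.mate_mate]
        exact O.v_notOut (hxv ▸ hx)
      · exact this h'
  · intro w hw hwo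
    by_cases hne : w = v
    · subst hne
      rw [O.mate_v]
      exact ⟨Or.inl rfl, O.base_reparent_self C⟩
    · obtain ⟨h1, h2⟩ := hvis w hw hwo hne
      have := C.mate_inner w h1 h2
      rw [O.base_reparent C this.1]
      exact ⟨Or.inr this.1, this.2⟩
  · intro w hw hwo
    by_cases hne : w = v
    · subst hne
      rw [hparv, R.owner_notMoved O C (O.u_notMoved C), R.owner_moved O C (Or.inl rfl), O.mate_v]
      exact ⟨Or.inr O.u_out, O.u_owner, (R.arcs _ _).2 (Or.inl ⟨rfl, rfl⟩),
        (R.arcs _ _).2 (Or.inr (Or.inl ⟨rfl, rfl⟩))⟩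
    · obtain ⟨h1, h2⟩ := hvis w hw hwo hne
      have := C.par_out w h1 h2
      rw [hpar w hne]
      refine ⟨Or.inr this.1, howner_iff this.2.1 (O.moved_par C h1 h2 hne),
        (R.arcs _ _).2 (Or.inr (Or.inr ⟨this.2.2.1, hne⟩)),
        (R.arcs _ _).2 (Or.inr (Or.inr ⟨this.2.2.2, ?_⟩))⟩
      intro h
      exact hw (Or.inl (by rw [← C.mate_mate w, h, O.mate_v]))
  · have key : ∀ x, s.root x = {y | F.nd y = F.nd x} := by
      intro x; ext y; exact C.mem_root_iff
    intro x hx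
    rw [R.root, key]
    ext y
    have hx' : (F.reparent u v t).base x = F.nd x := by
      rw [← Forest.nd_of_mem hx, O.nd_reparent C]
    change _ ↔ _ ∧ _
    rw [hx']
    constructor
    · intro hy
      change F.nd y = F.nd x at hy
      have hyo : y ∈ (F.reparent u v t).out := by
        rcases hx with rfl | hx
        · by_cases ht : x ∈ F.out
          · exact Or.inr ((C.mem_out_of_nd_eq hy).2 ht)
          · have hyn := (C.mem_out_of_nd_eq hy).not.2 ht
            rw [Forest.nd_of_notMem ht, Forest.nd_of_notMem hyn] at hy
            exact Or.inl hy
        · exact Or.inr ((C.mem_out_of_nd_eq hy).2 hx)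
      refine ⟨hyo, ?_⟩
      rw [← Forest.nd_of_mem hyo, O.nd_reparent C, hy]
    · rintro ⟨hyo, hy⟩
      rw [← Forest.nd_of_mem hyo, O.nd_reparent C] at hy
      exact hy
  · intro x hx
    rw [R.root]
    exact C.root_notOut x fun h => hx (Or.inr h)
  · intro x y hxy
    rcases (R.arcs x y).1 hxy with ⟨rfl, rfl⟩ | ⟨rfl, rfl⟩ | ⟨h, _⟩
    · exact O.adj
    · exact ((adj_iff_mate C.isMatching).2 ⟨O.mate_v, by rw [O.mate_v]; exact O.ne.symm⟩).adj_sub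
    · exact C.arcs_adj x y h
  · intro x y hxy
    rcases (R.arcs x y).1 hxy with ⟨rfl, rfl⟩ | ⟨rfl, rfl⟩ | ⟨h, hne⟩
    · rw [R.owner_notMoved O C (O.u_notMoved C), R.owner_moved O C (Or.inl rfl), O.u_owner]
      simp
    · rw [R.owner_moved O C (Or.inl rfl), R.owner_moved O C (Or.inr (Or.inl rfl))]
      simp
    · obtain ⟨h1, h2⟩ := C.arcs_owner x y h
      refine ⟨(R.owner_ne_none O C).2 (Or.inr (Or.inr h1)), howner_iff h2 ?_⟩
      rcases C.arcs_char x y h with ⟨h3, h4, h5⟩ | ⟨h3, h4⟩ | ⟨h3, h4⟩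
      · exact O.moved_of_nd_eq C (by rw [Forest.nd_of_mem h3, Forest.nd_of_mem h4, h5]) h1
      · rw [h4]
        exact O.moved_par C h3 (h2 ▸ h1) hne
      · rw [h4]
        exact (O.moved_mate C).symm
  · intro x y hxy
    rcases (R.arcs x y).1 hxy with ⟨rfl, rfl⟩ | ⟨rfl, rfl⟩ | ⟨h, hne⟩
    · refine Or.inr (Or.inl ⟨?_, hparv.symm⟩)
      rintro (h | h)
      exacts [O.ne h, O.v_notOut h]
    · refine Or.inr (Or.inr ⟨?_, O.mate_v.symm⟩)
      rintro (h | h)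
      exacts [O.ne h, O.v_notOut h]
    · obtain ⟨h1, h2⟩ := C.arcs_owner x y h
      have hto : ∀ z, z ∉ F.out → s.owner z ≠ none → z ∉ (F.reparent u v t).out := by
        rintro z hz hzo (rfl | h')
        · exact hz (O.t_of_visited C (by rwa [← O.owner_t C])).1
        · exact hz h'
      rcases C.arcs_char x y h with ⟨h3, h4, h5⟩ | ⟨h3, h4⟩ | ⟨h3, h4⟩
      · left
        rw [O.base_reparent C h3, O.base_reparent C h4]
        exact ⟨Or.inr h3, Or.inr h4, h5⟩
      · right; left
        rw [hpar y hne]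
        exact ⟨hto y h3 (h2 ▸ h1), h4⟩
      · exact Or.inr (Or.inr ⟨hto x h3 h1, h4⟩)
  · intro w hw hwo
    by_cases hne : w = v
    · subst hne
      rw [hparv, O.base_reparent C O.u_out, R.dist_eq O C (O.base_u_ne C), R.lab_v O C, O.k_eq]
      exact Nat.lt_succ_self _
    · obtain ⟨h1, h2⟩ := hvis w hw hwo hne
      have h3 := C.lab_lt w h1 h2
      have h4 := (C.par_out w h1 h2).1
      rw [hpar w hne, O.base_reparent C h4, R.lab_eq O C hne]
      -- Children of `t` keep labels above its distance, which fell from the old label of `v` to k.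
      by_cases h5 : F.base (F.par w) = t
      · rw [h5, R.dist_t O C]
        rw [h5, O.dist_t C] at h3
        · exact O.k_lt.trans h3
        · rw [← O.owner_t C, ← h5]
          exact C.out_owner _ (C.base_out _ h4)
      · rwa [R.dist_eq O C h5]
  · intro w hw hwo
    by_cases hne : w = v
    · subst hne
      rw [R.lab_v O C]
      have := R.lab_v_le O C
      have := O.k_lt
      omega
    · obtain ⟨h1, h2⟩ := hvis w hw hwo hne
      rw [R.lab_eq O C hne]
      exact C.lab_le w h1 h2
  · intro w hwo hr hm
    have h1 : w ∉ movedSet M s F v t := by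
      intro h
      rw [R.owner_moved O C h] at hwo
      cases hwo
    rw [R.owner_notMoved O C h1] at hwo
    rw [R.lab_eq O C (fun h => h1 (Or.inl h))]
    exact C.lab_none w hwo (R.removed ▸ hr) hm
  · intro γ W hW
    rw [R.root]
    rcases R.work with ⟨β, y, hv, hβ, hy1, hy2, hy3, hy4, hw⟩ | ⟨hno, hw⟩
    · have hv' : s.owner v ≠ none := by simp [hv]
      rw [hw] at hW
      split_ifs at hW with h1 h2
      · subst h1
        refine ⟨y, Or.inr hy2, R.owner_moved O C ?_, (Option.some_inj.1 hW).symm⟩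
        rw [O.mem_movedSet_iff C hv']
        refine ⟨by simp [hy3], hy4.trans ?_⟩
        have := Forest.desc_up (F := F) (M := M) t
        rwa [Forest.up_of_mem (O.t_of_visited C hv').1, O.mate_t C] at this
      · subst h2
        have hp := C.par_out v O.v_notOut hv'
        refine ⟨F.par v, Or.inr hp.1, ?_, (Option.some_inj.1 hW).symm⟩
        rw [R.owner_notMoved O C (O.par_v_notMoved C hv'), hp.2.1, hv]
      · obtain ⟨x, hx1, hx2, hx3⟩ := C.work_eq γ W hW
        refine ⟨x, Or.inr hx1, ?_, hx3⟩
        rw [R.owner_notMoved O C, hx2]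
        intro h
        have := O.owner_of_moved C h
        rw [hx2, hv, Option.some_inj] at this
        exact h2 this
    · rw [hw] at hW
      split_ifs at hW with h1
      · subst h1
        exact ⟨t, Or.inl rfl, R.owner_moved O C (Or.inr (Or.inl rfl)), (Option.some_inj.1 hW).symm⟩
      · obtain ⟨x, hx1, hx2, hx3⟩ := C.work_eq γ W hW
        refine ⟨x, Or.inr hx1, ?_, hx3⟩
        rw [R.owner_notMoved O C, hx2]
        intro h
        have h2 := O.owner_of_moved C h
        rw [hx2] at h2
        have hv' : s.owner v ≠ none := by simp [← h2]
        subst hx3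
        -- A working vertex is outer, so if it were in the moved subtree it would lie below `t` and
        -- not only below `v`. That is the case excluded here.
        refine hno γ x h2.symm h1 hW hx2 ?_
        rw [← O.mate_v]
        refine C.desc_mate_of_desc ((O.mem_movedSet_iff C hv').1 h).2 (C.rep_nd (by simp [hx2])) ?_
          O.v_notOut
        intro h'
        exact O.v_notOut (h' ▸ (C.nd_mem_iff x).2 hx1)

end Reparented

end

/-! ### Invariants of a phase -/

section

variable {V : Type*} {G : SimpleGraph V}

/-- The vertex of the forest represented by `b` is on the active path of its structure. -/
def OnPath (M : G.Subgraph) (s : PhaseState G) (F : Forest V) (b : V) : Prop :=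
  ∃ α y, s.owner b = some α ∧ s.owner y = some α ∧ s.work α = some (s.root y) ∧
    F.Desc M (F.nd y) b

/-- What remains unchanged, or changes monotonically, in the steps of a pass-bundle. -/
structure Evolves (M : G.Subgraph) (s : PhaseState G) (F : Forest V) (s' : PhaseState G)
    (F' : Forest V) : Prop where
  label_le : ∀ x y, s'.label x y ≤ s.label x y
  removed_mono : s.removed ⊆ s'.removed
  out_mono : ∀ x ∈ F.out, x ∈ F'.out ∨ x ∈ s'.removed
  onHold : s'.onHold = s.onHold
  modified_mono : s.modified ⊆ s'.modified
  work_none : ∀ α, s.work α = none → s'.work α = none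
  work : ∀ α ∉ s'.modified, s'.work α = s.work α
  owner : ∀ α ∉ s'.modified, ∀ x, s'.owner x = some α ↔ s.owner x = some α
  out_iff : ∀ α ∉ s'.modified, ∀ x, s'.owner x = some α → (x ∈ F'.out ↔ x ∈ F.out)
  root : ∀ α ∉ s'.modified, ∀ x, s'.owner x = some α → s'.root x = s.root x
  dist : ∀ α ∉ s'.modified, ∀ x ∈ F.out, s'.owner x = some α →
    dist M s' (F'.base x) = dist M s (F.base x)

/-- Outer vertices off the active paths were explored. -/
def Explored (M : G.Subgraph) (s : PhaseState G) (F : Forest V) : Prop :=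
  ∀ x ∈ F.out, ¬ OnPath M s F (F.base x) → ∀ y, G.Adj x y → y ∉ F.out → y ∉ s.removed →
    lab M s y ≤ dist M s (F.base x) + 1

/-- An edge between different outer blossoms that does not join two free vertices is at the
working vertex of a modified structure. -/
def FreshPairs (M : G.Subgraph) (s : PhaseState G) (F : Forest V) : Prop :=
  ∀ x ∈ F.out, ∀ y ∈ F.out, G.Adj x y → (mate M x ≠ x ∨ mate M y ≠ y) → F.base x ≠ F.base y →
    ∃ z, (z = x ∨ z = y) ∧ ∃ γ, s.owner z = some γ ∧ s.work γ = some (s.root z) ∧ γ ∈ s.modified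

/-- The vertices below the inner vertex `v`. -/
def below (M : G.Subgraph) (s : PhaseState G) (F : Forest V) (v : V) : Set V :=
  {x | s.owner x ≠ none ∧ F.Desc M (F.nd x) v}

/-- Bounds on the sizes of the structures and their subtrees. -/
structure Sizes (M : G.Subgraph) (s : PhaseState G) (F : Forest V) (ℓ L : ℕ) : Prop where
  below : ∀ v ∉ F.out, s.owner v ≠ none → (below M s F v).ncard ≤ (ℓ + 1 - lab M s v) * L
  verts : ∀ α, (s.vertsOf α).ncard ≤ (ℓ + 1) * L

/-- The bases of non-root blossoms on the active paths. -/
def critical (M : G.Subgraph) (s : PhaseState G) (F : Forest V) : Set V :=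
  {b | b ∈ F.out ∧ F.base b = b ∧ mate M b ≠ b ∧ OnPath M s F b}

open Classical in
/-- The potential that pays for the operations. -/
noncomputable def potential [Fintype V] (M : G.Subgraph) (s : PhaseState G) (F : Forest V) : ℕ :=
  3 * (∑ x : V, if mate M x = x then 0 else lab M s x) + (critical M s F).ncard

/-- The structures that have a working vertex and are marked as modified. -/
def activeModified (s : PhaseState G) : Set V := {α | α ∈ s.modified ∧ s.work α ≠ none}

variable {M : G.Subgraph} {s s' : PhaseState G} {F : Forest V} {ℓ k : ℕ} {α u v t : V}

theorem Evolves.lab_le {F' : Forest V} (h : Evolves M s F s' F') (x : V) :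
    lab M s' x ≤ lab M s x := h.label_le _ _

namespace Core

variable (C : Core M s F ℓ)
include C

/-- An inner vertex is entered by one arc only, so the vertex `p` chosen in `Overtake` is the forest
parent of `v`. -/
theorem par_eq {x w : V} (h : (x, w) ∈ s.arcs) (hw : w ∉ F.out) : x = F.par w := by
  rcases C.arcs_char x w h with ⟨_, h1, _⟩ | ⟨_, h1⟩ | ⟨h1, h2⟩
  · exact absurd h1 hw
  · exact h1
  · exact absurd (h2 ▸ (C.mate_inner x h1 (C.arcs_owner x w h).1).1) hw

theorem mem_subtree_iff {β x : V} (hv : s.owner v = some β) :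
    x ∈ s.subtree β v ↔ s.owner x ≠ none ∧ F.Desc M (F.nd x) (F.nd v) := by
  constructor
  · rintro ⟨h1, h2⟩
    exact ⟨by simp [show s.owner x = some β from h1], (C.isAncestor_root_iff hv h1).1 h2⟩
  · rintro ⟨h1, h2⟩
    have h3 : s.owner x = some β := by
      rw [← hv, ← C.owner_nd x, ← C.owner_nd v, (C.desc_rep h2 (C.rep_nd h1)).2]
    exact ⟨h3, (C.isAncestor_root_iff hv h3).2 h2⟩

end Core

/-- Removing `(p, v)` removes every old arc with head `v`, which is why one description fits all
three cases. -/
theorem OvertakeStep.reparented (C : Core M s F ℓ) (O : Overtaking M s F α u v t k)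
    (h : PhaseState.OvertakeStep α u v t k s s') : Reparented M s F α u v t k s' := by
  classical
  have harc : ∀ {x y}, (x, y) ∈ s.arcs → s.owner x ≠ none ∧ s.owner y ≠ none :=
    fun h => ⟨(C.arcs_owner _ _ h).1, (C.arcs_owner _ _ h).2 ▸ (C.arcs_owner _ _ h).1⟩
  have harcs : ∀ {p β}, s.owner v = some β → (p, v) ∈ s.arcsOf β → p = F.par v ∧ ∀ x y,
      (x, y) ∈ insert (u, v) (s.arcs \ {(p, v)}) ↔
        (x = u ∧ y = v) ∨ (x = v ∧ y = t) ∨ ((x, y) ∈ s.arcs ∧ y ≠ v) := by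
    intro p β hv hp
    have hv' : s.owner v ≠ none := by simp [hv]
    have hpp := C.par_eq hp.1 O.v_notOut
    refine ⟨hpp, fun x y => ?_⟩
    simp only [Set.mem_insert_iff, Prod.mk.injEq, Set.mem_sdiff, Set.mem_singleton_iff]
    constructor
    · rintro (h | ⟨h1, h2⟩)
      · exact Or.inl h
      · refine Or.inr (Or.inr ⟨h1, ?_⟩)
        rintro rfl
        exact h2 ⟨(C.par_eq h1 O.v_notOut).trans hpp.symm, rfl⟩
    · rintro (h | ⟨rfl, rfl⟩ | ⟨h1, h2⟩)
      · exact Or.inl h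
      · refine Or.inr ⟨?_, fun h => O.ne h.2.symm⟩
        have := (C.par_out x O.v_notOut hv').2.2.2
        rwa [O.mate_v] at this
      · exact Or.inr ⟨h1, fun h => h2 h.2⟩
  cases h with
  | unvisited hv =>
    refine ⟨?_, ?_, rfl, fun _ _ => rfl, rfl, rfl, rfl, ?_, Or.inr ⟨?_, ?_⟩⟩
    · intro x
      have := O.mem_movedSet_of_unvisited C (x := x) hv
      change (if x = v ∨ x = t then some α else s.owner x) = _
      by_cases h : x = v ∨ x = t
      · rw [if_pos h, if_pos (this.2 h)]
      · rw [if_neg h, if_neg (fun h' => h (this.1 h'))]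
    · intro x y
      change (x, y) ∈ insert (u, v) (insert (v, t) s.arcs) ↔ _
      simp only [Set.mem_insert_iff, Prod.mk.injEq]
      refine or_congr_right (or_congr_right ⟨fun h => ⟨h, ?_⟩, fun h => h.1⟩)
      rintro rfl
      exact (harc h).2 hv
    · intro β
      change β ∈ insert α s.modified ↔ _
      rw [Set.mem_insert_iff, hv]
      simp only [reduceCtorEq, or_false]
      exact or_comm
    · intro β y h
      rw [hv] at h
      cases h
    · intro γ
      change Function.update s.work α _ γ = _
      rw [Function.update_apply]
  | @same p hv hp hne =>
    have hv' : s.owner v ≠ none := by simp [hv]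
    refine ⟨?_, (harcs hv hp).2, rfl, fun _ _ => rfl, rfl, rfl, rfl, ?_, Or.inr ⟨?_, ?_⟩⟩
    · intro x
      change s.owner x = _
      split_ifs with h
      · rw [O.owner_of_moved C h, hv]
      · rfl
    · intro β
      change β ∈ insert α s.modified ↔ _
      rw [Set.mem_insert_iff, hv, Option.some_inj]
      constructor
      · rintro (h | h)
        exacts [Or.inr (Or.inl h), Or.inl h]
      · rintro (h | h | h)
        exacts [Or.inr h, Or.inl h, Or.inl h.symm]
    · intro β y h hne
      rw [hv, Option.some_inj] at h
      exact absurd h.symm hne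
    · intro γ
      change Function.update s.work α _ γ = _
      rw [Function.update_apply]
  | @other β p hv hβ hp hne =>
    have hv' : s.owner v ≠ none := by simp [hv]
    have ht : s.owner t = some β := by rw [O.owner_t C, hv]
    have htn : F.nd t = t := by
      rw [Forest.nd_of_mem (O.t_of_visited C hv').1, (O.t_of_visited C hv').2]
    refine ⟨?_, (harcs hv hp).2, rfl, fun _ _ => rfl, rfl, rfl, rfl, ?_, ?_⟩
    · intro x
      change (if x ∈ s.subtree β v then some α else s.owner x) = _
      have : x ∈ s.subtree β v ↔ x ∈ movedSet M s F v t := by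
        rw [C.mem_subtree_iff hv, O.mem_movedSet_iff C hv', Forest.nd_of_notMem O.v_notOut]
      by_cases h : x ∈ s.subtree β v
      · rw [if_pos h, if_pos (this.1 h)]
      · rw [if_neg h, if_neg (fun h' => h (this.2 h'))]
    · intro γ
      change γ ∈ insert α (insert β s.modified) ↔ _
      rw [Set.mem_insert_iff, Set.mem_insert_iff, hv, Option.some_inj]
      constructor
      · rintro (h | h | h)
        exacts [Or.inr (Or.inl h), Or.inr (Or.inr h.symm), Or.inl h]
      · rintro (h | h | h)
        exacts [Or.inr (Or.inr h), Or.inl h, Or.inr (Or.inl h.symm)]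
    · by_cases hW : ∃ W, s.work β = some W ∧ s.IsAncestor β (s.root t) W
      · left
        have hW' := hW
        obtain ⟨W, hW1, hW2⟩ := hW
        obtain ⟨y, hy1, hy2, rfl⟩ := C.work_eq β W hW1
        refine ⟨β, y, hv, hβ, hW1, hy1, hy2, ?_, ?_⟩
        · rw [← htn]
          exact (C.isAncestor_root_iff ht hy2).1 hW2
        · intro γ
          unfold PhaseState.overtakeOther
          dsimp only
          rw [if_pos hW', Function.update_apply, Function.update_apply, hW1, (harcs hv hp).1]
          by_cases h1 : γ = β
          · rw [if_pos h1, if_neg (h1 ▸ hβ), if_pos h1]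
          · rw [if_neg h1, if_neg h1]
      · right
        refine ⟨?_, ?_⟩
        · intro β' y h1 h2 h3 h4 h5
          rw [hv, Option.some_inj] at h1
          subst h1
          refine hW ⟨_, h3, (C.isAncestor_root_iff ht h4).2 ?_⟩
          rwa [htn]
        · intro γ
          unfold PhaseState.overtakeOther
          dsimp only
          rw [if_neg hW, Function.update_apply]

namespace Reparented

variable (R : Reparented M s F α u v t k s') (O : Overtaking M s F α u v t k) (C : Core M s F ℓ)
include R O C

theorem up_of_ne {b : V} (hb : s.owner b ≠ none) (hne : b ≠ v) :
    (F.reparent u v t).up M b = F.up M b := by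
  by_cases h : b ∈ F.out
  · rw [Forest.up_of_mem h, Forest.up_of_mem (Or.inr h)]
  · have hp := C.par_out b h hb
    have : b ∉ (F.reparent u v t).out := by
      rintro (h' | h')
      · rw [h'] at hb h
        exact h (O.t_of_visited C (by rwa [← O.owner_t C])).1
      · exact h h'
    rw [Forest.up_of_notMem h, Forest.up_of_notMem this,
      show (F.reparent u v t).par b = F.par b from if_neg hne, O.base_reparent C hp.1]

theorem up_v : (F.reparent u v t).up M v = F.base u := by
  have : v ∉ (F.reparent u v t).out := by
    rintro (h' | h')
    · exact O.ne h'
    · exact O.v_notOut h'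
  rw [Forest.up_of_notMem this, show (F.reparent u v t).par v = u from if_pos rfl,
    O.base_reparent C O.u_out]

theorem up_t : (F.reparent u v t).up M t = v := by
  rw [Forest.up_of_mem (Or.inl rfl), O.mate_t C]

theorem rep_base_u : Rep s F (F.base u) ∧ F.base u ∉ movedSet M s F v t := by
  refine ⟨C.rep_base O.u_out, ?_⟩
  have h1 := C.out_owner u O.u_out
  rw [← Forest.nd_of_mem O.u_out]
  intro h
  exact O.u_notMoved C ((O.moved_of_nd_eq C (C.nd_nd u) (by rwa [C.owner_nd])).1 h)

theorem notMoved_of_desc {a b : V} (h : F.Desc M b a) (hb : Rep s F b)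
    (hbX : b ∉ movedSet M s F v t) : a ∉ movedSet M s F v t := by
  intro ha
  have ha' := C.desc_rep h hb
  have hv : s.owner v ≠ none := by
    rw [← O.owner_of_moved C ha]; exact ha'.1.1
  rw [O.mem_movedSet_iff C hv] at ha hbX
  rw [ha'.1.2] at ha
  rw [hb.2] at hbX
  exact hbX ⟨hb.1, h.trans ha.2⟩

/-- Off the moved subtree the ancestors do not change. -/
theorem desc_iff {a b : V} (hb : Rep s F b) (hbX : b ∉ movedSet M s F v t) :
    (F.reparent u v t).Desc M b a ↔ F.Desc M b a := by
  constructor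
  · intro h
    induction h with
    | refl => exact .refl _
    | @tail c d _ h2 ih =>
      have hc := C.desc_rep ih hb
      have hcX := R.notMoved_of_desc O C ih hb hbX
      rw [R.up_of_ne O C hc.1.1 (fun h => hcX (Or.inl h))] at h2
      exact ih.tail h2
  · intro h
    induction h with
    | refl => exact .refl _
    | @tail c d h1 h2 ih =>
      have hc := C.desc_rep h1 hb
      have hcX := R.notMoved_of_desc O C h1 hb hbX
      rw [← R.up_of_ne O C hc.1.1 (fun h => hcX (Or.inl h))] at h2
      exact ih.tail h2

/-- In the new forest a climb from the moved subtree stays in it up to `v`, then jumps to the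
blossom of `u` and continues as in the old forest. The condition on `s.owner v` separates off the
unvisited arc, which has no position in the old forest. -/
theorem desc_moved {a b : V} (hb : s.owner v ≠ none → Rep s F b) (hbX : b ∈ movedSet M s F v t)
    (h : (F.reparent u v t).Desc M b a) :
    (a ∈ movedSet M s F v t ∧ (s.owner v ≠ none → F.Desc M b a)) ∨ F.Desc M (F.base u) a := by
  have hu := R.rep_base_u O C
  induction h with
  | refl => exact Or.inl ⟨hbX, fun _ => .refl _⟩
  | @tail c d _ h2 ih =>
    subst h2
    rcases ih with ⟨h3, h4⟩ | h3
    · by_cases hcv : c = v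
      · subst hcv
        rw [R.up_v O C]
        exact Or.inr (.refl _)
      · left
        by_cases hv : s.owner v = none
        · rcases (O.mem_movedSet_of_unvisited C hv).1 h3 with h5 | h5
          · exact absurd h5 hcv
          · rw [h5, R.up_t O C]
            exact ⟨Or.inl rfl, fun h => absurd hv h⟩
        · have h5 := C.desc_rep (h4 hv) (hb hv)
          rw [R.up_of_ne O C h5.1.1 hcv]
          refine ⟨?_, fun _ => (h4 hv).tail rfl⟩
          rw [O.mem_movedSet_iff C hv] at h3 ⊢
          rw [(C.rep_up h5.1).2]
          rw [h5.1.2] at h3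
          exact ⟨(C.rep_up h5.1).1, h3.2.up_of_ne hcv⟩
    · right
      have hc := C.desc_rep h3 hu.1
      have hcX := R.notMoved_of_desc O C h3 hu.1 hu.2
      rw [R.up_of_ne O C hc.1.1 (fun h => hcX (Or.inl h))]
      exact h3.tail rfl

/-- An upward path that ends at or below `v` never uses the parent arc of `v`, the only one that
changed. -/
theorem desc_of_moved (hv : s.owner v ≠ none) {a b : V} (hb : Rep s F b) (h : F.Desc M b a)
    (ha : F.Desc M a v) : (F.reparent u v t).Desc M b a := by
  induction h using Relation.ReflTransGen.head_induction_on with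
  | refl => exact .refl _
  | @head b c h1 h2 ih =>
    subst h1
    refine .head ?_ (ih (C.rep_up hb))
    by_cases hbv : b = v
    · exfalso
      have h3 : F.Desc M (F.up M b) b := by
        have := h2.trans ha
        rwa [hbv] at this ⊢
      have := C.desc_antisymm h3 (Forest.desc_up b) (C.rep_up hb)
      have hbo : b ∉ F.out := by rw [hbv]; exact O.v_notOut
      apply hbo
      rw [this, Forest.up_of_notMem hbo]
      exact C.base_out _ (C.par_out b hbo hb.1).1
    · exact R.up_of_ne O C hb.1 hbv

theorem desc_t_v : (F.reparent u v t).Desc M t v := by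
  have := Forest.desc_up (F := F.reparent u v t) (M := M) t
  rwa [R.up_t O C] at this

theorem desc_t_u : (F.reparent u v t).Desc M t (F.base u) := by
  have := Forest.desc_up (F := F.reparent u v t) (M := M) v
  rw [R.up_v O C] at this
  exact (R.desc_t_v O C).trans this

theorem nd_t : F.nd t = t := by
  by_cases h : t ∈ F.out
  · rw [Forest.nd_of_mem h, O.base_t C h]
  · rw [Forest.nd_of_notMem h]

theorem desc_t_v_old (hv : s.owner v ≠ none) : F.Desc M t v := by
  have := Forest.desc_up (F := F) (M := M) t
  rwa [Forest.up_of_mem (O.t_of_visited C hv).1, O.mate_t C] at this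

/-- The new working vertex of `S_α` is in the subtree at `t`. -/
theorem exists_work : ∃ y, y ∈ movedSet M s F v t ∧ s'.work α = some (s.root y) ∧
    (F.reparent u v t).Desc M (F.nd y) t ∧ (s.owner v ≠ none → Rep s F (F.nd y)) ∧
    ((∃ β, s.owner v = some β ∧ β ≠ α ∧ s.work β = some (s.root y) ∧ s.owner y = some β) ∨ y = t)
    := by
  rcases R.work with ⟨β, y, hv, hβ, hy1, hy2, hy3, hy4, hw⟩ | ⟨hno, hw⟩
  · have hv' : s.owner v ≠ none := by simp [hv]
    have hy : s.owner y ≠ none := by simp [hy3]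
    have h1 := R.desc_t_v_old O C hv'
    exact ⟨y, (O.mem_movedSet_iff C hv').2 ⟨hy, hy4.trans h1⟩, by rw [hw, if_pos rfl],
      R.desc_of_moved O C hv' (C.rep_nd hy) hy4 h1, fun _ => C.rep_nd hy,
      Or.inl ⟨β, hv, hβ, hy1, hy3⟩⟩
  · refine ⟨t, Or.inr (Or.inl rfl), by rw [hw, if_pos rfl], ?_, ?_, Or.inr rfl⟩
    · rw [R.nd_t O C]
      exact .refl _
    · exact fun h => C.rep_nd (by rwa [O.owner_t C])

theorem onPath_t : OnPath M s' (F.reparent u v t) t := by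
  obtain ⟨y, hyX, hy1, hy2, _, _⟩ := R.exists_work O C
  refine ⟨α, y, R.owner_moved O C (Or.inr (Or.inl rfl)), R.owner_moved O C hyX, ?_, ?_⟩
  · rw [R.root, hy1]
  · rwa [O.nd_reparent C]

theorem notMoved_of_nd {x : V} (hx : s.owner x ≠ none) :
    F.nd x ∉ movedSet M s F v t ↔ x ∉ movedSet M s F v t :=
  not_congr (O.moved_of_nd_eq C (C.nd_nd x) (by rwa [C.owner_nd]))

/-- No outer vertex leaves the active paths. The path of `S_α` is prolonged through `v` and `t`. If
the working vertex taken from `S_β` lies below `t`, its old path is cut at `v`: the lower part now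
belongs to `S_α`, and the upper part is the new path of `S_β`, ending at the parent of `v`. -/
theorem onPath_of_onPath {x : V} (hx : x ∈ F.out) (h : OnPath M s F x) :
    OnPath M s' (F.reparent u v t) x := by
  obtain ⟨γ, y, hxo, hyo, hwk, hd⟩ := h
  have hy' : s.owner y ≠ none := by simp [hyo]
  have hyr := C.rep_nd hy'
  have hu := R.rep_base_u O C
  have hx' := (C.desc_rep hd hyr).1
  by_cases hγ : γ = α
  · subst hγ
    have h1 : F.nd y = F.base u := by
      rw [← Forest.nd_of_mem O.u_out]
      have := O.u_work
      rw [hwk, Option.some_inj] at this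
      exact C.root_eq_iff.1 this
    rw [h1] at hd
    obtain ⟨z, hzX, hz1, hz2, _, _⟩ := R.exists_work O C
    refine ⟨γ, z, ?_, R.owner_moved O C hzX, ?_, ?_⟩
    · rw [R.owner_notMoved O C (R.notMoved_of_desc O C hd hu.1 hu.2), hxo]
    · rw [R.root, hz1]
    · rw [O.nd_reparent C]
      exact hz2.trans ((R.desc_t_u O C).trans ((R.desc_iff O C hu.1 hu.2).2 hd))
  · rcases R.work with ⟨β, y', hv, hβ, hy1, hy2, hy3, hy4, hw⟩ | ⟨hno, hw⟩
    · have hv' : s.owner v ≠ none := by simp [hv]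
      by_cases hγβ : γ = β
      · subst hγβ
        rw [hwk, Option.some_inj] at hy1
        have h1 := C.root_eq_iff.1 hy1
        rw [← h1] at hy4
        have htv := R.desc_t_v_old O C hv'
        have key : F.Desc M x t → OnPath M s' (F.reparent u v t) x := by
          intro h
          have hyX : y ∈ movedSet M s F v t :=
            (O.mem_movedSet_iff C hv').2 ⟨hy', hy4.trans htv⟩
          refine ⟨α, y, R.owner_moved O C ?_, R.owner_moved O C hyX, ?_, ?_⟩
          · rw [O.mem_movedSet_iff C hv', hx'.2]
            exact ⟨hx'.1, h.trans htv⟩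
          · rw [hw, if_pos rfl, R.root, hy1]
          · rw [O.nd_reparent C]
            exact R.desc_of_moved O C hv' hyr hd (h.trans htv)
        rcases hy4.total hd with h2 | h2
        · by_cases hxt : x = t
          · exact key (hxt ▸ .refl _)
          · have h3 := h2.up_of_ne (Ne.symm hxt)
            rw [Forest.up_of_mem (O.t_of_visited C hv').1, O.mate_t C] at h3
            have h4 := h3.up_of_ne (by rintro rfl; exact O.v_notOut hx)
            have hp := C.par_out v O.v_notOut hv'
            rw [Forest.up_of_notMem O.v_notOut, ← Forest.nd_of_mem hp.1] at h4
            have hpX := O.par_v_notMoved C hv'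
            have hpo : s.owner (F.par v) ≠ none := C.out_owner _ hp.1
            have hpX' := (R.notMoved_of_nd O C hpo).2 hpX
            refine ⟨γ, F.par v, ?_, ?_, ?_, ?_⟩
            · rw [R.owner_notMoved O C (R.notMoved_of_desc O C h4 (C.rep_nd hpo) hpX'), hxo]
            · rw [R.owner_notMoved O C hpX, hp.2.1, hv]
            · rw [hw, if_neg hγ, if_pos rfl, R.root]
            · rw [O.nd_reparent C]
              exact (R.desc_iff O C (C.rep_nd hpo) hpX').2 h4
        · exact key h2
      · have hyX : y ∉ movedSet M s F v t := by
          intro h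
          have := O.owner_of_moved C h
          rw [hyo, hv, Option.some_inj] at this
          exact hγβ this
        have hyX' := (R.notMoved_of_nd O C hy').2 hyX
        refine ⟨γ, y, ?_, ?_, ?_, ?_⟩
        · rw [R.owner_notMoved O C (R.notMoved_of_desc O C hd hyr hyX'), hxo]
        · rw [R.owner_notMoved O C hyX, hyo]
        · rw [hw, if_neg hγ, if_neg hγβ, R.root, hwk]
        · rw [O.nd_reparent C]
          exact (R.desc_iff O C hyr hyX').2 hd
    · obtain ⟨y', hyo', _, hyy⟩ := C.work_eq γ _ hwk
      have hyout := (C.mem_out_of_nd_eq (C.root_eq_iff.1 hyy)).2 hyo'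
      have hyX : y ∉ movedSet M s F v t := by
        intro h
        have h2 := O.owner_of_moved C h
        rw [hyo] at h2
        have hv' : s.owner v ≠ none := by simp [← h2]
        refine hno γ y h2.symm hγ hwk hyo ?_
        rw [← O.mate_v]
        refine C.desc_mate_of_desc ((O.mem_movedSet_iff C hv').1 h).2 hyr ?_ O.v_notOut
        intro h'
        exact O.v_notOut (h' ▸ (C.nd_mem_iff y).2 hyout)
      have hyX' := (R.notMoved_of_nd O C hy').2 hyX
      refine ⟨γ, y, ?_, ?_, ?_, ?_⟩
      · rw [R.owner_notMoved O C (R.notMoved_of_desc O C hd hyr hyX'), hxo]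
      · rw [R.owner_notMoved O C hyX, hyo]
      · rw [hw, if_neg hγ, R.root, hwk]
      · rw [O.nd_reparent C]
        exact (R.desc_iff O C hyr hyX').2 hd

/-- Conversely only `t` can become active, so the set of critical bases grows by at most one. -/
theorem onPath_old {x : V} (hx : x ∈ (F.reparent u v t).out) (hxt : x ≠ t)
    (h : OnPath M s' (F.reparent u v t) x) : OnPath M s F x := by
  obtain ⟨γ, y, hxo, hyo, hwk, hd⟩ := h
  have hu := R.rep_base_u O C
  rw [O.nd_reparent C] at hd
  rw [R.root] at hwk
  have hxv : x ≠ v := by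
    rintro rfl
    rcases hx with h | h
    exacts [hxt h, O.v_notOut h]
  by_cases hγ : γ = α
  · subst hγ
    obtain ⟨z, hzX, hz1, hz2, hz3, hz4⟩ := R.exists_work O C
    have hyz : F.nd y = F.nd z := by
      rw [hwk, Option.some_inj] at hz1
      exact C.root_eq_iff.1 hz1
    rw [hyz] at hd
    have hzX' : F.nd z ∈ movedSet M s F v t := by
      by_cases hv : s.owner v = none
      · rcases (O.mem_movedSet_of_unvisited C hv).1 hzX with h | h
        · rw [h, Forest.nd_of_notMem O.v_notOut]; exact Or.inl rfl
        · rw [h, R.nd_t O C]; exact Or.inr (Or.inl rfl)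
      · refine (O.moved_of_nd_eq C (C.nd_nd z).symm ?_).1 hzX
        rw [O.owner_of_moved C hzX]; exact hv
    rcases R.desc_moved O C hz3 hzX' hd with ⟨h1, h2⟩ | h1
    · by_cases hv : s.owner v = none
      · rcases (O.mem_movedSet_of_unvisited C hv).1 h1 with h | h
        exacts [absurd h hxv, absurd h hxt]
      · rcases hz4 with ⟨β, hvβ, hβ, hw, hzo⟩ | rfl
        · exact ⟨β, z, by rw [O.owner_of_moved C h1, hvβ], hzo, hw, h2 hv⟩
        · exfalso
          have h3 := h2 hv
          rw [R.nd_t O C] at h3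
          have hzr := C.rep_nd (x := z) (by rwa [O.owner_t C])
          rw [R.nd_t O C] at hzr
          have h4 := h3.up_of_ne (Ne.symm hxt)
          rw [Forest.up_of_mem (O.t_of_visited C hv).1, O.mate_t C] at h4
          have h5 := (C.desc_rep h3 hzr).1
          have h6 := ((O.mem_movedSet_iff C hv).1 h1).2
          rw [h5.2] at h6
          exact hxv (C.desc_antisymm h4 h6 (rep_of_notOut O.v_notOut hv))
    · refine ⟨γ, u, ?_, O.u_owner, O.u_work, ?_⟩
      · rw [(C.desc_rep h1 hu.1).2, C.base_owner u O.u_out, O.u_owner]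
      · rwa [Forest.nd_of_mem O.u_out]
  · have hxX : x ∉ movedSet M s F v t := by
      intro h
      rw [R.owner_moved O C h, Option.some_inj] at hxo
      exact hγ hxo.symm
    have hyX : y ∉ movedSet M s F v t := by
      intro h
      rw [R.owner_moved O C h, Option.some_inj] at hyo
      exact hγ hyo.symm
    rw [R.owner_notMoved O C hxX] at hxo
    rw [R.owner_notMoved O C hyX] at hyo
    have hy' : s.owner y ≠ none := by simp [hyo]
    have hyr := C.rep_nd hy'
    have hd' := (R.desc_iff O C hyr ((R.notMoved_of_nd O C hy').2 hyX)).1 hd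
    rcases R.work with ⟨β, z, hv, hβ, hy1, hy2, hy3, hy4, hw⟩ | ⟨hno, hw⟩
    · rw [hw, if_neg hγ] at hwk
      split_ifs at hwk with h1
      · subst h1
        have hv' : s.owner v ≠ none := by simp [hv]
        refine ⟨γ, z, hxo, hy3, hy1, hy4.trans ((R.desc_t_v_old O C hv').trans ?_)⟩
        refine (Forest.desc_up v).trans ?_
        have hp := C.par_out v O.v_notOut hv'
        rw [Forest.up_of_notMem O.v_notOut, ← Forest.nd_of_mem hp.1,
          C.root_eq_iff.1 (Option.some_inj.1 hwk)]
        exact hd'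
      · exact ⟨γ, y, hxo, hyo, hwk, hd'⟩
    · rw [hw, if_neg hγ] at hwk
      exact ⟨γ, y, hxo, hyo, hwk, hd'⟩

theorem evolves : Evolves M s F s' (F.reparent u v t) := by
  have hmod : ∀ γ, γ ∉ s'.modified → γ ∉ s.modified ∧ γ ≠ α ∧ s.owner v ≠ some γ := by
    intro γ h
    rw [R.modified] at h
    push Not at h
    exact h
  have howner : ∀ γ ∉ s'.modified, ∀ x, s'.owner x = some γ ↔ s.owner x = some γ := by
    intro γ hγ x
    obtain ⟨_, h1, h2⟩ := hmod γ hγ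
    by_cases hx : x ∈ movedSet M s F v t
    · rw [R.owner_moved O C hx, O.owner_of_moved C hx, Option.some_inj]
      exact iff_of_false (Ne.symm h1) h2
    · rw [R.owner_notMoved O C hx]
  have hnt : ∀ γ ∉ s'.modified, ∀ x, s'.owner x = some γ → x ≠ t := by
    rintro γ hγ x hx rfl
    rw [R.owner_moved O C (Or.inr (Or.inl rfl)), Option.some_inj] at hx
    exact (hmod γ hγ).2.1 hx.symm
  refine ⟨?_, by rw [R.removed], fun x hx => Or.inl (Or.inr hx), R.onHold,
    fun x hx => (R.modified x).2 (Or.inl hx), ?_, ?_, howner, ?_, fun _ _ _ _ => by rw [R.root], ?_⟩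
  · intro x y
    rw [R.label]
    split_ifs with h
    · obtain ⟨rfl, rfl⟩ := h
      have := O.k_lt
      rw [lab, O.mate_v] at this
      exact this.le
    · rfl
  · intro γ hγ
    have h1 : γ ≠ α := by
      rintro rfl
      rw [O.u_work] at hγ
      cases hγ
    rcases R.work with ⟨β, y, hv, hβ, hy1, hy2, hy3, hy4, hw⟩ | ⟨hno, hw⟩
    · have h2 : γ ≠ β := by
        rintro rfl
        rw [hγ] at hy1
        cases hy1
      rw [hw, if_neg h1, if_neg h2, hγ]
    · rw [hw, if_neg h1, hγ]
  · intro γ hγ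
    obtain ⟨_, h1, h2⟩ := hmod γ hγ
    rcases R.work with ⟨β, y, hv, hβ, hy1, hy2, hy3, hy4, hw⟩ | ⟨hno, hw⟩
    · have h3 : γ ≠ β := by
        rintro rfl
        exact h2 hv
      rw [hw, if_neg h1, if_neg h3]
    · rw [hw, if_neg h1]
  · intro γ hγ x hx
    have := hnt γ hγ x hx
    rw [O.mem_reparent C]
    exact or_iff_right this
  · intro γ hγ x hxo hx
    rw [O.base_reparent C hxo, R.dist_eq O C]
    refine hnt γ hγ _ ?_
    rw [howner γ hγ] at hx ⊢
    rw [C.base_owner x hxo, hx]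

/-- Active paths only gain outer vertices, labels only fall, and `t`, the only base whose distance
changes, is on an active path. -/
theorem explored (hK : Explored M s F) : Explored M s' (F.reparent u v t) := by
  intro x hx hp y hadj hy hyr
  by_cases hxt : x = t
  · rw [hxt, O.base_reparent_self C] at hp
    exact absurd (R.onPath_t O C) hp
  · have hxo : x ∈ F.out := hx.resolve_left hxt
    rw [O.base_reparent C hxo] at hp ⊢
    have h1 : F.base x ≠ t := by
      intro h
      rw [h] at hp
      exact hp (R.onPath_t O C)
    rw [R.dist_eq O C h1]
    refine ((R.evolves O C).lab_le y).trans (hK x hxo ?_ y hadj (fun h => hy (Or.inr h)) ?_)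
    · exact fun h => hp (R.onPath_of_onPath O C (C.base_out x hxo) h)
    · rwa [R.removed] at hyr

/-- A working vertex that served as a witness either stays or passes from `S_β` to `S_α`, and both
are marked as modified. Edges at a newly outer vertex are edges at `t`, which in that case is the
new working vertex of `S_α`. -/
theorem freshPairs (hJ : FreshPairs M s F) (hα : α ∉ s.modified) :
    FreshPairs M s' (F.reparent u v t) := by
  intro x hx y hy hadj hfr hne
  have hαm : α ∈ s'.modified := (R.modified α).2 (Or.inr (Or.inl rfl))
  by_cases hboth : x ∈ F.out ∧ y ∈ F.out
  · rw [O.base_reparent C hboth.1, O.base_reparent C hboth.2] at hne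
    obtain ⟨z, hz, γ, h1, h2, h3⟩ := hJ x hboth.1 y hboth.2 hadj hfr hne
    refine ⟨z, hz, ?_⟩
    have hzo : z ∈ F.out := by rcases hz with rfl | rfl; exacts [hboth.1, hboth.2]
    have hγ : γ ≠ α := by rintro rfl; exact hα h3
    have hγm : γ ∈ s'.modified := (R.modified γ).2 (Or.inl h3)
    rw [R.root]
    rcases R.work with ⟨β, y', hv, hβ, hy1, hy2, hy3, hy4, hw⟩ | ⟨hno, hw⟩
    · have hv' : s.owner v ≠ none := by simp [hv]
      by_cases hγβ : γ = β
      · subst hγβ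
        rw [h2, Option.some_inj] at hy1
        refine ⟨α, R.owner_moved O C ?_, ?_, hαm⟩
        · rw [O.mem_movedSet_iff C hv', C.root_eq_iff.1 hy1]
          exact ⟨by simp [h1], hy4.trans (R.desc_t_v_old O C hv')⟩
        · rw [hw, if_pos rfl, hy1]
      · refine ⟨γ, ?_, ?_, hγm⟩
        · rw [R.owner_notMoved O C, h1]
          intro h
          have := O.owner_of_moved C h
          rw [h1, hv, Option.some_inj] at this
          exact hγβ this
        · rw [hw, if_neg hγ, if_neg hγβ, h2]
    · refine ⟨γ, ?_, ?_, hγm⟩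
      · rw [R.owner_notMoved O C, h1]
        intro h
        have h4 := O.owner_of_moved C h
        rw [h1] at h4
        have hv' : s.owner v ≠ none := by simp [← h4]
        refine hno γ z h4.symm hγ h2 h1 ?_
        rw [← O.mate_v]
        refine C.desc_mate_of_desc ((O.mem_movedSet_iff C hv').1 h).2 (C.rep_nd (by simp [h1])) ?_
          O.v_notOut
        intro h'
        exact O.v_notOut (h' ▸ (C.nd_mem_iff z).2 hzo)
      · rw [hw, if_neg hγ, h2]
  · have ht : t ∉ F.out ∧ (t = x ∨ t = y) := by
      rcases hx with hx | hx <;> rcases hy with hy | hy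
      · exact absurd (hx.trans hy.symm) hadj.ne
      · exact ⟨fun h => hboth ⟨hx ▸ h, hy⟩, Or.inl hx.symm⟩
      · exact ⟨fun h => hboth ⟨hx, hy ▸ h⟩, Or.inr hy.symm⟩
      · exact absurd ⟨hx, hy⟩ hboth
    refine ⟨t, ht.2, α, R.owner_moved O C (Or.inr (Or.inl rfl)), ?_, hαm⟩
    rw [R.root]
    rcases R.work with ⟨β, y', hv, _⟩ | ⟨hno, hw⟩
    · exact absurd (O.t_of_visited C (by simp [hv])).1 ht.1
    · rw [hw, if_pos rfl]

end Reparented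

end

/-! ### Potential and size bounds under overtaking -/

section

variable {V : Type*} [Fintype V] {G : SimpleGraph V}
variable {M : G.Subgraph} {s s' : PhaseState G} {F F' : Forest V} {ℓ L k : ℕ} {α u v t : V}

/-- A step in which a label decreases. -/
theorem Evolves.sum_lab_lt (E : Evolves M s F s' F') {w : V} (hw : mate M w ≠ w)
    (hlt : lab M s' w < lab M s w) :
    open Classical in
    (∑ x : V, if mate M x = x then 0 else lab M s' x) + 1 ≤
      ∑ x : V, if mate M x = x then 0 else lab M s x := by
  classical
  refine Nat.succ_le_of_lt (Finset.sum_lt_sum ?_ ⟨w, Finset.mem_univ w, ?_⟩)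
  · intro x _
    split_ifs
    · rfl
    · exact E.lab_le x
  · rw [if_neg hw, if_neg hw]
    exact hlt

theorem Evolves.activeModified_subset (E : Evolves M s F s' F') {X : Set V}
    (h : ∀ γ ∈ s'.modified, s'.work γ ≠ none → γ ∈ s.modified ∨ γ ∈ X) :
    (activeModified s').ncard ≤ (activeModified s).ncard + X.ncard := by
  refine (Set.ncard_le_ncard ?_).trans (Set.ncard_union_le _ _)
  rintro γ ⟨h1, h2⟩
  rcases h γ h1 h2 with h3 | h3
  · exact Or.inl ⟨h3, fun h4 => h2 (E.work_none γ h4)⟩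
  · exact Or.inr h3

namespace Reparented

variable (R : Reparented M s F α u v t k s') (O : Overtaking M s F α u v t k) (C : Core M s F ℓ)
include R O C

/-- The label of `v` drops by at least one, worth 3 units. This pays for at most one new critical
base, `t`, and at most two newly modified structures; it is the source of the weight 3. -/
theorem potential_le : potential M s' (F.reparent u v t) + (activeModified s').ncard ≤
    potential M s F + (activeModified s).ncard := by
  classical
  have E := R.evolves O C
  have h1 := E.sum_lab_lt (w := v) (by rw [O.mate_v]; exact O.ne.symm)
    (by rw [R.lab_v O C]; exact O.k_lt)
  have h2 : (critical M s' (F.reparent u v t)).ncard ≤ (critical M s F).ncard + 1 := by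
    refine (Set.ncard_le_ncard (t := insert t (critical M s F)) ?_).trans (Set.ncard_insert_le _ _)
    rintro x ⟨hx1, hx2, hx3, hx4⟩
    by_cases hxt : x = t
    · exact Or.inl hxt
    · have hxo : x ∈ F.out := hx1.resolve_left hxt
      rw [O.base_reparent C hxo] at hx2
      exact Or.inr ⟨hxo, hx2, hx3, R.onPath_old O C hx1 hxt hx4⟩
  have h3 : (activeModified s').ncard ≤ (activeModified s).ncard + 2 := by
    refine (E.activeModified_subset (X := {α} ∪ {γ | s.owner v = some γ}) ?_).trans ?_
    · intro γ hγ _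
      rcases (R.modified γ).1 hγ with h | h | h
      exacts [Or.inl h, Or.inr (Or.inl h), Or.inr (Or.inr h)]
    · have h4 : {γ | s.owner v = some γ}.ncard ≤ 1 := by
        rw [Set.ncard_le_one_iff]
        intro a b ha hb
        exact Option.some_inj.1 (ha.symm.trans hb)
      have := Set.ncard_union_le {α} {γ | s.owner v = some γ}
      rw [Set.ncard_singleton] at this
      omega
  unfold potential
  omega

/-- A visited subtree is covered by the bound at `v`, whose label exceeds k. An unvisited arc brings
two vertices, at most L, and k ≤ ℓ leaves room for one L. -/
theorem ncard_movedSet_le (S : Sizes M s F ℓ L) (hL : 2 ≤ L) :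
    (movedSet M s F v t).ncard ≤ (ℓ + 1 - k) * L := by
  have hk := O.k_lt
  have hl := R.lab_v_le O C
  by_cases hv : s.owner v = none
  · have h1 : movedSet M s F v t ⊆ {v, t} := by
      intro x hx
      exact (O.mem_movedSet_of_unvisited C hv).1 hx
    have h2 := Set.ncard_le_ncard h1
    have h3 : ({v, t} : Set V).ncard ≤ 2 :=
      (Set.ncard_insert_le _ _).trans (by rw [Set.ncard_singleton])
    calc _ ≤ 1 * L := by omega
      _ ≤ _ := Nat.mul_le_mul_right _ (by omega)
  · have h1 : movedSet M s F v t = below M s F v := by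
      ext x
      exact O.mem_movedSet_iff C hv
    rw [h1]
    exact (S.below v O.v_notOut hv).trans (Nat.mul_le_mul_right _ (by omega))

/-- A subtree that grows lies in `S_α`, so it has at most L old and (ℓ+1−k)L moved vertices, in
total (ℓ+2−k)L. It hangs at an ancestor of `u`, whose label is at most k − 1 and therefore allows
this many. For the whole structure k ≥ 1 suffices. -/
theorem sizes (S : Sizes M s F ℓ L) (hL : 2 ≤ L) (hα : (s.vertsOf α).ncard ≤ L) :
    Sizes M s' (F.reparent u v t) ℓ L := by
  have hX := R.ncard_movedSet_le O C S hL
  have hu := R.rep_base_u O C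
  have hk1 : 1 ≤ k := by rw [O.k_eq]; omega
  have hbig : ∀ Y : Set V, Y ⊆ s.vertsOf α ∪ movedSet M s F v t → Y.ncard ≤ (ℓ + 2 - k) * L := by
    intro Y hY
    have h1 := Set.ncard_le_ncard hY
    have h2 := Set.ncard_union_le (s.vertsOf α) (movedSet M s F v t)
    have hk := O.k_lt
    have hl := R.lab_v_le O C
    have : ℓ + 2 - k = (ℓ + 1 - k) + 1 := by omega
    rw [this, Nat.add_mul, one_mul]
    omega
  have hXo : ∀ x, F.nd x ∈ movedSet M s F v t ↔ x ∈ movedSet M s F v t := by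
    intro x
    by_cases hx : s.owner x = none
    · by_cases hxo : x ∈ F.out
      · exact absurd hx (C.out_owner x hxo)
      · rw [Forest.nd_of_notMem hxo]
    · exact O.moved_of_nd_eq C (C.nd_nd x) (by rwa [C.owner_nd])
  constructor
  · intro w hw hwo
    have hwt : w ≠ t := fun h => hw (Or.inl h)
    have hwF : w ∉ F.out := fun h => hw (Or.inr h)
    have hvis : ∀ x, s'.owner x ≠ none → x ∉ movedSet M s F v t → s.owner x ≠ none := by
      intro x hx hxX
      rwa [R.owner_notMoved O C hxX] at hx
    have hout : ∀ x, s'.owner x ≠ none → x ∉ movedSet M s F v t →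
        (F.reparent u v t).Desc M ((F.reparent u v t).nd x) w → x ∈ below M s F w := by
      intro x hx hxX hd
      have h1 := hvis x hx hxX
      rw [O.nd_reparent C] at hd
      exact ⟨h1, (R.desc_iff O C (C.rep_nd h1) ((R.notMoved_of_nd O C h1).2 hxX)).1 hd⟩
    have hin : ∀ x, x ∈ movedSet M s F v t →
        (F.reparent u v t).Desc M ((F.reparent u v t).nd x) w →
        (w ∈ movedSet M s F v t ∧ (s.owner v ≠ none → x ∈ below M s F w)) ∨
          F.Desc M (F.base u) w := by
      intro x hxX hd
      rw [O.nd_reparent C] at hd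
      have h1 : s.owner v ≠ none → s.owner x ≠ none := by
        intro h
        rwa [O.owner_of_moved C hxX]
      rcases R.desc_moved O C (fun h => C.rep_nd (h1 h)) ((hXo x).2 hxX) hd with ⟨h2, h3⟩ | h2
      · exact Or.inl ⟨h2, fun h => ⟨h1 h, h3 h⟩⟩
      · exact Or.inr h2
    by_cases hwv : w = v
    · subst hwv
      rw [R.lab_v O C]
      refine (Set.ncard_le_ncard ?_).trans hX
      rintro x ⟨hx, hd⟩
      by_contra hxX
      have h1 := hout x hx hxX hd
      have h2 : s.owner w ≠ none := by
        have := C.desc_rep h1.2 (C.rep_nd h1.1)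
        exact this.1.1
      exact hxX ((O.mem_movedSet_iff C h2).2 h1)
    · rw [R.lab_eq O C hwv]
      have hwo' : s.owner w ≠ none := by
        rcases (R.owner_ne_none O C).1 hwo with h | h | h
        exacts [absurd h hwv, absurd h hwt, h]
      by_cases hdu : F.Desc M (F.base u) w
      · have hrk := C.desc_rk hdu hu.1
        have hlab : lab M s w ≤ k - 1 := by
          rcases hrk with h | h
          · exact absurd (h ▸ C.base_out u O.u_out) hwF
          · rw [rk, if_neg hwF, rk, if_pos (C.base_out u O.u_out)] at h
            rw [O.k_eq]
            omega
        refine (hbig _ ?_).trans (Nat.mul_le_mul_right _ (by omega))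
        rintro x ⟨hx, hd⟩
        by_cases hxX : x ∈ movedSet M s F v t
        · exact Or.inr hxX
        · left
          have h1 := hout x hx hxX hd
          have h2 := (C.desc_rep h1.2 (C.rep_nd h1.1)).2
          have h3 := (C.desc_rep hdu hu.1).2
          change s.owner x = some α
          rw [← C.owner_nd, ← h2, h3, C.base_owner u O.u_out, O.u_owner]
      · refine (Set.ncard_le_ncard ?_).trans (S.below w hwF hwo')
        rintro x ⟨hx, hd⟩
        by_cases hxX : x ∈ movedSet M s F v t
        · rcases hin x hxX hd with ⟨h1, h2⟩ | h1
          · apply h2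
            intro h
            rcases (O.mem_movedSet_of_unvisited C h).1 h1 with h | h
            exacts [hwv h, hwt h]
          · exact absurd h1 hdu
        · exact hout x hx hxX hd
  · intro γ
    by_cases hγ : γ = α
    · refine (hbig _ ?_).trans (Nat.mul_le_mul_right _ (by omega))
      intro x hx
      by_cases hxX : x ∈ movedSet M s F v t
      · exact Or.inr hxX
      · left
        change s'.owner x = some γ at hx
        rw [R.owner_notMoved O C hxX, hγ] at hx
        exact hx
    · refine (Set.ncard_le_ncard ?_).trans (S.verts γ)
      intro x hx
      change s'.owner x = some γ at hx
      have hxX : x ∉ movedSet M s F v t := by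
        intro h
        rw [R.owner_moved O C h, Option.some_inj] at hx
        exact hγ hx.symm
      rw [R.owner_notMoved O C hxX] at hx
      exact hx

end Reparented

end

/-! ### Contraction -/

section

variable {V : Type*} {G : SimpleGraph V}

open Classical in
/-- The forest after the blossom `B` with base `b` was contracted. -/
noncomputable def Forest.contract (F : Forest V) (B : Set V) (b : V) : Forest V :=
  ⟨F.out ∪ B, fun x => if x ∈ B then b else F.base x, F.par⟩

/-- The arc `(u, v)` closes a cycle in the tree of `S_α`, the top of which is represented
by `b`. -/
structure Contracting (M : G.Subgraph) (s : PhaseState G) (F : Forest V) (α u v b : V) : Prop where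
  u_out : u ∈ F.out
  u_owner : s.owner u = some α
  u_work : s.work α = some (s.root u)
  v_out : v ∈ F.out
  v_owner : s.owner v = some α
  adj : G.Adj u v
  ne : F.nd u ≠ F.nd v
  desc_u : F.Desc M (F.nd u) b
  desc_v : F.Desc M (F.nd v) b
  lowest : ∀ d, F.Desc M (F.nd u) d → F.Desc M (F.nd v) d → F.Desc M b d

variable {M : G.Subgraph} {s : PhaseState G} {F : Forest V} {ℓ L : ℕ} {α u v b : V}

theorem Core.exists_contracting (C : Core M s F ℓ) (hu : u ∈ F.out) (huo : s.owner u = some α)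
    (hw : s.work α = some (s.root u)) (hv : v ∈ F.out) (hvo : s.owner v = some α)
    (hadj : G.Adj u v) (hne : F.nd u ≠ F.nd v) : ∃ b, Contracting M s F α u v b := by
  have h1 := C.desc_root (C.rep_nd (x := u) (by simp [huo])) (by rw [C.owner_nd, huo])
  have h2 := C.desc_root (C.rep_nd (x := v) (by simp [hvo])) (by rw [C.owner_nd, hvo])
  obtain ⟨b, h3, h4, h5⟩ := Forest.exists_lowest_common h1 h2
  exact ⟨b, hu, huo, hw, hv, hvo, hadj, hne, h3, h4, h5⟩

namespace Contracting

variable (K : Contracting M s F α u v b) (C : Core M s F ℓ)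
include K C

theorem rep_u : Rep s F (F.nd u) := C.rep_nd (by simp [K.u_owner])

theorem rep_v : Rep s F (F.nd v) := C.rep_nd (by simp [K.v_owner])

theorem rep_b : Rep s F b := (C.desc_rep K.desc_u (K.rep_u C)).1

theorem owner_b : s.owner b = some α := by
  rw [(C.desc_rep K.desc_u (K.rep_u C)).2, C.owner_nd, K.u_owner]

/-- An inner vertex has a single child, its mate. Were `b` inner, the mate of `b` would be a lower
common ancestor of `u` and `v`. -/
theorem b_out : b ∈ F.out := by
  by_contra hb
  have h1 := C.desc_mate_of_desc K.desc_u (K.rep_u C)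
    (fun h => hb (h ▸ (C.nd_mem_iff u).2 K.u_out)) hb
  have h2 := C.desc_mate_of_desc K.desc_v (K.rep_v C)
    (fun h => hb (h ▸ (C.nd_mem_iff v).2 K.v_out)) hb
  have h3 := K.lowest _ h1 h2
  have h4 := Forest.desc_up (F := F) (M := M) (mate M b)
  rw [C.up_mate hb (K.rep_b C).1] at h4
  have := C.desc_antisymm h3 h4 (K.rep_b C)
  exact C.mate_ne_of_notOut hb (K.rep_b C).1 this

theorem base_b : F.base b = b := (K.rep_b C).base_eq (K.b_out C)

/-- As every common ancestor lies above `b`, being below all of them is the same as being below `b`.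
-/
theorem mem_iff {x : V} : x ∈ s.cycleBlossom α u v ↔ s.owner x = some α ∧
    (F.Desc M (F.nd u) (F.nd x) ∨ F.Desc M (F.nd v) (F.nd x)) ∧ F.Desc M (F.nd x) b := by
  have hbn := (K.rep_b C).2
  constructor
  · rintro ⟨h1, h2, h3⟩
    rw [C.isAncestor_root_iff h1 K.u_owner, C.isAncestor_root_iff h1 K.v_owner] at h2
    refine ⟨h1, h2, ?_⟩
    have := h3 (s.root b) ((C.isAncestor_root_iff (K.owner_b C) K.u_owner).2 (hbn.symm ▸ K.desc_u))
      ((C.isAncestor_root_iff (K.owner_b C) K.v_owner).2 (hbn.symm ▸ K.desc_v))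
    have := (C.isAncestor_root_iff (K.owner_b C) h1).1 this
    rwa [hbn] at this
  · rintro ⟨h1, h2, h3⟩
    refine ⟨h1, ?_, ?_⟩
    · rw [C.isAncestor_root_iff h1 K.u_owner, C.isAncestor_root_iff h1 K.v_owner]
      exact h2
    · intro D hDu hDv
      obtain ⟨d, hd, rfl, hdu⟩ := (C.isAncestor_iff K.u_owner).1 hDu
      rw [C.isAncestor_root_iff hd K.v_owner] at hDv
      rw [C.isAncestor_root_iff hd h1]
      exact h3.trans (K.lowest _ hdu hDv)

theorem mem_of_nd {x y : V} (h : F.nd x = F.nd y) (hy : y ∈ s.cycleBlossom α u v) :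
    x ∈ s.cycleBlossom α u v := by
  rw [K.mem_iff C] at hy ⊢
  rw [h, ← C.owner_nd, h, C.owner_nd]
  exact hy

theorem mem_congr {x y : V} (h : F.nd x = F.nd y) :
    x ∈ s.cycleBlossom α u v ↔ y ∈ s.cycleBlossom α u v :=
  ⟨K.mem_of_nd C h.symm, K.mem_of_nd C h⟩

theorem nd_mem {x : V} : F.nd x ∈ s.cycleBlossom α u v ↔ x ∈ s.cycleBlossom α u v :=
  K.mem_congr C (C.nd_nd x)

theorem base_mem {x : V} (hx : x ∈ F.out) :
    F.base x ∈ s.cycleBlossom α u v ↔ x ∈ s.cycleBlossom α u v := by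
  rw [← Forest.nd_of_mem hx, K.nd_mem C]

theorem u_mem : u ∈ s.cycleBlossom α u v :=
  (K.mem_iff C).2 ⟨K.u_owner, Or.inl (.refl _), K.desc_u⟩

theorem v_mem : v ∈ s.cycleBlossom α u v :=
  (K.mem_iff C).2 ⟨K.v_owner, Or.inr (.refl _), K.desc_v⟩

theorem b_mem : b ∈ s.cycleBlossom α u v := by
  rw [K.mem_iff C, (K.rep_b C).2]
  exact ⟨K.owner_b C, Or.inl K.desc_u, .refl _⟩

theorem up_mem {c : V} (hc : F.nd c = c) (hcB : c ∈ s.cycleBlossom α u v) (hne : c ≠ b) :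
    F.up M c ∈ s.cycleBlossom α u v := by
  rw [K.mem_iff C] at hcB ⊢
  rw [hc] at hcB
  have hr : Rep s F c := ⟨by simp [hcB.1], hc⟩
  rw [(C.rep_up hr).2, C.owner_up hr.1]
  refine ⟨hcB.1, ?_, hcB.2.2.up_of_ne hne⟩
  rcases hcB.2.1 with h | h
  · exact Or.inl (h.trans (Forest.desc_up c))
  · exact Or.inr (h.trans (Forest.desc_up c))

theorem par_mem {x : V} (hx : x ∉ F.out) (hxB : x ∈ s.cycleBlossom α u v) :
    F.par x ∈ s.cycleBlossom α u v := by
  have h1 := K.up_mem C (Forest.nd_of_notMem hx) hxB (fun h => hx (h ▸ K.b_out C))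
  have h2 := ((K.mem_iff C).1 hxB).1
  rw [Forest.up_of_notMem hx, K.base_mem C (C.par_out x hx (by simp [h2])).1] at h1
  exact h1

/-- The new blossom is matched within itself except at `b`: outer members other than `b` have their
parent or blossom mate in it, and an inner member is passed by a tree path that comes through its
mate. -/
theorem mate_mem {x : V} (hxB : x ∈ s.cycleBlossom α u v) (hne : x ≠ b) :
    mate M x ∈ s.cycleBlossom α u v ∧ mate M x ≠ x := by
  have hm := (K.mem_iff C).1 hxB
  have hxo : s.owner x ≠ none := by simp [hm.1]
  by_cases hx : x ∈ F.out
  · by_cases hb : F.base x = x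
    · have hn : F.nd x = x := by rw [Forest.nd_of_mem hx, hb]
      have := K.up_mem C hn hxB hne
      rw [Forest.up_of_mem hx] at this
      refine ⟨this, fun h => hne ?_⟩
      rw [hn] at hm
      exact (C.desc_of_free h hxo hm.2.2).symm
    · have := C.mate_out x hx hb
      refine ⟨K.mem_of_nd C ?_ hxB, this.2.2⟩
      rw [Forest.nd_of_mem this.1, Forest.nd_of_mem hx, this.2.1]
  · refine ⟨?_, C.mate_ne_of_notOut hx hxo⟩
    have h1 := C.mate_inner x hx hxo
    rw [Forest.nd_of_notMem hx] at hm
    rw [K.mem_iff C, C.mate_owner, Forest.nd_of_mem h1.1, h1.2]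
    refine ⟨hm.1, ?_, ?_⟩
    · rcases hm.2.1 with h | h
      · exact Or.inl (C.desc_mate_of_desc h (K.rep_u C)
          (fun h => hx (h ▸ (C.nd_mem_iff u).2 K.u_out)) hx)
      · exact Or.inr (C.desc_mate_of_desc h (K.rep_v C)
          (fun h => hx (h ▸ (C.nd_mem_iff v).2 K.v_out)) hx)
    · have := Forest.desc_up (F := F) (M := M) (mate M x)
      rw [C.up_mate hx hxo] at this
      exact this.trans hm.2.2

theorem mate_b_notMem (h : mate M b ≠ b) : mate M b ∉ F.out ∧ mate M b ∉ s.cycleBlossom α u v := by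
  have h1 := C.mate_base b (K.b_out C) (K.base_b C) h
  refine ⟨h1, fun h2 => ?_⟩
  have h3 := ((K.mem_iff C).1 h2).2.2
  rw [Forest.nd_of_notMem h1] at h3
  have h4 := Forest.desc_up (F := F) (M := M) b
  rw [Forest.up_of_mem (K.b_out C)] at h4
  exact h (C.desc_antisymm h4 h3 (K.rep_b C))

theorem base_of_mem {x : V} (h : x ∈ s.cycleBlossom α u v) :
    (F.contract (s.cycleBlossom α u v) b).base x = b := if_pos h

theorem base_of_notMem {x : V} (h : x ∉ s.cycleBlossom α u v) :
    (F.contract (s.cycleBlossom α u v) b).base x = F.base x := if_neg h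

theorem nd_of_mem {x : V} (h : x ∈ s.cycleBlossom α u v) :
    (F.contract (s.cycleBlossom α u v) b).nd x = b := by
  rw [Forest.nd_of_mem (Or.inr h), K.base_of_mem C h]

theorem nd_of_notMem {x : V} (h : x ∉ s.cycleBlossom α u v) :
    (F.contract (s.cycleBlossom α u v) b).nd x = F.nd x := by
  by_cases hx : x ∈ F.out
  · rw [Forest.nd_of_mem (Or.inl hx), K.base_of_notMem C h, Forest.nd_of_mem hx]
  · rw [Forest.nd_of_notMem (by rintro (h' | h'); exacts [hx h', h h']), Forest.nd_of_notMem hx]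

theorem root_of_mem {x : V} (h : x ∈ s.cycleBlossom α u v) :
    (s.contract M α u v).root x = s.cycleBlossom α u v := if_pos h

theorem root_of_notMem {x : V} (h : x ∉ s.cycleBlossom α u v) :
    (s.contract M α u v).root x = s.root x := if_neg h

theorem work_self : (s.contract M α u v).work α = some (s.cycleBlossom α u v) := by
  unfold PhaseState.contract
  classical
  dsimp only
  rw [Function.update_apply, if_pos rfl]

theorem work_of_ne {γ : V} (h : γ ≠ α) : (s.contract M α u v).work γ = s.work γ := by
  unfold PhaseState.contract
  classical
  dsimp only
  rw [Function.update_apply, if_neg h]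

theorem lab_of_notMem {x : V} (h : x ∉ s.cycleBlossom α u v) :
    lab M (s.contract M α u v) x = lab M s x := if_neg fun h' => h h'.2.1

theorem lab_of_mem {x : V} (h : x ∈ s.cycleBlossom α u v) (hne : x ≠ b) :
    lab M (s.contract M α u v) x = 0 := by
  have := K.mate_mem C h hne
  exact if_pos ⟨(adj_iff_mate C.isMatching).2 ⟨rfl, this.2⟩, h, this.1⟩

theorem dist_of_notMem {x : V} (h : x ∉ s.cycleBlossom α u v) :
    dist M (s.contract M α u v) x = dist M s x := by
  unfold dist
  split_ifs
  · rfl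
  · exact if_neg fun h' => h h'.2.2

theorem dist_b : dist M (s.contract M α u v) b = dist M s b := by
  unfold dist
  split_ifs with hf
  · rfl
  · exact if_neg fun h' => (K.mate_b_notMem C hf).2 h'.2.1

theorem owner_mem {x : V} (h : x ∈ s.cycleBlossom α u v) : s.owner x = some α :=
  ((K.mem_iff C).1 h).1

/-- The matched arc at `b` leaves the blossom, so the distance of `b` is not reset, and labels set
to 0 no longer belong to inner vertices. -/
theorem core : Core M (s.contract M α u v) (F.contract (s.cycleBlossom α u v) b) ℓ := by
  have hbm := K.b_mem C
  refine
    { isMatching := C.isMatching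
      free_owner := C.free_owner, owner_free := C.owner_free, owner_eq := C.owner_eq
      free_out := fun x h h' => Or.inl (C.free_out x h h'), out_owner := ?_
      removed_owner := C.removed_owner, mate_removed := C.mate_removed
      mate_owner := C.mate_owner, base_out := ?_, base_base := ?_
      base_owner := ?_, mate_out := ?_, mate_base := ?_, mate_inner := ?_, par_out := ?_
      root_out := ?_, root_notOut := ?_, arcs_adj := ?_, arcs_owner := ?_, arcs_char := ?_
      lab_lt := ?_, lab_le := ?_, lab_none := ?_, work_eq := ?_ }
  · rintro x (hx | hx)
    · exact C.out_owner x hx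
    · change s.owner x ≠ none
      simp [K.owner_mem C hx]
  · intro x hx
    by_cases hB : x ∈ s.cycleBlossom α u v
    · rw [K.base_of_mem C hB]; exact Or.inr hbm
    · rw [K.base_of_notMem C hB]; exact Or.inl (C.base_out x (hx.resolve_right hB))
  · intro x hx
    by_cases hB : x ∈ s.cycleBlossom α u v
    · rw [K.base_of_mem C hB, K.base_of_mem C hbm]
    · have hxo := hx.resolve_right hB
      rw [K.base_of_notMem C hB, K.base_of_notMem C (fun h => hB ((K.base_mem C hxo).1 h)),
        C.base_base x hxo]
  · intro x hx
    by_cases hB : x ∈ s.cycleBlossom α u v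
    · rw [K.base_of_mem C hB]
      change s.owner b = s.owner x
      rw [K.owner_b C, K.owner_mem C hB]
    · rw [K.base_of_notMem C hB]
      exact C.base_owner x (hx.resolve_right hB)
  · intro x hx hne
    by_cases hB : x ∈ s.cycleBlossom α u v
    · rw [K.base_of_mem C hB] at hne ⊢
      have := K.mate_mem C hB hne.symm
      rw [K.base_of_mem C this.1]
      exact ⟨Or.inr this.1, rfl, this.2⟩
    · have hxo := hx.resolve_right hB
      rw [K.base_of_notMem C hB] at hne ⊢
      have := C.mate_out x hxo hne
      have hmB : mate M x ∉ s.cycleBlossom α u v := by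
        intro h
        refine hB (K.mem_of_nd C ?_ h)
        rw [Forest.nd_of_mem this.1, Forest.nd_of_mem hxo, this.2.1]
      rw [K.base_of_notMem C hmB]
      exact ⟨Or.inl this.1, this.2⟩
  · intro x hx hb hm
    by_cases hB : x ∈ s.cycleBlossom α u v
    · rw [K.base_of_mem C hB] at hb
      subst hb
      have := K.mate_b_notMem C hm
      rintro (h | h)
      exacts [this.1 h, this.2 h]
    · have hxo := hx.resolve_right hB
      rw [K.base_of_notMem C hB] at hb
      have h1 := C.mate_base x hxo hb hm
      rintro (h | h)
      · exact h1 h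
      · have := (K.mate_mem C h (fun h' => h1 (h' ▸ K.b_out C))).1
        rw [C.mate_mate] at this
        exact hB this
  · intro w hw hwo
    have hwF : w ∉ F.out := fun h => hw (Or.inl h)
    have hwB : w ∉ s.cycleBlossom α u v := fun h => hw (Or.inr h)
    have h1 := C.mate_inner w hwF hwo
    refine ⟨Or.inl h1.1, ?_⟩
    by_cases hB : mate M w ∈ s.cycleBlossom α u v
    · rw [K.base_of_mem C hB]
      by_contra hne
      have := (K.mate_mem C hB (fun h => hne h.symm)).1
      rw [C.mate_mate] at this
      exact hwB this
    · rw [K.base_of_notMem C hB, h1.2]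
  · intro w hw hwo
    have h1 := C.par_out w (fun h => hw (Or.inl h)) hwo
    exact ⟨Or.inl h1.1, h1.2.1, Or.inr h1.2.2.1, Or.inr h1.2.2.2⟩
  · intro x hx
    ext y
    by_cases hB : x ∈ s.cycleBlossom α u v
    · rw [K.root_of_mem C hB, K.base_of_mem C hB]
      constructor
      · exact fun hy => ⟨Or.inr hy, K.base_of_mem C hy⟩
      · rintro ⟨hy, hyb⟩
        by_contra hyB
        have hyo := hy.resolve_right hyB
        rw [K.base_of_notMem C hyB] at hyb
        exact hyB ((K.base_mem C hyo).1 (hyb ▸ hbm))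
    · have hxo := hx.resolve_right hB
      rw [K.root_of_notMem C hB, K.base_of_notMem C hB, C.root_out x hxo]
      constructor
      · rintro ⟨hy, hyb⟩
        refine ⟨Or.inl hy, ?_⟩
        rw [K.base_of_notMem C, hyb]
        intro h
        exact hB ((K.base_mem C hxo).1 (hyb ▸ (K.base_mem C hy).2 h))
      · rintro ⟨hy, hyb⟩
        by_cases hyB : y ∈ s.cycleBlossom α u v
        · rw [K.base_of_mem C hyB] at hyb
          exact absurd ((K.base_mem C hxo).1 (hyb ▸ hbm)) hB
        · rw [K.base_of_notMem C hyB] at hyb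
          exact ⟨hy.resolve_right hyB, hyb⟩
  · intro x hx
    rw [K.root_of_notMem C (fun h => hx (Or.inr h))]
    exact C.root_notOut x fun h => hx (Or.inl h)
  · rintro x y (h | h)
    · obtain ⟨rfl, rfl⟩ := Prod.mk.inj h
      exact K.adj
    · exact C.arcs_adj x y h
  · rintro x y (h | h)
    · obtain ⟨rfl, rfl⟩ := Prod.mk.inj h
      change s.owner x ≠ none ∧ s.owner x = s.owner y
      rw [K.u_owner, K.v_owner]
      simp
    · exact C.arcs_owner x y h
  · rintro x y (h | h)
    · obtain ⟨rfl, rfl⟩ := Prod.mk.inj h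
      left
      rw [K.base_of_mem C (K.u_mem C), K.base_of_mem C (K.v_mem C)]
      exact ⟨Or.inr (K.u_mem C), Or.inr (K.v_mem C), rfl⟩
    · have hboth : x ∈ s.cycleBlossom α u v → y ∈ s.cycleBlossom α u v →
          x ∈ (F.contract (s.cycleBlossom α u v) b).out ∧
          y ∈ (F.contract (s.cycleBlossom α u v) b).out ∧
          (F.contract (s.cycleBlossom α u v) b).base x =
            (F.contract (s.cycleBlossom α u v) b).base y := by
        intro hx hy
        rw [K.base_of_mem C hx, K.base_of_mem C hy]
        exact ⟨Or.inr hx, Or.inr hy, rfl⟩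
      rcases C.arcs_char x y h with ⟨h1, h2, h3⟩ | ⟨h1, h2⟩ | ⟨h1, h2⟩
      · left
        have hxy := K.mem_congr C (x := x) (y := y)
          (by rw [Forest.nd_of_mem h1, Forest.nd_of_mem h2, h3])
        by_cases hB : x ∈ s.cycleBlossom α u v
        · exact hboth hB (hxy.1 hB)
        · rw [K.base_of_notMem C hB, K.base_of_notMem C (fun h => hB (hxy.2 h))]
          exact ⟨Or.inl h1, Or.inl h2, h3⟩
      · by_cases hB : y ∈ s.cycleBlossom α u v
        · exact Or.inl (hboth (h2 ▸ K.par_mem C h1 hB) hB)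
        · exact Or.inr (Or.inl ⟨by rintro (h | h); exacts [h1 h, hB h], h2⟩)
      · by_cases hB : x ∈ s.cycleBlossom α u v
        · exact Or.inl (hboth hB (h2 ▸ (K.mate_mem C hB (fun h => h1 (h ▸ K.b_out C))).1))
        · exact Or.inr (Or.inr ⟨by rintro (h | h); exacts [h1 h, hB h], h2⟩)
  · intro w hw hwo
    have hwF : w ∉ F.out := fun h => hw (Or.inl h)
    have hwB : w ∉ s.cycleBlossom α u v := fun h => hw (Or.inr h)
    rw [K.lab_of_notMem C hwB]
    have h1 := C.lab_lt w hwF hwo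
    have h2 := C.par_out w hwF hwo
    change dist M _ ((F.contract (s.cycleBlossom α u v) b).base (F.par w)) < _
    by_cases hp : F.par w ∈ s.cycleBlossom α u v
    · rw [K.base_of_mem C hp, K.dist_b C]
      -- The former parent blossom of `w` lies below `b`, so its distance is at least that of `b`.
      have h3 := C.desc_rk ((K.mem_iff C).1 hp).2.2 (C.rep_nd (by rw [h2.2.1]; exact hwo))
      rw [Forest.nd_of_mem h2.1] at h3
      rcases h3 with h3 | h3
      · rwa [h3]
      · rw [rk, if_pos (K.b_out C), rk, if_pos (C.base_out _ h2.1)] at h3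
        omega
    · rwa [K.base_of_notMem C hp, K.dist_of_notMem C (fun h => hp ((K.base_mem C h2.1).1 h))]
  · intro w hw hwo
    rw [K.lab_of_notMem C (fun h => hw (Or.inr h))]
    exact C.lab_le w (fun h => hw (Or.inl h)) hwo
  · intro w hwo hr hm
    rw [K.lab_of_notMem C]
    · exact C.lab_none w hwo hr hm
    · intro h
      have := K.owner_mem C h
      change s.owner w = none at hwo
      rw [hwo] at this
      cases this
  · intro γ W hW
    by_cases hγ : γ = α
    · subst hγ
      rw [K.work_self C, Option.some_inj] at hW
      exact ⟨u, Or.inl K.u_out, K.u_owner, by rw [K.root_of_mem C (K.u_mem C), hW]⟩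
    · rw [K.work_of_ne C hγ] at hW
      obtain ⟨x, h1, h2, h3⟩ := C.work_eq γ W hW
      refine ⟨x, Or.inl h1, h2, ?_⟩
      rw [K.root_of_notMem C, h3]
      intro h
      rw [K.owner_mem C h, Option.some_inj] at h2
      exact hγ h2.symm

theorem evolves : Evolves M s F (s.contract M α u v) (F.contract (s.cycleBlossom α u v) b) := by
  have hB : ∀ γ ∉ (s.contract M α u v).modified, γ ≠ α ∧
      ∀ x, s.owner x = some γ → x ∉ s.cycleBlossom α u v := by
    intro γ hγ
    have h1 : γ ≠ α := fun h => hγ (Or.inl h)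
    refine ⟨h1, fun x hx h => h1 ?_⟩
    rw [K.owner_mem C h, Option.some_inj] at hx
    exact hx.symm
  refine ⟨?_, subset_rfl, fun x hx => Or.inl (Or.inl hx), rfl, fun x hx => Or.inr hx, ?_, ?_,
    fun _ _ _ => Iff.rfl, ?_, ?_, ?_⟩
  · intro x y
    unfold PhaseState.contract
    dsimp only
    split_ifs
    · exact Nat.zero_le _
    · rfl
  · intro γ hγ
    have : γ ≠ α := by
      rintro rfl
      rw [K.u_work] at hγ
      cases hγ
    rw [K.work_of_ne C this, hγ]
  · exact fun γ hγ => K.work_of_ne C (hB γ hγ).1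
  · intro γ hγ x hx
    exact or_iff_left ((hB γ hγ).2 x hx)
  · intro γ hγ x hx
    exact K.root_of_notMem C ((hB γ hγ).2 x hx)
  · intro γ hγ x hxo hx
    have h1 := (hB γ hγ).2 x hx
    rw [K.base_of_notMem C h1, K.dist_of_notMem C (fun h => h1 ((K.base_mem C hxo).1 h))]

/-- For a base that remains a base, the step to its mate is the same in both forests. -/
theorem nd_mate {c : V} (hc : c ∈ F.out) (hcb : F.base c = c)
    (hcB : c = b ∨ c ∉ s.cycleBlossom α u v) :
    (F.contract (s.cycleBlossom α u v) b).nd (mate M c) = mate M c ∧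
      F.nd (mate M c) = mate M c ∧ (F.contract (s.cycleBlossom α u v) b).up M c = mate M c := by
  refine ⟨?_, ?_, Forest.up_of_mem (Or.inl hc)⟩
  · by_cases hm : mate M c = c
    · rw [hm]
      rcases hcB with rfl | h
      · exact K.nd_of_mem C (K.b_mem C)
      · rw [K.nd_of_notMem C h, Forest.nd_of_mem hc, hcb]
    · have h1 := C.mate_base c hc hcb hm
      rw [K.nd_of_notMem C, Forest.nd_of_notMem h1]
      intro h
      have h2 := (K.mate_mem C h (fun h' => h1 (h' ▸ K.b_out C))).1
      rw [C.mate_mate] at h2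
      rcases hcB with rfl | h3
      · exact (K.mate_b_notMem C hm).2 h
      · exact h3 h2
  · by_cases hm : mate M c = c
    · rw [hm, Forest.nd_of_mem hc, hcb]
    · exact Forest.nd_of_notMem (C.mate_base c hc hcb hm)

theorem nd_par {w : V} (hw : w ∉ F.out) (hwo : s.owner w ≠ none)
    (hwB : w ∉ s.cycleBlossom α u v) :
    (F.contract (s.cycleBlossom α u v) b).up M w =
      (F.contract (s.cycleBlossom α u v) b).nd (F.par w) ∧ F.up M w = F.nd (F.par w) := by
  have hp := (C.par_out w hw hwo).1
  rw [Forest.up_of_notMem (by rintro (h | h); exacts [hw h, hwB h]), Forest.up_of_notMem hw,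
    Forest.nd_of_mem hp, Forest.nd_of_mem (Or.inl hp)]
  exact ⟨rfl, rfl⟩

/-- A climb that enters the new blossom leaves it from `b`, and in the old forest every vertex of
the blossom lies below `b`. -/
theorem desc_of_contract {y z : V} (hz : z = b ∨ z ∉ s.cycleBlossom α u v) (hy : s.owner y ≠ none)
    (h : (F.contract (s.cycleBlossom α u v) b).Desc M
      ((F.contract (s.cycleBlossom α u v) b).nd y) z) : F.Desc M (F.nd y) z := by
  -- Quantifying over `y` is necessary: all old representatives in the blossom share the new
  -- representative `b`.
  have key : ∀ c, (F.contract (s.cycleBlossom α u v) b).Desc M c z → ∀ y, s.owner y ≠ none →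
      (F.contract (s.cycleBlossom α u v) b).nd y = c → F.Desc M (F.nd y) z := by
    intro c hc
    induction hc using Relation.ReflTransGen.head_induction_on with
    | refl =>
      intro y hy h
      by_cases hB : y ∈ s.cycleBlossom α u v
      · rw [K.nd_of_mem C hB] at h
        rw [← h]
        exact ((K.mem_iff C).1 hB).2.2
      · rw [K.nd_of_notMem C hB] at h
        rw [h]
        exact .refl _
    | @head c d h1 _ ih =>
      intro y hy h
      subst h1
      subst h
      by_cases hB : y ∈ s.cycleBlossom α u v
      · rw [K.nd_of_mem C hB] at ih
        obtain ⟨h2, h3, h4⟩ := K.nd_mate C (K.b_out C) (K.base_b C) (Or.inl rfl)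
        have h5 := ih (mate M b) (by rw [C.mate_owner]; exact (K.rep_b C).1) (by rw [h2, h4])
        rw [h3] at h5
        have h6 := Forest.desc_up (F := F) (M := M) b
        rw [Forest.up_of_mem (K.b_out C)] at h6
        exact ((K.mem_iff C).1 hB).2.2.trans (h6.trans h5)
      · rw [K.nd_of_notMem C hB] at ih
        by_cases hyo : y ∈ F.out
        · rw [Forest.nd_of_mem hyo] at ih ⊢
          have hbo := C.base_out y hyo
          obtain ⟨h2, h3, h4⟩ := K.nd_mate C hbo (C.base_base y hyo)
            (Or.inr (fun h => hB ((K.base_mem C hyo).1 h)))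
          have h5 := ih (mate M (F.base y))
            (by rw [C.mate_owner, C.base_owner y hyo]; exact hy) (by rw [h2, h4])
          rw [h3] at h5
          have h6 := Forest.desc_up (F := F) (M := M) (F.base y)
          rw [Forest.up_of_mem hbo] at h6
          exact h6.trans h5
        · rw [Forest.nd_of_notMem hyo] at ih ⊢
          obtain ⟨h2, h3⟩ := K.nd_par C hyo hy hB
          have h5 := ih (F.par y) (by rw [(C.par_out y hyo hy).2.1]; exact hy) h2.symm
          rw [← h3] at h5
          exact (Forest.desc_up y).trans h5
  exact key _ h y hy rfl

/-- Old steps inside the blossom collapse to a point; all other steps survive with their endpoints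
contracted. -/
theorem desc_contract {y z : V} (hy : s.owner y ≠ none) (h : F.Desc M (F.nd y) z) :
    (F.contract (s.cycleBlossom α u v) b).Desc M ((F.contract (s.cycleBlossom α u v) b).nd y)
      ((F.contract (s.cycleBlossom α u v) b).nd z) := by
  induction h with
  | refl =>
    by_cases hB : y ∈ s.cycleBlossom α u v
    · rw [K.nd_of_mem C hB, K.nd_of_mem C ((K.nd_mem C).2 hB)]
      exact .refl _
    · rw [K.nd_of_notMem C hB, K.nd_of_notMem C (fun h => hB ((K.nd_mem C).1 h)), C.nd_nd]
      exact .refl _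
  | @tail c d h1 h2 ih =>
    subst h2
    refine ih.trans ?_
    have hc := (C.desc_rep h1 (C.rep_nd hy)).1
    by_cases hB : c ∈ s.cycleBlossom α u v
    · by_cases hcb : c = b
      · subst hcb
        obtain ⟨h2, h3, h4⟩ := K.nd_mate C (K.b_out C) (K.base_b C) (Or.inl rfl)
        rw [Forest.up_of_mem (K.b_out C), K.nd_of_mem C hB, h2, ← h4]
        exact Forest.desc_up _
      · rw [K.nd_of_mem C hB, K.nd_of_mem C (K.up_mem C hc.2 hB hcb)]
        exact .refl _
    · rw [K.nd_of_notMem C hB, hc.2]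
      by_cases hco : c ∈ F.out
      · obtain ⟨h2, h3, h4⟩ := K.nd_mate C hco (hc.base_eq hco) (Or.inr hB)
        rw [Forest.up_of_mem hco, h2, ← h4]
        exact Forest.desc_up _
      · obtain ⟨h2, h3⟩ := K.nd_par C hco hc.1 hB
        have h4 : (F.contract (s.cycleBlossom α u v) b).nd (F.up M c) =
            (F.contract (s.cycleBlossom α u v) b).nd (F.par c) := by
          rw [h3]
          by_cases hp : F.par c ∈ s.cycleBlossom α u v
          · rw [K.nd_of_mem C hp, K.nd_of_mem C ((K.nd_mem C).2 hp)]
          · rw [K.nd_of_notMem C hp, K.nd_of_notMem C (fun h => hp ((K.nd_mem C).1 h)), C.nd_nd]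
        rw [h4, ← h2]
        exact Forest.desc_up _

theorem onPath_b : OnPath M (s.contract M α u v) (F.contract (s.cycleBlossom α u v) b) b := by
  refine ⟨α, u, K.owner_b C, K.u_owner, ?_, ?_⟩
  · rw [K.work_self C, K.root_of_mem C (K.u_mem C)]
  · rw [K.nd_of_mem C (K.u_mem C)]
    exact .refl _

theorem notMem_of_owner {y γ : V} (hγ : γ ≠ α) (hy : s.owner y = some γ) :
    y ∉ s.cycleBlossom α u v := by
  intro h
  rw [K.owner_mem C h, Option.some_inj] at hy
  exact hγ hy.symm

theorem onPath_of_onPath {x : V} (hx : x ∉ s.cycleBlossom α u v) (hxn : F.nd x = x)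
    (h : OnPath M s F x) :
    OnPath M (s.contract M α u v) (F.contract (s.cycleBlossom α u v) b) x := by
  obtain ⟨γ, y, hxo, hyo, hwk, hd⟩ := h
  have hy : s.owner y ≠ none := by simp [hyo]
  have hd' := K.desc_contract C hy hd
  rw [K.nd_of_notMem C hx, hxn] at hd'
  by_cases hγ : γ = α
  · subst hγ
    refine ⟨γ, u, hxo, K.u_owner, ?_, ?_⟩
    · rw [K.work_self C, K.root_of_mem C (K.u_mem C)]
    · rw [K.u_work, Option.some_inj] at hwk
      have hyB := K.mem_of_nd C (C.root_eq_iff.1 hwk).symm (K.u_mem C)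
      rw [K.nd_of_mem C hyB] at hd'
      rwa [K.nd_of_mem C (K.u_mem C)]
  · refine ⟨γ, y, hxo, hyo, ?_, hd'⟩
    rw [K.work_of_ne C hγ, K.root_of_notMem C (K.notMem_of_owner C hγ hyo), hwk]

theorem onPath_old {x : V} (hx : x = b ∨ x ∉ s.cycleBlossom α u v)
    (h : OnPath M (s.contract M α u v) (F.contract (s.cycleBlossom α u v) b) x) :
    OnPath M s F x := by
  obtain ⟨γ, y, hxo, hyo, hwk, hd⟩ := h
  change s.owner y = some γ at hyo
  have hy : s.owner y ≠ none := by simp [hyo]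
  by_cases hγ : γ = α
  · subst hγ
    refine ⟨γ, u, hxo, K.u_owner, K.u_work, ?_⟩
    apply K.desc_of_contract C hx (by simp [K.u_owner])
    rw [K.work_self C, Option.some_inj] at hwk
    have hyB : y ∈ s.cycleBlossom γ u v := hwk ▸ (K.core C).mem_root_self y
    rw [K.nd_of_mem C hyB] at hd
    rwa [K.nd_of_mem C (K.u_mem C)]
  · refine ⟨γ, y, hxo, hyo, ?_, K.desc_of_contract C hx hy hd⟩
    rwa [K.work_of_ne C hγ, K.root_of_notMem C (K.notMem_of_owner C hγ hyo)] at hwk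

/-- The new blossom is the working vertex, hence active. Off the active paths distances are
unchanged. -/
theorem explored (hK : Explored M s F) :
    Explored M (s.contract M α u v) (F.contract (s.cycleBlossom α u v) b) := by
  intro x hx hp y hadj hy hyr
  have hxB : x ∉ s.cycleBlossom α u v := by
    intro h
    rw [K.base_of_mem C h] at hp
    exact hp (K.onPath_b C)
  have hxo := hx.resolve_right hxB
  have hbB := fun h => hxB ((K.base_mem C hxo).1 h)
  rw [K.base_of_notMem C hxB] at hp ⊢
  rw [K.dist_of_notMem C hbB]
  refine ((K.evolves C).lab_le y).trans (hK x hxo ?_ y hadj (fun h => hy (Or.inl h)) hyr)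
  exact fun h => hp (K.onPath_of_onPath C hbB (C.rep_base hxo).2 h)

/-- Edges at the new blossom are covered by it, as it is the working vertex of a structure now
marked as modified. For other edges the old witness cannot be the old working vertex of `S_α`, which
was swallowed. -/
theorem freshPairs (hJ : FreshPairs M s F) :
    FreshPairs M (s.contract M α u v) (F.contract (s.cycleBlossom α u v) b) := by
  intro x hx y hy hadj hfr hne
  have hα : α ∈ (s.contract M α u v).modified := Or.inl rfl
  by_cases hB : ∃ z, (z = x ∨ z = y) ∧ z ∈ s.cycleBlossom α u v
  · obtain ⟨z, hz, hzB⟩ := hB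
    exact ⟨z, hz, α, K.owner_mem C hzB, by rw [K.work_self C, K.root_of_mem C hzB], hα⟩
  · push Not at hB
    have hxB := hB x (Or.inl rfl)
    have hyB := hB y (Or.inr rfl)
    rw [K.base_of_notMem C hxB, K.base_of_notMem C hyB] at hne
    obtain ⟨z, hz, γ, h1, h2, h3⟩ := hJ x (hx.resolve_right hxB) y (hy.resolve_right hyB) hadj
      hfr hne
    have hzB := hB z hz
    have hγ : γ ≠ α := by
      rintro rfl
      rw [K.u_work, Option.some_inj] at h2
      exact hzB (K.mem_of_nd C (C.root_eq_iff.1 h2).symm (K.u_mem C))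
    exact ⟨z, hz, γ, h1, by rw [K.work_of_ne C hγ, K.root_of_notMem C hzB, h2], Or.inr h3⟩

theorem sizes [Fintype V] (S : Sizes M s F ℓ L) :
    Sizes M (s.contract M α u v) (F.contract (s.cycleBlossom α u v) b) ℓ L := by
  refine ⟨?_, S.verts⟩
  intro w hw hwo
  have hwB : w ∉ s.cycleBlossom α u v := fun h => hw (Or.inr h)
  rw [K.lab_of_notMem C hwB]
  refine (Set.ncard_le_ncard ?_).trans (S.below w (fun h => hw (Or.inl h)) hwo)
  rintro x ⟨hx, hd⟩
  exact ⟨hx, K.desc_of_contract C (Or.inr hwB) hx hd⟩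

/-- The blossom contains a base `x ≠ b`. Its mate was inner, so it had a positive label, and this
becomes 0: a gain of 3 against at most one newly modified structure. The strict drop also makes
repeated contraction terminate. -/
theorem potential_le [Fintype V] :
    potential M (s.contract M α u v) (F.contract (s.cycleBlossom α u v) b) +
      (activeModified (s.contract M α u v)).ncard + 2 ≤
    potential M s F + (activeModified s).ncard := by
  classical
  have E := K.evolves C
  obtain ⟨w, hw, hwl⟩ : ∃ w, mate M w ≠ w ∧ lab M (s.contract M α u v) w < lab M s w := by
    obtain ⟨x, hx, hxB, hxn, hne⟩ : ∃ x, x ∈ F.out ∧ x ∈ s.cycleBlossom α u v ∧ F.base x = x ∧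
        x ≠ b := by
      by_cases h : F.nd u = b
      · refine ⟨F.nd v, (C.nd_mem_iff v).2 K.v_out, (K.nd_mem C).2 (K.v_mem C), ?_, ?_⟩
        · rw [Forest.nd_of_mem K.v_out, C.base_base v K.v_out]
        · rintro h'
          exact K.ne (h.trans h'.symm)
      · refine ⟨F.nd u, (C.nd_mem_iff u).2 K.u_out, (K.nd_mem C).2 (K.u_mem C), ?_, h⟩
        rw [Forest.nd_of_mem K.u_out, C.base_base u K.u_out]
    obtain ⟨h1, h2⟩ := K.mate_mem C hxB hne
    have h3 := C.mate_base x hx hxn h2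
    refine ⟨mate M x, ?_, ?_⟩
    · rw [C.mate_mate]; exact h2.symm
    · rw [K.lab_of_mem C h1 (fun h => h3 (h ▸ K.b_out C))]
      exact Nat.zero_lt_of_lt (C.lab_lt _ h3 (by rw [C.mate_owner]; exact C.out_owner x hx))
  have h1 := E.sum_lab_lt hw hwl
  have h2 : (critical M (s.contract M α u v) (F.contract (s.cycleBlossom α u v) b)).ncard ≤
      (critical M s F).ncard := by
    refine Set.ncard_le_ncard ?_
    rintro x ⟨hx1, hx2, hx3, hx4⟩
    by_cases hB : x ∈ s.cycleBlossom α u v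
    · rw [K.base_of_mem C hB] at hx2
      subst hx2
      exact ⟨K.b_out C, K.base_b C, hx3, K.onPath_old C (Or.inl rfl) hx4⟩
    · rw [K.base_of_notMem C hB] at hx2
      exact ⟨hx1.resolve_right hB, hx2, hx3, K.onPath_old C (Or.inr hB) hx4⟩
  have h3 : (activeModified (s.contract M α u v)).ncard ≤ (activeModified s).ncard + 1 := by
    refine (E.activeModified_subset (X := {α}) ?_).trans (by rw [Set.ncard_singleton])
    rintro γ (h | h) _
    exacts [Or.inr h, Or.inl h]
  unfold potential
  omega

end Contracting

end

/-! ### Removal of two structures -/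

section

variable {V : Type*} {G : SimpleGraph V}

/-- The forest without the vertices in `R`. -/
def Forest.delete (F : Forest V) (R : Set V) : Forest V := ⟨F.out \ R, F.base, F.par⟩

theorem Forest.mem_delete {F : Forest V} {R : Set V} {x : V} :
    x ∈ (F.delete R).out ↔ x ∈ F.out ∧ x ∉ R := Iff.rfl

/-- The vertices of two structures. -/
def vertsOfPair (s : PhaseState G) (α β : V) : Set V := s.vertsOf α ∪ s.vertsOf β

/-- The paths found so far are disjoint augmenting paths on removed vertices, and the number of
removed vertices is bounded in terms of their number. -/
structure GoodPaths (M : G.Subgraph) (s : PhaseState G) (D : ℕ) : Prop where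
  aug : ∀ p ∈ s.paths, IsAugmentingPath M p.2
  disjoint : DisjointPaths s.paths
  support : ∀ p ∈ s.paths, ∀ x ∈ p.2.support, x ∈ s.removed
  ncard : s.removed.ncard ≤ 2 * s.paths.length * D

variable {M : G.Subgraph} {s s' : PhaseState G} {F : Forest V} {ℓ L : ℕ} {α β : V}
  {P : BundledPath G}

namespace Core

variable (C : Core M s F ℓ)
include C

theorem mem_pair_congr {x y : V} (h : s.owner x = s.owner y) :
    x ∈ vertsOfPair s α β ↔ y ∈ vertsOfPair s α β := by
  change s.owner x = some α ∨ s.owner x = some β ↔ s.owner y = some α ∨ s.owner y = some β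
  rw [h]

theorem owner_of_mem {x : V} (h : x ∈ vertsOfPair s α β) : s.owner x ≠ none := by
  rcases h with h | h <;> rw [show s.owner x = _ from h] <;> simp

theorem remove_owner_of_mem {x : V} (h : x ∈ vertsOfPair s α β) :
    (s.removeStructures α β P).owner x = none := if_pos h

theorem remove_owner {x : V} (h : x ∉ vertsOfPair s α β) :
    (s.removeStructures α β P).owner x = s.owner x := if_neg h

theorem remove_owner_some {x γ : V} : (s.removeStructures α β P).owner x = some γ ↔
    s.owner x = some γ ∧ γ ≠ α ∧ γ ≠ β := by
  by_cases h : x ∈ vertsOfPair s α β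
  · rw [C.remove_owner_of_mem h]
    refine iff_of_false (by simp) ?_
    rintro ⟨h1, h2, h3⟩
    rcases h with h | h
    · exact h2 (Option.some_inj.1 (h1.symm.trans h))
    · exact h3 (Option.some_inj.1 (h1.symm.trans h))
  · rw [C.remove_owner h]
    refine ⟨fun h1 => ⟨h1, ?_, ?_⟩, fun h1 => h1.1⟩
    · rintro rfl; exact h (Or.inl h1)
    · rintro rfl; exact h (Or.inr h1)

theorem remove_owner_ne {x : V} : (s.removeStructures α β P).owner x ≠ none ↔
    s.owner x ≠ none ∧ x ∉ vertsOfPair s α β := by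
  by_cases h : x ∈ vertsOfPair s α β
  · rw [C.remove_owner_of_mem h]
    exact iff_of_false (by simp) (fun h' => h'.2 h)
  · rw [C.remove_owner h]
    exact ⟨fun h' => ⟨h', h⟩, fun h' => h'.1⟩

theorem remove_root {x : V} (h : x ∉ vertsOfPair s α β) :
    (s.removeStructures α β P).root x = s.root x := if_neg h

theorem remove_work {γ : V} (h : (s.removeStructures α β P).work γ ≠ none) : γ ≠ α ∧ γ ≠ β ∧
    (s.removeStructures α β P).work γ = s.work γ := by
  unfold PhaseState.removeStructures at h ⊢
  dsimp only at h ⊢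
  split_ifs at h ⊢ with h1
  · exact absurd rfl h
  · push Not at h1
    exact ⟨h1.1, h1.2, rfl⟩

theorem remove_work_eq {γ : V} (h1 : γ ≠ α) (h2 : γ ≠ β) :
    (s.removeStructures α β P).work γ = s.work γ :=
  if_neg (by rintro (h | h); exacts [h1 h, h2 h])

/-- Bases, mates and tree parents have the owner of the vertex itself, so deleting two owners
deletes whole trees and leaves the others untouched. -/
theorem remove : Core M (s.removeStructures α β P) (F.delete (vertsOfPair s α β)) ℓ := by
  have hvis : ∀ w ∉ (F.delete (vertsOfPair s α β)).out,
      (s.removeStructures α β P).owner w ≠ none →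
      w ∉ F.out ∧ s.owner w ≠ none ∧ w ∉ vertsOfPair s α β := by
    intro w hw hwo
    have := C.remove_owner_ne.1 hwo
    exact ⟨fun h => hw ⟨h, this.2⟩, this⟩
  have hbase : ∀ x ∈ F.out, (F.base x ∈ vertsOfPair s α β ↔ x ∈ vertsOfPair s α β) :=
    fun x hx => C.mem_pair_congr (C.base_owner x hx)
  have hmate : ∀ x, (mate M x ∈ vertsOfPair s α β ↔ x ∈ vertsOfPair s α β) :=
    fun x => C.mem_pair_congr (C.mate_owner x)
  refine
    { isMatching := C.isMatching
      free_owner := ?_, owner_free := ?_, owner_eq := ?_, free_out := ?_, out_owner := ?_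
      removed_owner := ?_, mate_removed := ?_, mate_owner := ?_, base_out := ?_, base_base := ?_
      base_owner := ?_, mate_out := ?_, mate_base := ?_, mate_inner := ?_, par_out := ?_
      root_out := ?_, root_notOut := ?_, arcs_adj := ?_, arcs_owner := ?_, arcs_char := ?_
      lab_lt := ?_, lab_le := ?_, lab_none := ?_, work_eq := ?_ }
  · intro x hx hr
    rw [C.remove_owner (fun h => hr (Or.inr h))]
    exact C.free_owner x hx (fun h => hr (Or.inl h))
  · intro x γ h
    rw [C.remove_owner_some] at h ⊢
    have := C.owner_free x γ h.1
    exact ⟨this.1, this.2, h.2⟩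
  · intro x γ h hf
    rw [C.remove_owner_some] at h
    exact C.owner_eq x γ h.1 hf
  · intro x hf h
    rw [C.remove_owner_ne] at h
    exact ⟨C.free_out x hf h.1, h.2⟩
  · rintro x ⟨h1, h2⟩
    exact C.remove_owner_ne.2 ⟨C.out_owner x h1, h2⟩
  · rintro x (h | h)
    · by_contra h'
      exact (C.remove_owner_ne.1 h').1 (C.removed_owner x h)
    · exact C.remove_owner_of_mem h
  · rintro x (h | h)
    · exact Or.inl (C.mate_removed x h)
    · exact Or.inr ((hmate x).2 h)
  · intro x
    by_cases h : x ∈ vertsOfPair s α β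
    · rw [C.remove_owner_of_mem h, C.remove_owner_of_mem ((hmate x).2 h)]
    · rw [C.remove_owner h, C.remove_owner (fun h' => h ((hmate x).1 h')), C.mate_owner]
  · rintro x ⟨h1, h2⟩
    exact ⟨C.base_out x h1, fun h => h2 ((hbase x h1).1 h)⟩
  · exact fun x hx => C.base_base x hx.1
  · rintro x ⟨h1, h2⟩
    rw [C.remove_owner h2]
    exact (C.remove_owner (fun h => h2 ((hbase x h1).1 h))).trans (C.base_owner x h1)
  · rintro x ⟨h1, h2⟩ hne
    have := C.mate_out x h1 hne
    exact ⟨⟨this.1, fun h => h2 ((hmate x).1 h)⟩, this.2⟩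
  · rintro x ⟨h1, h2⟩ hb hm
    exact fun h => C.mate_base x h1 hb hm h.1
  · intro w hw hwo
    obtain ⟨h1, h2, h3⟩ := hvis w hw hwo
    have := C.mate_inner w h1 h2
    exact ⟨⟨this.1, fun h => h3 ((hmate w).1 h)⟩, this.2⟩
  · intro w hw hwo
    obtain ⟨h1, h2, h3⟩ := hvis w hw hwo
    have hp := C.par_out w h1 h2
    have h4 : F.par w ∉ vertsOfPair s α β := fun h => h3 ((C.mem_pair_congr hp.2.1).1 h)
    refine ⟨⟨hp.1, h4⟩, ?_, ⟨hp.2.2.1, h4, h3⟩, ⟨hp.2.2.2, h3, fun h => h3 ((hmate w).1 h)⟩⟩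
    rw [C.remove_owner h3]
    exact (C.remove_owner h4).trans hp.2.1
  · rintro x ⟨h1, h2⟩
    rw [C.remove_root h2, C.root_out x h1]
    ext y
    constructor
    · rintro ⟨h3, h4⟩
      refine ⟨⟨h3, fun h => h2 ?_⟩, h4⟩
      rw [← hbase x h1, ← h4, hbase y h3]
      exact h
    · rintro ⟨h3, h4⟩
      exact ⟨h3.1, h4⟩
  · intro x hx
    by_cases h : x ∈ vertsOfPair s α β
    · exact if_pos h
    · rw [C.remove_root h]
      exact C.root_notOut x fun h' => hx ⟨h', h⟩
  · rintro x y ⟨h, _⟩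
    exact C.arcs_adj x y h
  · rintro x y ⟨h, h1, h2⟩
    rw [C.remove_owner_ne, C.remove_owner h1, C.remove_owner h2]
    exact ⟨⟨(C.arcs_owner x y h).1, h1⟩, (C.arcs_owner x y h).2⟩
  · rintro x y ⟨h, h1, h2⟩
    rcases C.arcs_char x y h with ⟨h3, h4, h5⟩ | ⟨h3, h4⟩ | ⟨h3, h4⟩
    · exact Or.inl ⟨⟨h3, h1⟩, ⟨h4, h2⟩, h5⟩
    · exact Or.inr (Or.inl ⟨fun h => h3 h.1, h4⟩)
    · exact Or.inr (Or.inr ⟨fun h => h3 h.1, h4⟩)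
  · intro w hw hwo
    obtain ⟨h1, h2, _⟩ := hvis w hw hwo
    exact C.lab_lt w h1 h2
  · intro w hw hwo
    obtain ⟨h1, h2, _⟩ := hvis w hw hwo
    exact C.lab_le w h1 h2
  · intro w hwo hr hm
    rw [C.remove_owner (fun h => hr (Or.inr h))] at hwo
    exact C.lab_none w hwo (fun h => hr (Or.inl h)) hm
  · intro γ W hW
    obtain ⟨h1, h2, h3⟩ := C.remove_work (P := P) (γ := γ) (by rw [hW]; simp)
    rw [h3] at hW
    obtain ⟨x, hx1, hx2, rfl⟩ := C.work_eq γ W hW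
    have h4 := (C.remove_owner_some (P := P)).2 ⟨hx2, h1, h2⟩
    have h5 := (C.remove_owner_ne.1 (show (s.removeStructures α β P).owner x ≠ none by simp [h4])).2
    exact ⟨x, ⟨hx1, h5⟩, h4, (C.remove_root h5).symm⟩

theorem remove_evolves :
    Evolves M s F (s.removeStructures α β P) (F.delete (vertsOfPair s α β)) := by
  have hγ : ∀ γ ∉ (s.removeStructures α β P).modified, γ ≠ α ∧ γ ≠ β ∧
      ∀ x, (s.removeStructures α β P).owner x = some γ → x ∉ vertsOfPair s α β := by
    intro γ h
    refine ⟨fun h' => h (Or.inl h'), fun h' => h (Or.inr (Or.inl h')), fun x hx => ?_⟩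
    exact (C.remove_owner_ne.1 (by rw [hx]; simp)).2
  refine ⟨fun _ _ => le_rfl, fun x hx => Or.inl hx, ?_, rfl, fun x hx => Or.inr (Or.inr hx), ?_,
    ?_, ?_, ?_, ?_, ?_⟩
  · intro x hx
    by_cases h : x ∈ vertsOfPair s α β
    · exact Or.inr (Or.inr h)
    · exact Or.inl ⟨hx, h⟩
  · intro γ h
    by_contra h'
    exact h' ((C.remove_work h').2.2.trans h)
  · exact fun γ h => C.remove_work_eq (hγ γ h).1 (hγ γ h).2.1
  · intro γ h x
    rw [C.remove_owner_some]
    exact and_iff_left ⟨(hγ γ h).1, (hγ γ h).2.1⟩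
  · intro γ h x hx
    exact and_iff_left ((hγ γ h).2.2 x hx)
  · intro γ h x hx
    exact C.remove_root ((hγ γ h).2.2 x hx)
  · exact fun _ _ _ _ _ => rfl

theorem remove_nd {x : V} (h : x ∉ vertsOfPair s α β) :
    (F.delete (vertsOfPair s α β)).nd x = F.nd x := by
  by_cases hx : x ∈ F.out
  · rw [Forest.nd_of_mem hx, Forest.nd_of_mem (Forest.mem_delete.2 ⟨hx, h⟩)]
    rfl
  · rw [Forest.nd_of_notMem hx, Forest.nd_of_notMem fun h' => hx (Forest.mem_delete.1 h').1]

theorem remove_desc {y z : V} (hy : s.owner y ≠ none) (hyR : y ∉ vertsOfPair s α β)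
    (h : (F.delete (vertsOfPair s α β)).Desc M (F.nd y) z) : F.Desc M (F.nd y) z := by
  have hr := C.rep_nd hy
  induction h with
  | refl => exact .refl _
  | @tail c d _ h2 ih =>
    have hc := C.desc_rep ih hr
    have hcR : c ∉ vertsOfPair s α β := by
      rwa [C.mem_pair_congr (hc.2.trans (C.owner_nd y))]
    refine ih.tail ?_
    rw [← h2]
    by_cases hco : c ∈ F.out
    · rw [Forest.up_of_mem hco, Forest.up_of_mem (Forest.mem_delete.2 ⟨hco, hcR⟩)]
    · rw [Forest.up_of_notMem hco, Forest.up_of_notMem fun h => hco (Forest.mem_delete.1 h).1]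
      rfl

theorem desc_remove {y z : V} (hy : s.owner y ≠ none) (hyR : y ∉ vertsOfPair s α β)
    (h : F.Desc M (F.nd y) z) : (F.delete (vertsOfPair s α β)).Desc M (F.nd y) z := by
  have hr := C.rep_nd hy
  induction h with
  | refl => exact .refl _
  | @tail c d h1 h2 ih =>
    have hc := C.desc_rep h1 hr
    have hcR : c ∉ vertsOfPair s α β := by
      rwa [C.mem_pair_congr (hc.2.trans (C.owner_nd y))]
    refine ih.tail ?_
    rw [← h2]
    by_cases hco : c ∈ F.out
    · rw [Forest.up_of_mem hco, Forest.up_of_mem (Forest.mem_delete.2 ⟨hco, hcR⟩)]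
    · rw [Forest.up_of_notMem hco, Forest.up_of_notMem fun h => hco (Forest.mem_delete.1 h).1]
      rfl

theorem onPath_of_remove {x : V}
    (h : OnPath M (s.removeStructures α β P) (F.delete (vertsOfPair s α β)) x) :
    OnPath M s F x := by
  obtain ⟨γ, y, hxo, hyo, hwk, hd⟩ := h
  have h1 := C.remove_owner_some.1 hyo
  have h2 := (C.remove_owner_ne.1 (by rw [hyo]; simp)).2
  rw [C.remove_work_eq h1.2.1 h1.2.2, C.remove_root h2] at hwk
  rw [C.remove_nd h2] at hd
  exact ⟨γ, y, (C.remove_owner_some.1 hxo).1, h1.1, hwk,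
    C.remove_desc (by simp [h1.1]) h2 hd⟩

theorem onPath_remove {x : V} (hx : x ∉ vertsOfPair s α β) (h : OnPath M s F x) :
    OnPath M (s.removeStructures α β P) (F.delete (vertsOfPair s α β)) x := by
  obtain ⟨γ, y, hxo, hyo, hwk, hd⟩ := h
  have h1 : γ ≠ α := by rintro rfl; exact hx (Or.inl hxo)
  have h2 : γ ≠ β := by rintro rfl; exact hx (Or.inr hxo)
  have h3 : y ∉ vertsOfPair s α β := by rwa [C.mem_pair_congr (hyo.trans hxo.symm)]
  refine ⟨γ, y, C.remove_owner_some.2 ⟨hxo, h1, h2⟩, C.remove_owner_some.2 ⟨hyo, h1, h2⟩, ?_, ?_⟩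
  · rw [C.remove_work_eq h1 h2, C.remove_root h3, hwk]
  · rw [C.remove_nd h3]
    exact C.desc_remove (by simp [hyo]) h3 hd

theorem remove_explored (hK : Explored M s F) :
    Explored M (s.removeStructures α β P) (F.delete (vertsOfPair s α β)) := by
  rintro x ⟨hx, hxR⟩ hp y hadj hy hyr
  refine hK x hx (fun h => hp (C.onPath_remove ?_ h)) y hadj ?_ (fun h => hyr (Or.inl h))
  · change F.base x ∉ _
    rwa [C.mem_pair_congr (C.base_owner x hx)]
  · exact fun h => hy ⟨h, fun h' => hyr (Or.inr h')⟩

theorem remove_freshPairs (hJ : FreshPairs M s F) :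
    FreshPairs M (s.removeStructures α β P) (F.delete (vertsOfPair s α β)) := by
  rintro x ⟨hx, hxR⟩ y ⟨hy, hyR⟩ hadj hfr hne
  obtain ⟨z, hz, γ, h1, h2, h3⟩ := hJ x hx y hy hadj hfr hne
  have hzR : z ∉ vertsOfPair s α β := by rcases hz with rfl | rfl; exacts [hxR, hyR]
  have h4 : γ ≠ α := by rintro rfl; exact hzR (Or.inl h1)
  have h5 : γ ≠ β := by rintro rfl; exact hzR (Or.inr h1)
  exact ⟨z, hz, γ, C.remove_owner_some.2 ⟨h1, h4, h5⟩,
    by rw [C.remove_work_eq h4 h5, C.remove_root hzR, h2], Or.inr (Or.inr h3)⟩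

theorem remove_sizes [Fintype V] (S : Sizes M s F ℓ L) :
    Sizes M (s.removeStructures α β P) (F.delete (vertsOfPair s α β)) ℓ L := by
  constructor
  · intro w hw hwo
    have h1 := C.remove_owner_ne.1 hwo
    refine (Set.ncard_le_ncard ?_).trans (S.below w (fun h => hw ⟨h, h1.2⟩) h1.1)
    rintro x ⟨hx, hd⟩
    have h2 := C.remove_owner_ne.1 hx
    rw [C.remove_nd h2.2] at hd
    exact ⟨h2.1, C.remove_desc h2.1 h2.2 hd⟩
  · intro γ
    refine (Set.ncard_le_ncard ?_).trans (S.verts γ)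
    intro x hx
    exact (C.remove_owner_some.1 hx).1

theorem remove_potential_le [Fintype V] :
    potential M (s.removeStructures α β P) (F.delete (vertsOfPair s α β)) +
      (activeModified (s.removeStructures α β P)).ncard ≤
    potential M s F + (activeModified s).ncard := by
  have h1 : (critical M (s.removeStructures α β P) (F.delete (vertsOfPair s α β))).ncard ≤
      (critical M s F).ncard := by
    refine Set.ncard_le_ncard ?_
    rintro x ⟨hx1, hx2, hx3, hx4⟩
    exact ⟨hx1.1, hx2, hx3, C.onPath_of_remove hx4⟩
  have h2 : (activeModified (s.removeStructures α β P)).ncard ≤ (activeModified s).ncard := by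
    refine Set.ncard_le_ncard ?_
    rintro γ ⟨h3, h4⟩
    obtain ⟨h5, h6, h7⟩ := C.remove_work h4
    refine ⟨(h3.resolve_left h5).resolve_left h6, ?_⟩
    rwa [h7] at h4
  have h3 : ∀ x, lab M (s.removeStructures α β P) x = lab M s x := fun _ => rfl
  unfold potential
  simp only [h3]
  omega

end Core

theorem AugmentStep.eq_remove {u v : V} (h : PhaseState.AugmentStep M α β u v s s') :
    ∃ P : G.Walk α β, s' = s.removeStructures α β ⟨(α, β), P⟩ := by
  obtain ⟨P, _, _, h⟩ := h
  exact ⟨P, h⟩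

/-- The edges of the path are `(u, v)` and arcs of the two structures, so its vertices are among
those now removed. Earlier paths use removed vertices, which have no owner, and hence are disjoint
from it. One path costs two structures of at most `D` vertices each. -/
theorem GoodPaths.augment [Fintype V] {D : ℕ} (Q : GoodPaths M s D) (C : Core M s F ℓ)
    (hD : ∀ γ, (s.vertsOf γ).ncard ≤ D) {u v : V} (hu : s.owner u = some α)
    (hv : s.owner v = some β) (h : PhaseState.AugmentStep M α β u v s s') : GoodPaths M s' D := by
  obtain ⟨P, hP, he, rfl⟩ := h
  have hsup : ∀ x ∈ P.support, x ∈ vertsOfPair s α β := by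
    intro x hx
    cases P with
    | nil => exact absurd rfl hP.2.1
    | cons h' P =>
      obtain ⟨e, he1, he2⟩ : ∃ e ∈ (Walk.cons h' P).edges, x ∈ e := by
        rw [Walk.mem_support_iff_exists_mem_edges_of_not_nil] at hx
        · exact hx
        · simp
      rcases he e he1 with rfl | ⟨a, b, hab, rfl⟩
      · rcases Sym2.mem_iff.1 he2 with rfl | rfl
        exacts [Or.inl hu, Or.inr hv]
      · rcases hab with hab | hab <;> rcases Sym2.mem_iff.1 he2 with rfl | rfl
        exacts [Or.inl hab.2.1, Or.inl hab.2.2, Or.inr hab.2.1, Or.inr hab.2.2]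
  refine ⟨?_, ?_, ?_, ?_⟩
  · intro p hp
    rcases List.mem_cons.1 hp with rfl | hp
    exacts [hP, Q.aug p hp]
  · refine List.pairwise_cons.2 ⟨?_, Q.disjoint⟩
    intro p hp x hx hx'
    exact C.owner_of_mem (hsup x hx) (C.removed_owner x (Q.support p hp x hx'))
  · intro p hp x hx
    rcases List.mem_cons.1 hp with rfl | hp
    exacts [Or.inr (hsup x hx), Or.inl (Q.support p hp x hx)]
  · have h1 := Set.ncard_union_le s.removed (vertsOfPair s α β)
    have h2 := Set.ncard_union_le (s.vertsOf α) (s.vertsOf β)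
    have h3 := hD α
    have h4 := hD β
    have h5 := Q.ncard
    change (s.removed ∪ vertsOfPair s α β).ncard ≤ 2 * (s.paths.length + 1) * D
    have h6 : 2 * (s.paths.length + 1) * D = 2 * s.paths.length * D + 2 * D := by ring
    have h7 : (vertsOfPair s α β).ncard ≤ (s.vertsOf α).ncard + (s.vertsOf β).ncard := h2
    omega

end

/-! ### Alternating paths in the structures -/

section

variable {V : Type*} {G : SimpleGraph V}

/-- There is an alternating path from `x` to `y` with vertices in `S` and edges in `A`, whose
first edge is matched if and only if `c` is true, and whose length is odd if and only if `o` is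
true. -/
def HasAlt (M : G.Subgraph) (A : Set (V × V)) (S : Set V) (c o : Bool) (x y : V) : Prop :=
  ∃ p : G.Walk x y, p.IsPath ∧ Alt M c p ∧ not^[p.length] false = o ∧ (∀ z ∈ p.support, z ∈ S) ∧
    ∀ e ∈ p.edges, ∃ a b, (a, b) ∈ A ∧ e = s(a, b)

variable {M : G.Subgraph} {s s' : PhaseState G} {F : Forest V} {ℓ k : ℕ} {A A' : Set (V × V)}
  {S T : Set V} {c c' o o' : Bool} {x y z w : V}

theorem not_iterate_eq_xor (n : ℕ) (c : Bool) : not^[n] c = xor c (not^[n] false) := by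
  rcases Nat.even_or_odd n with h | h
  · rw [not_iterate_of_even h, not_iterate_of_even h, Bool.xor_false]
  · rw [not_iterate_of_odd h, not_iterate_of_odd h, Bool.not_false, Bool.xor_true]

theorem HasAlt.nil (hx : x ∈ S) : HasAlt M A S c false x x :=
  ⟨Walk.nil, Walk.IsPath.nil, alt_nil, rfl, by simpa using hx, by simp⟩

theorem HasAlt.mono (h : HasAlt M A S c o x y) (hS : S ⊆ T) (hA : A ⊆ A') :
    HasAlt M A' T c o x y := by
  obtain ⟨p, h1, h2, h3, h4, h5⟩ := h
  refine ⟨p, h1, h2, h3, fun z hz => hS (h4 z hz), fun e he => ?_⟩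
  obtain ⟨a, b, hab, rfl⟩ := h5 e he
  exact ⟨a, b, hA hab, rfl⟩

theorem HasAlt.reverse (h : HasAlt M A S c o x y) :
    HasAlt M A S (!(xor c o)) o y x := by
  obtain ⟨p, h1, h2, h3, h4, h5⟩ := h
  refine ⟨p.reverse, h1.reverse, ?_, ?_, ?_, ?_⟩
  · have := h2.reverse
    rwa [Function.iterate_succ_apply', not_iterate_eq_xor, h3] at this
  · rwa [Walk.length_reverse]
  · intro z hz
    rw [Walk.support_reverse, List.mem_reverse] at hz
    exact h4 z hz
  · intro e he
    rw [Walk.edges_reverse, List.mem_reverse] at he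
    exact h5 e he

/-- Two disjoint alternating paths joined by an edge. -/
theorem HasAlt.bridge (h : HasAlt M A S c o x y) (h' : HasAlt M A T c' o' z w)
    (hadj : G.Adj y z) (hA : (y, z) ∈ A ∨ (z, y) ∈ A) (hM : M.Adj y z ↔ xor c o = true)
    (hc : c' = !(xor c o)) (hd : ∀ a ∈ S, a ∉ T) :
    HasAlt M A (S ∪ T) c (!(xor o o')) x w := by
  obtain ⟨p, h1, h2, h3, h4, h5⟩ := h
  obtain ⟨q, g1, g2, g3, g4, g5⟩ := h'
  refine ⟨p.append (Walk.cons hadj q), ?_, ?_, ?_, ?_, ?_⟩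
  · rw [Walk.isPath_def, Walk.support_append, Walk.support_cons, List.tail_cons,
      List.nodup_append]
    refine ⟨h1.support_nodup, g1.support_nodup, ?_⟩
    rintro a ha b hb rfl
    exact hd a (h4 a ha) (g4 a hb)
  · refine h2.append ?_
    rw [not_iterate_eq_xor, h3, alt_cons, ← hc]
    exact ⟨hM, g2⟩
  · rw [Walk.length_append, Walk.length_cons, ← Nat.add_assoc, Function.iterate_succ_apply',
      Nat.add_comm, Function.iterate_add_apply, h3, not_iterate_eq_xor, g3]
  · intro a ha
    rw [Walk.support_append, Walk.support_cons, List.tail_cons, List.mem_append] at ha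
    rcases ha with ha | ha
    exacts [Or.inl (h4 a ha), Or.inr (g4 a ha)]
  · intro e he
    rw [Walk.edges_append, Walk.edges_cons, List.mem_append, List.mem_cons] at he
    rcases he with he | rfl | he
    · exact h5 e he
    · rcases hA with h | h
      · exact ⟨y, z, h, rfl⟩
      · exact ⟨z, y, h, Sym2.eq_swap⟩
    · exact g5 e he

/-- Every vertex of an outer blossom is reached from the base by an even alternating path inside
the blossom. -/
def BlossomPaths (M : G.Subgraph) (s : PhaseState G) (F : Forest V) : Prop :=
  ∀ x ∈ F.out, HasAlt M s.arcs {y | y ∈ F.out ∧ F.base y = F.base x} false false (F.base x) x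

/-- The vertices on the tree path from `z` to the blossom of `x`. -/
def between (M : G.Subgraph) (s : PhaseState G) (F : Forest V) (z x : V) : Set V :=
  {w | s.owner w ≠ none ∧ F.Desc M (F.nd w) z ∧ F.Desc M (F.nd x) (F.nd w)}

namespace Core

variable (C : Core M s F ℓ)
include C

theorem not_adj_of_nd_ne (hx : x ∈ F.out) (hy : y ∈ F.out) (hne : F.nd x ≠ F.nd y) :
    ¬ M.Adj x y := by
  intro h
  obtain ⟨h1, h2⟩ := (adj_iff_mate C.isMatching).1 h
  by_cases hb : F.base x = x
  · exact C.mate_base x hx hb h2 (h1 ▸ hy)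
  · have := C.mate_out x hx hb
    rw [h1] at this
    apply hne
    rw [Forest.nd_of_mem hx, Forest.nd_of_mem hy, this.2.1]

/-- The even alternating path down the tree from a base to an outer vertex. -/
theorem hasAlt_even (B : BlossomPaths M s F) (hz : z ∈ F.out) (hx : x ∈ F.out)
    (h : F.Desc M (F.nd x) z) : HasAlt M s.arcs (between M s F z x) false false z x := by
  induction hn : rk M s F (F.nd x) using Nat.strong_induction_on generalizing x with
  | _ n ih =>
    have hb := C.rep_base hx
    have hbo := C.base_out x hx
    by_cases hzx : F.nd x = z
    · have := B x hx
      rw [← Forest.nd_of_mem hx, hzx] at this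
      refine this.mono ?_ subset_rfl
      rintro y ⟨h1, h2⟩
      have h3 : F.nd y = z := by rw [Forest.nd_of_mem h1, h2]
      refine ⟨C.out_owner y h1, ?_, ?_⟩
      · rw [h3]; exact .refl _
      · rw [h3, hzx]; exact .refl _
    · rw [Forest.nd_of_mem hx] at h hzx hn
      have hm : mate M (F.base x) ≠ F.base x :=
        fun hf => hzx (C.desc_of_free hf hb.1 h).symm
      have hv := C.mate_base _ hbo (C.base_base x hx) hm
      set v := mate M (F.base x) with hvdef
      have hvo : s.owner v ≠ none := by rw [hvdef, C.mate_owner]; exact hb.1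
      have hub : F.up M (F.base x) = v := Forest.up_of_mem hbo
      have h1 := h.up_of_ne hzx
      rw [hub] at h1
      have h2 := h1.up_of_ne (fun h => hv (h ▸ hz))
      obtain ⟨hp1, hp2, hp3, hp4⟩ := C.par_out v hv hvo
      have hupv : F.up M v = F.nd (F.par v) := by
        rw [Forest.up_of_notMem hv, Forest.nd_of_mem hp1]
      rw [hupv] at h2
      have hvr := rep_of_notOut hv hvo
      have hpr := C.rep_nd (C.out_owner _ hp1)
      have hrk1 : rk M s F v < rk M s F (F.base x) := by
        have := C.rk_up hb (by rw [hub]; exact hm)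
        rwa [hub] at this
      have hrk2 : rk M s F (F.nd (F.par v)) < rk M s F v := by
        have := C.rk_up hvr (by rw [hupv]; intro h; exact hv (h ▸ (C.nd_mem_iff _).2 hp1))
        rwa [hupv] at this
      have h3 := ih _ (by omega) hp1 h2 rfl
      -- The path runs from `z` to the parent of `v` by induction, along an unmatched arc to `v`,
      -- along the matched arc to the base of `x`, and inside the blossom to `x`.
      have hmv : mate M v = F.base x := by rw [hvdef, C.mate_mate]
      have h4 : HasAlt M s.arcs ({v} ∪ {y | y ∈ F.out ∧ F.base y = F.base x}) true true v x := by
        refine HasAlt.bridge (S := {v}) (c := true) (o := false) (y := v) (.nil rfl) (B x hx)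
          (C.arcs_adj _ _ (hmv ▸ hp4))
          (Or.inl (hmv ▸ hp4)) ?_ rfl ?_
        · simp only [Bool.xor_false, iff_true]
          exact (adj_iff_mate C.isMatching).2 ⟨hmv, by rw [hmv]; exact hm.symm⟩
        · rintro a rfl ⟨h, _⟩
          exact hv h
      have hdx : ∀ y, y = v ∨ (y ∈ F.out ∧ F.base y = F.base x) →
          s.owner y ≠ none ∧ F.Desc M (F.base x) (F.nd y) ∧ F.Desc M (F.nd y) v ∧
          rk M s F v ≤ rk M s F (F.nd y) := by
        rintro y (rfl | ⟨h5, h6⟩)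
        · rw [Forest.nd_of_notMem hv]
          refine ⟨hvo, ?_, .refl _, le_rfl⟩
          rw [← hub]; exact Forest.desc_up _
        · rw [Forest.nd_of_mem h5, h6]
          refine ⟨C.out_owner y h5, .refl _, ?_, hrk1.le⟩
          rw [← hub]; exact Forest.desc_up _
      refine (HasAlt.bridge h3 h4 (C.arcs_adj _ _ hp3) (Or.inl hp3) ?_ rfl ?_).mono ?_ subset_rfl
      · simp only [Bool.xor_false, Bool.false_eq_true, iff_false]
        intro hadj
        have := ((adj_iff_mate C.isMatching).1 hadj.symm).1
        rw [hmv] at this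
        have h5 : F.nd (F.par v) = F.base x := by
          rw [← this, Forest.nd_of_mem hbo, C.base_base x hx]
        rw [h5] at hrk2
        omega
      -- The two pieces are disjoint by rank: `v` and the blossom of `x` have larger rank than
      -- everything from the parent of `v` upwards.
      · rintro y ⟨_, _, h6⟩ hy
        have h7 := (hdx y hy).2.2.2
        rcases C.desc_rk h6 hpr with h8 | h8
        · rw [h8] at h7; omega
        · omega
      · rintro y (⟨h5, h6, h7⟩ | hy)
        · refine ⟨h5, h6, ?_⟩
          rw [Forest.nd_of_mem hx]
          refine (Forest.desc_up _).trans (?_ : F.Desc M _ _)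
          rw [hub]
          refine (Forest.desc_up _).trans (?_ : F.Desc M _ _)
          rwa [hupv]
        · obtain ⟨h5, h6, h7, _⟩ := hdx y hy
          exact ⟨h5, h7.trans h1, by rwa [Forest.nd_of_mem hx]⟩

/-- The alternating path down the tree from an inner vertex to an outer vertex. -/
theorem hasAlt_odd (B : BlossomPaths M s F) (hy : y ∉ F.out) (hyo : s.owner y ≠ none)
    (hx : x ∈ F.out) (h : F.Desc M (F.nd x) y) :
    HasAlt M s.arcs (between M s F y x) true true y x := by
  obtain ⟨h1, h2⟩ := C.mate_inner y hy hyo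
  have hxr := C.rep_nd (C.out_owner x hx)
  have h3 := C.desc_mate_of_desc h hxr (fun h => hy (h ▸ (C.nd_mem_iff x).2 hx)) hy
  have h4 := (C.par_out y hy hyo).2.2.2
  have h5 : F.Desc M (mate M y) y := by
    have := Forest.desc_up (F := F) (M := M) (mate M y)
    rwa [C.up_mate hy hyo] at this
  refine (HasAlt.bridge (S := {y}) (y := y) (.nil rfl) (C.hasAlt_even B h1 hx h3)
    (C.arcs_adj _ _ h4) (Or.inl h4) ?_ rfl ?_).mono ?_ subset_rfl
  · simp only [Bool.xor_false, iff_true]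
    exact (adj_iff_mate C.isMatching).2 ⟨rfl, C.mate_ne_of_notOut hy hyo⟩
  · rintro a rfl ⟨_, h6, _⟩
    rw [Forest.nd_of_notMem hy] at h6
    have := C.desc_antisymm h6 h5 (rep_of_notOut hy hyo)
    exact C.mate_ne_of_notOut hy hyo this
  · rintro w (rfl | ⟨h6, h7, h8⟩)
    · refine ⟨hyo, ?_, ?_⟩
      · rw [Forest.nd_of_notMem hy]; exact .refl _
      · rwa [Forest.nd_of_notMem hy]
    · exact ⟨h6, h7.trans h5, h8⟩

/-- The even paths from the two roots to `u` and `v` end with matched edges or are trivial, and `(u,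
v)` is unmatched, so joining them alternates. They are disjoint because they have different owners.
-/
theorem exists_augmentStep (B : BlossomPaths M s F) {α β u v : V} (hαβ : α ≠ β) (hu : u ∈ F.out)
    (huo : s.owner u = some α) (hv : v ∈ F.out) (hvo : s.owner v = some β) (hadj : G.Adj u v) :
    ∃ s', PhaseState.AugmentStep M α β u v s s' := by
  have howner : ∀ {a y γ}, s.owner y = some γ → a ∈ between M s F γ y → s.owner a = some γ := by
    rintro a y γ hy ⟨_, _, h⟩
    rw [← C.owner_nd, (C.desc_rep h (C.rep_nd (by simp [hy]))).2, C.owner_nd, hy]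
  have key : ∀ {x γ}, x ∈ F.out → s.owner x = some γ →
      HasAlt M s.arcs (between M s F γ x) false false γ x := by
    intro x γ hx hxo
    refine C.hasAlt_even B (C.rep_root hxo).2.1 hx (C.desc_root (C.rep_nd (by simp [hxo])) ?_)
    rw [C.owner_nd, hxo]
  have h1 := (key hu huo).mono subset_rfl (Set.subset_insert (u, v) s.arcs)
  have h2 := ((key hv hvo).mono subset_rfl (Set.subset_insert (u, v) s.arcs)).reverse
  have h3 := h1.bridge h2 hadj (Or.inl (Or.inl rfl)) (by
      simp only [Bool.xor_false, Bool.false_eq_true, iff_false]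
      refine C.not_adj_of_nd_ne hu hv fun h => hαβ ?_
      have := C.owner_nd u
      rw [h, C.owner_nd, huo, hvo, Option.some_inj] at this
      exact this.symm) rfl (by
      intro a ha hb
      have := (howner huo ha).symm.trans (howner hvo hb)
      exact hαβ (Option.some_inj.1 this))
  obtain ⟨p, g1, g2, _, g4, g5⟩ := h3
  refine ⟨_, p, isAugmentingPath_of_alt g1 g2 hαβ ?_ ?_, ?_, rfl⟩
  · exact isFree_iff_mate.2 (C.owner_free u α huo).1
  · exact isFree_iff_mate.2 (C.owner_free v β hvo).1
  · intro e he
    obtain ⟨a, b, hab, rfl⟩ := g5 e he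
    rcases hab with hab | hab
    · obtain ⟨rfl, rfl⟩ := Prod.mk.inj hab
      exact Or.inl rfl
    · refine Or.inr ⟨a, b, ?_, rfl⟩
      have ho := (C.arcs_owner a b hab).2
      rcases g4 a (p.fst_mem_support_of_mem_edges he) with ha | ha
      · have := howner huo ha
        exact Or.inl ⟨hab, this, (ho.symm.trans this : s.owner b = some _)⟩
      · have := howner hvo ha
        exact Or.inr ⟨hab, this, (ho.symm.trans this : s.owner b = some _)⟩

theorem remove_blossomPaths (B : BlossomPaths M s F) {α β : V} {P : BundledPath G} :
    BlossomPaths M (s.removeStructures α β P) (F.delete (vertsOfPair s α β)) := by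
  rintro x ⟨hx, hxR⟩
  obtain ⟨p, h1, h2, h3, h4, h5⟩ := B x hx
  have h6 : ∀ z ∈ p.support, z ∉ vertsOfPair s α β := by
    intro z hz
    obtain ⟨h7, h8⟩ := h4 z hz
    rwa [C.mem_pair_congr (y := x)]
    rw [← C.base_owner z h7, h8, C.base_owner x hx]
  refine ⟨p, h1, h2, h3, fun z hz => ⟨⟨(h4 z hz).1, h6 z hz⟩, (h4 z hz).2⟩, fun e he => ?_⟩
  obtain ⟨a, b, hab, rfl⟩ := h5 e he
  exact ⟨a, b, ⟨hab, h6 a (p.fst_mem_support_of_mem_edges he),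
    h6 b (p.snd_mem_support_of_mem_edges he)⟩, rfl⟩

end Core

/-- The deleted arc ends in `v`, which is not outer, so no path inside a blossom uses it. -/
theorem Reparented.blossomPaths {α u v t : V} (R : Reparented M s F α u v t k s')
    (O : Overtaking M s F α u v t k) (C : Core M s F ℓ) (B : BlossomPaths M s F) :
    BlossomPaths M s' (F.reparent u v t) := by
  intro x hx
  by_cases hxo : x ∈ F.out
  · obtain ⟨p, h1, h2, h3, h4, h5⟩ := B x hxo
    rw [O.base_reparent C hxo]
    refine ⟨p, h1, h2, h3, fun z hz => ⟨Or.inr (h4 z hz).1, ?_⟩, fun e he => ?_⟩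
    · rw [O.base_reparent C (h4 z hz).1, (h4 z hz).2]
    · obtain ⟨a, b, hab, rfl⟩ := h5 e he
      refine ⟨a, b, (R.arcs a b).2 (Or.inr (Or.inr ⟨hab, ?_⟩)), rfl⟩
      rintro rfl
      exact O.v_notOut (h4 b (p.snd_mem_support_of_mem_edges he)).1
  · obtain rfl : x = t := hx.resolve_right hxo
    have h := O.base_reparent_self C
    rw [h]
    exact .nil ⟨Or.inl rfl, h⟩

/-- For an outer vertex of the cycle the tree path from `b` is even already. An inner one is reached
the other way round the cycle: down the opposite side, across the closing arc, and up again. -/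
theorem Contracting.blossomPaths {α u v b : V} (K : Contracting M s F α u v b) (C : Core M s F ℓ)
    (B : BlossomPaths M s F) :
    BlossomPaths M (s.contract M α u v) (F.contract (s.cycleBlossom α u v) b) := by
  have hA : s.arcs ⊆ (s.contract M α u v).arcs := Set.subset_insert _ _
  intro x hx
  by_cases hB : x ∈ s.cycleBlossom α u v
  · rw [K.base_of_mem C hB]
    have hset : s.cycleBlossom α u v ⊆ {y | y ∈ (F.contract (s.cycleBlossom α u v) b).out ∧
        (F.contract (s.cycleBlossom α u v) b).base y = b} :=
      fun y hy => ⟨Or.inr hy, K.base_of_mem C hy⟩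
    have hsub : ∀ {z y}, z ∈ s.cycleBlossom α u v → y ∈ s.cycleBlossom α u v → F.nd z = z →
        between M s F z y ⊆ s.cycleBlossom α u v := by
      rintro z y hz hy hzn w ⟨h1, h2, h3⟩
      obtain ⟨h4, h5, h6⟩ := (K.mem_iff C).1 hy
      have h7 := ((K.mem_iff C).1 hz).2.2
      rw [hzn] at h7
      refine (K.mem_iff C).2 ⟨?_, h5.imp (·.trans h3) (·.trans h3), h2.trans h7⟩
      rw [← C.owner_nd, (C.desc_rep h3 (C.rep_nd (by simp [h4]))).2, C.owner_nd, h4]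
    have hbb := (K.rep_b C).2
    refine HasAlt.mono ?_ hset subset_rfl
    by_cases hxo : x ∈ F.out
    · exact (C.hasAlt_even B (K.b_out C) hxo ((K.mem_iff C).1 hB).2.2).mono
        (hsub (K.b_mem C) hB hbb) hA
    · obtain ⟨h1, h2, h3⟩ := (K.mem_iff C).1 hB
      rw [Forest.nd_of_notMem hxo] at h2 h3
      have hxv : s.owner x ≠ none := by simp [h1]
      -- `a` is the end of the closing arc below `x`, and `c` is the other end. A vertex common to
      -- the two pieces would be an ancestor of both `a` and `c`, hence above `b`; then `x`, lying
      -- above it, would equal `b`, which is outer.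
      have key : ∀ a c, a ∈ F.out → c ∈ F.out → a ∈ s.cycleBlossom α u v →
          c ∈ s.cycleBlossom α u v → F.Desc M (F.nd a) x → F.Desc M (F.nd c) b → G.Adj c a →
          ((c, a) ∈ (s.contract M α u v).arcs ∨ (a, c) ∈ (s.contract M α u v).arcs) →
          F.nd c ≠ F.nd a →
          (∀ d, F.Desc M (F.nd a) d → F.Desc M (F.nd c) d → F.Desc M b d) →
          HasAlt M (s.contract M α u v).arcs (s.cycleBlossom α u v) false false b x := by
        intro a c ha hc haB hcB hax hcb hadj harc hne hlow
        have g1 := (C.hasAlt_even B (K.b_out C) hc hcb).mono subset_rfl hA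
        have g2 := ((C.hasAlt_odd B hxo hxv ha hax).mono subset_rfl hA).reverse
        refine (g1.bridge g2 hadj harc ?_ rfl ?_).mono ?_ subset_rfl
        · simp only [Bool.xor_false, Bool.false_eq_true, iff_false]
          exact C.not_adj_of_nd_ne hc ha hne
        · rintro w ⟨_, h4, h5⟩ ⟨_, h6, h7⟩
          have h8 := (hlow _ h7 h5).trans h6
          have := C.desc_antisymm h8 h3 (K.rep_b C)
          exact hxo (this ▸ K.b_out C)
        · exact Set.union_subset (hsub (K.b_mem C) hcB hbb)
            (hsub hB haB (Forest.nd_of_notMem hxo))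
      have huv : (u, v) ∈ (s.contract M α u v).arcs := Or.inl rfl
      rcases h2 with h2 | h2
      · exact key u v K.u_out K.v_out (K.u_mem C) (K.v_mem C) h2 K.desc_v K.adj.symm (Or.inr huv)
          K.ne.symm K.lowest
      · exact key v u K.v_out K.u_out (K.v_mem C) (K.u_mem C) h2 K.desc_u K.adj (Or.inl huv)
          K.ne (fun d h h' => K.lowest d h' h)
  · have hxo := hx.resolve_right hB
    rw [K.base_of_notMem C hB]
    refine (B x hxo).mono ?_ hA
    rintro y ⟨h1, h2⟩
    refine ⟨Or.inl h1, ?_⟩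
    rw [K.base_of_notMem C, h2]
    intro hy
    refine hB (K.mem_of_nd C ?_ hy)
    rw [Forest.nd_of_mem hxo, Forest.nd_of_mem h1, h2]

end

/-! ### The steps of a pass-bundle -/

section

variable {V : Type*} [Fintype V] {G : SimpleGraph V}

/-- The invariants of a phase. -/
structure Good (M : G.Subgraph) (s : PhaseState G) (F : Forest V) (ℓ L : ℕ) : Prop where
  core : Core M s F ℓ
  explored : Explored M s F
  sizes : Sizes M s F ℓ L
  blossom : BlossomPaths M s F
  paths : GoodPaths M s ((ℓ + 1) * L)

/-- The state `s'` can be reached from `s` by extensions, contractions and augmentations. -/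
structure Progress (M : G.Subgraph) (ℓ L : ℕ) (s : PhaseState G) (F : Forest V)
    (s' : PhaseState G) (F' : Forest V) : Prop where
  good : Good M s' F' ℓ L
  fresh : FreshPairs M s' F'
  evolves : Evolves M s F s' F'
  potential_le : potential M s' F' + (activeModified s').ncard ≤
    potential M s F + (activeModified s).ncard

/-- Structures that are neither modified nor on hold have at most `L` vertices. -/
def SmallActive (s : PhaseState G) (L : ℕ) : Prop :=
  ∀ α ∉ s.onHold, α ∉ s.modified → (s.vertsOf α).ncard ≤ L

/-- The arc `(x, y)` cannot be used to extend the active path of an unmodified structure. -/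
def Scanned (M : G.Subgraph) (s : PhaseState G) (F : Forest V) (x y : V) : Prop :=
  ∀ α, x ∈ F.out → s.owner x = some α → α ∉ s.modified → α ∉ s.onHold →
    s.work α = some (s.root x) → y ∉ F.out → y ∉ s.removed → mate M x ≠ y →
    lab M s y ≤ dist M s (F.base x) + 1

variable {M : G.Subgraph} {s s' s'' : PhaseState G} {F F' F'' : Forest V} {ℓ L : ℕ}

theorem Evolves.refl (s : PhaseState G) (F : Forest V) : Evolves M s F s F where
  label_le _ _ := le_rfl
  removed_mono := subset_rfl
  out_mono _ h := Or.inl h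
  onHold := rfl
  modified_mono := subset_rfl
  work_none _ h := h
  work _ _ := rfl
  owner _ _ _ := Iff.rfl
  out_iff _ _ _ _ := Iff.rfl
  root _ _ _ _ := rfl
  dist _ _ _ _ _ := rfl

theorem Evolves.trans (E : Evolves M s F s' F') (E' : Evolves M s' F' s'' F'') :
    Evolves M s F s'' F'' where
  label_le x y := (E'.label_le x y).trans (E.label_le x y)
  removed_mono := E.removed_mono.trans E'.removed_mono
  out_mono x h := (E.out_mono x h).elim (E'.out_mono x) fun h => Or.inr (E'.removed_mono h)
  onHold := E'.onHold.trans E.onHold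
  modified_mono := E.modified_mono.trans E'.modified_mono
  work_none α h := E'.work_none α (E.work_none α h)
  work α h := (E'.work α h).trans (E.work α fun h' => h (E'.modified_mono h'))
  owner α h x := (E'.owner α h x).trans (E.owner α (fun h' => h (E'.modified_mono h')) x)
  out_iff α h x hx := (E'.out_iff α h x hx).trans
    (E.out_iff α (fun h' => h (E'.modified_mono h')) x ((E'.owner α h x).1 hx))
  root α h x hx := (E'.root α h x hx).trans
    (E.root α (fun h' => h (E'.modified_mono h')) x ((E'.owner α h x).1 hx))
  dist α h x hx ho := by
    have h1 : α ∉ s'.modified := fun h' => h (E'.modified_mono h')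
    have h2 := (E'.owner α h x).1 ho
    rw [E'.dist α h x ((E.out_iff α h1 x h2).2 hx) ho, E.dist α h1 x hx h2]

theorem Progress.refl (H : Good M s F ℓ L) (J : FreshPairs M s F) : Progress M ℓ L s F s F :=
  ⟨H, J, .refl s F, le_rfl⟩

theorem Progress.trans (h : Progress M ℓ L s F s' F') (h' : Progress M ℓ L s' F' s'' F'') :
    Progress M ℓ L s F s'' F'' :=
  ⟨h'.good, h'.fresh, h.evolves.trans h'.evolves, h'.potential_le.trans h.potential_le⟩

theorem SmallActive.evolves (h : SmallActive s L) (E : Evolves M s F s' F') :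
    SmallActive s' L := by
  intro α h1 h2
  rw [E.onHold] at h1
  have : s'.vertsOf α = s.vertsOf α := Set.ext fun x => E.owner α h2 x
  rw [this]
  exact h α h1 fun h3 => h2 (E.modified_mono h3)

/-- In a structure that is still unmodified, working vertex and distances are the same while labels
may only have dropped. An outer vertex never becomes inner without being removed. -/
theorem Scanned.evolves {x y : V} (h : Scanned M s F x y) (E : Evolves M s F s' F') :
    Scanned M s' F' x y := by
  intro α hx ho hm hh hw hy hyr hmate
  have h1 := (E.owner α hm x).1 ho
  have h2 := (E.out_iff α hm x ho).1 hx
  rw [E.dist α hm x h2 ho]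
  refine (E.lab_le y).trans (h α h2 h1 (fun h3 => hm (E.modified_mono h3)) (E.onHold ▸ hh) ?_
    (fun h3 => (E.out_mono y h3).elim hy hyr) (fun h3 => hyr (E.removed_mono h3)) hmate)
  rw [← E.work α hm, hw, E.root α hm x ho]

theorem GoodPaths.congr {D : ℕ} (Q : GoodPaths M s D) (hp : s'.paths = s.paths)
    (hr : s'.removed = s.removed) : GoodPaths M s' D :=
  ⟨hp ▸ Q.aug, hp ▸ Q.disjoint, by rw [hp, hr]; exact Q.support, by rw [hp, hr]; exact Q.ncard⟩

theorem Core.owner_eq_some_of_ne_none (C : Core M s F ℓ) {x : V} (hx : x ∈ F.out) :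
    ∃ α, s.owner x = some α := Option.ne_none_iff_exists'.1 (C.out_owner x hx)

theorem Core.mate_ne_of_notRemoved (C : Core M s F ℓ) {v : V} (hv : v ∉ F.out)
    (hr : v ∉ s.removed) : mate M v ≠ v := fun h =>
  hv (C.free_out v h (by rw [C.free_owner v h hr]; simp))

namespace Good

variable (H : Good M s F ℓ L)
include H

theorem contract (J : FreshPairs M s F) {α u v : V} (hu : u ∈ F.out) (huo : s.owner u = some α)
    (hw : s.work α = some (s.root u)) (hv : v ∈ F.out) (hvo : s.owner v = some α)
    (hadj : G.Adj u v) (hne : s.root u ≠ s.root v) :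
    ∃ F', Progress M ℓ L s F (s.contract M α u v) F' ∧
      potential M (s.contract M α u v) F' + (activeModified (s.contract M α u v)).ncard <
        potential M s F + (activeModified s).ncard := by
  have C := H.core
  obtain ⟨b, K⟩ := C.exists_contracting hu huo hw hv hvo hadj fun h => hne (C.root_eq_iff.2 h)
  have h1 := K.potential_le C
  exact ⟨_, ⟨⟨K.core C, K.explored C H.explored, K.sizes C H.sizes, K.blossomPaths C H.blossom,
    H.paths.congr rfl rfl⟩, K.freshPairs C J, K.evolves C, by omega⟩, by omega⟩

theorem augment (J : FreshPairs M s F) {α β u v : V} (huo : s.owner u = some α)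
    (hvo : s.owner v = some β) (h : PhaseState.AugmentStep M α β u v s s') :
    Progress M ℓ L s F s' (F.delete (vertsOfPair s α β)) := by
  have C := H.core
  have hQ := H.paths.augment C H.sizes.verts huo hvo h
  obtain ⟨P, rfl⟩ := AugmentStep.eq_remove h
  exact ⟨⟨C.remove, C.remove_explored H.explored, C.remove_sizes H.sizes,
    C.remove_blossomPaths H.blossom, hQ⟩, C.remove_freshPairs J, C.remove_evolves,
    C.remove_potential_le⟩

theorem overtake (hL : 2 ≤ L) (hS : SmallActive s L) (J : FreshPairs M s F) {α u v t : V} {k : ℕ}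
    (O : Overtaking M s F α u v t k) (hm : α ∉ s.modified) (hh : α ∉ s.onHold)
    (h : PhaseState.OvertakeStep α u v t k s s') :
    Progress M ℓ L s F s' (F.reparent u v t) := by
  have C := H.core
  have R := OvertakeStep.reparented C O h
  exact ⟨⟨R.core O C, R.explored O C H.explored, R.sizes O C H.sizes hL (hS α hh hm),
    R.blossomPaths O C H.blossom, H.paths.congr R.paths R.removed⟩, R.freshPairs O C J hm,
    R.evolves O C, R.potential_le O C⟩

theorem not_ignored {u v : V} (h : ¬ s.Ignored M u v) : ∃ α, u ∈ F.out ∧ s.owner u = some α ∧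
    s.work α = some (s.root u) ∧ v ∉ s.removed ∧ s.root u ≠ s.root v ∧ ¬ M.Adj u v ∧
    α ∉ s.modified ∧ α ∉ s.onHold := by
  unfold PhaseState.Ignored at h
  push Not at h
  obtain ⟨_, h2, h3, ⟨α, h4⟩, h5, h6⟩ := h
  obtain ⟨h7, h8, h9⟩ := H.core.isWorkingAt_iff.1 h4
  exact ⟨α, h7, h8, h9, h2, h3, h5, h6 α h8⟩

/-- Once an operation was executed, the structure of the tail is modified and `Scanned` holds
vacuously. In the remaining cases the arc was ignored for a reason that `Scanned` excludes, or the
label was already small. -/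
theorem extendStep (hL : 2 ≤ L) (hS : SmallActive s L) (J : FreshPairs M s F) {g : V × V}
    (hg : G.Adj g.1 g.2) (h : PhaseState.ExtendStep M g s s') :
    ∃ F', Progress M ℓ L s F s' F' ∧ Scanned M s' F' g.1 g.2 := by
  have C := H.core
  have key : ∀ α F', s.owner g.1 = some α → Progress M ℓ L s F s' F' → α ∈ s'.modified →
      ∃ F', Progress M ℓ L s F s' F' ∧ Scanned M s' F' g.1 g.2 := by
    intro α F' h1 h2 h3
    refine ⟨F', h2, fun γ _ ho hm => ?_⟩
    have h4 := (h2.evolves.owner γ hm _).1 ho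
    rw [h1, Option.some_inj] at h4
    exact absurd h3 (h4 ▸ hm)
  cases h with
  | ignore hi =>
    refine ⟨F, .refl H J, fun γ hx ho hm hh hw hy hyr hmate => ?_⟩
    rcases hi with h | h | h | h | h | ⟨α, h, h'⟩
    · rw [C.removed_owner _ h] at ho; exact absurd ho (by simp)
    · exact absurd h hyr
    · exact absurd ((C.mem_out_of_nd_eq (C.root_eq_iff.1 h)).1 hx) hy
    · exact absurd (C.isWorkingAt_iff.2 ⟨hx, ho, hw⟩) (h γ)
    · exact absurd ((adj_iff_mate C.isMatching).1 h).1 hmate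
    · rw [h, Option.some_inj] at ho
      subst ho
      exact absurd h' (by simp [hm, hh])
  | @contract α hi hw hout =>
    obtain ⟨h1, h2, h3⟩ := C.isWorkingAt_iff.1 hw
    obtain ⟨h4, h5⟩ := C.isOuter_iff.1 hout
    obtain ⟨_, _, _, _, _, h6, _⟩ := H.not_ignored hi
    obtain ⟨F', h7, _⟩ := H.contract J h1 h2 h3 h4 h5 hg h6
    exact key α F' h2 h7 (Or.inl rfl)
  | @augment α β _ hi hw hout hne hA =>
    obtain ⟨h1, h2, h3⟩ := C.isWorkingAt_iff.1 hw
    obtain ⟨h4, h5⟩ := C.isOuter_iff.1 hout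
    refine key α _ h2 (H.augment J h2 h5 hA) ?_
    obtain ⟨P, rfl⟩ := AugmentStep.eq_remove hA
    exact Or.inl rfl
  | @overtake α t d _ hi hw hout hadj hd hlt hO =>
    obtain ⟨h1, h2, h3⟩ := C.isWorkingAt_iff.1 hw
    obtain ⟨γ, _, h5, _, h6, _, _, h7, h8⟩ := H.not_ignored hi
    rw [h2, Option.some_inj] at h5
    subst h5
    obtain ⟨h9, h10⟩ := (adj_iff_mate C.isMatching).1 hadj
    have hv : g.2 ∉ F.out := by
      intro h
      obtain ⟨β, hβ⟩ := C.owner_eq_some_of_ne_none h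
      exact hout β (C.isOuter_iff.2 ⟨h, hβ⟩)
    have O : Overtaking M s F α g.1 g.2 t (d + 1) :=
      ⟨h1, h2, h3, hv, h6, hg, h9, hadj.ne, by rw [(C.distance_iff h1).1 hd],
        by rw [lab, h9]; exact hlt⟩
    exact key α _ h2 (H.overtake hL hS J O h7 h8 hO)
      (((OvertakeStep.reparented C O hO).modified α).2 (Or.inr (Or.inl rfl)))
  | @noReduction t d hi hout hadj hd hlt =>
    obtain ⟨γ, h1, h5, _, h6, _, _, h7, h8⟩ := H.not_ignored hi
    refine ⟨F, .refl H J, fun _ _ _ _ _ _ _ _ _ => ?_⟩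
    rw [← (C.distance_iff h1).1 hd, lab, ((adj_iff_mate C.isMatching).1 hadj).1]
    omega

theorem exists_extendStep {g : V × V} (hg : G.Adj g.1 g.2) :
    ∃ s', PhaseState.ExtendStep M g s s' := by
  have C := H.core
  by_cases hi : s.Ignored M g.1 g.2
  · exact ⟨s, .ignore hi⟩
  obtain ⟨α, h1, h2, h3, h4, h5, h6, h7, h8⟩ := H.not_ignored hi
  have hw := C.isWorkingAt_iff.2 ⟨h1, h2, h3⟩
  by_cases hv : g.2 ∈ F.out
  · obtain ⟨β, hβ⟩ := C.owner_eq_some_of_ne_none hv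
    have hout := C.isOuter_iff.2 ⟨hv, hβ⟩
    by_cases hβα : β = α
    · subst hβα
      exact ⟨_, .contract hi hw hout⟩
    · obtain ⟨s', h⟩ := C.exists_augmentStep H.blossom (Ne.symm hβα) h1 h2 hv hβ hg
      exact ⟨s', .augment hi hw hout hβα h⟩
  · have hout : ∀ β, ¬ s.IsOuter β (s.root g.2) := fun β h => hv (C.isOuter_iff.1 h).1
    have hadj : M.Adj g.2 (mate M g.2) :=
      (adj_iff_mate C.isMatching).2 ⟨rfl, C.mate_ne_of_notRemoved hv h4⟩
    have hd := (C.distance_iff (M := M) h1).2 rfl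
    by_cases hlt : dist M s (F.base g.1) + 1 < s.label g.2 (mate M g.2)
    · rcases ho : s.owner g.2 with _ | β
      · exact ⟨_, .overtake hi hw hout hadj hd hlt (.unvisited ho)⟩
      · obtain ⟨p1, p2, p3, _⟩ := C.par_out g.2 hv (by simp [ho])
        have hp : (F.par g.2, g.2) ∈ s.arcsOf β := ⟨p3, p2.trans ho, ho⟩
        have hr : s.root (F.par g.2) ≠ s.root g.2 := fun h =>
          hv ((C.mem_out_of_nd_eq (C.root_eq_iff.1 h)).1 p1)
        by_cases hβα : β = α
        · subst hβα
          exact ⟨_, .overtake hi hw hout hadj hd hlt (.same ho hp hr)⟩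
        · exact ⟨_, .overtake hi hw hout hadj hd hlt (.other ho hβα hp hr)⟩
    · exact ⟨s, .noReduction hi hout hadj hd hlt⟩

theorem contractOnce (J : FreshPairs M s F) (h : PhaseState.ContractOnce M s s') :
    ∃ F', Progress M ℓ L s F s' F' ∧ potential M s' F' + (activeModified s').ncard <
      potential M s F + (activeModified s).ncard := by
  have C := H.core
  obtain ⟨hadj, hw, hv, hne, hout⟩ := h
  obtain ⟨h1, h2, h3⟩ := C.isWorkingAt_iff.1 hw
  obtain ⟨h4, h5⟩ := C.isOuter_iff.1 hout
  exact H.contract J h1 h2 h3 h4 h5 hadj hne.symm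

theorem contractAll (J : FreshPairs M s F)
    (h : Relation.ReflTransGen (PhaseState.ContractOnce M) s s') :
    ∃ F', Progress M ℓ L s F s' F' := by
  induction h with
  | refl => exact ⟨F, .refl H J⟩
  | tail _ h ih =>
    obtain ⟨F', h1⟩ := ih
    obtain ⟨F'', h2, _⟩ := h1.good.contractOnce h1.fresh h
    exact ⟨F'', h1.trans h2⟩

/-- Termination: each contraction strictly lowers the potential plus the number of active modified
structures. -/
theorem exists_contractAll (J : FreshPairs M s F) : ∃ s', PhaseState.ContractAll M s s' := by
  induction hn : potential M s F + (activeModified s).ncard using Nat.strong_induction_on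
    generalizing s F with
  | _ n ih =>
    by_cases h : ∃ s'', PhaseState.ContractOnce M s s''
    · obtain ⟨s₁, h⟩ := h
      obtain ⟨F₁, h1, h2⟩ := H.contractOnce J h
      obtain ⟨s', h3, h4⟩ := ih _ (hn ▸ h2) h1.good h1.fresh rfl
      exact ⟨s', .head h h3, h4⟩
    · exact ⟨s, .refl, fun s'' h' => h ⟨s'', h'⟩⟩

/-- Contracting is over: no edge joins different outer blossoms of the same structure. -/
theorem base_eq_of_contractAll (J : FreshPairs M s F) (h : ∀ s', ¬ PhaseState.ContractOnce M s s') :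
    ∀ x ∈ F.out, ∀ y ∈ F.out, G.Adj x y → s.owner x = s.owner y → F.base x = F.base y := by
  have C := H.core
  intro x hx y hy hadj ho
  by_contra hne
  have key : ∀ z w γ, z ∈ F.out → w ∈ F.out → G.Adj z w → s.owner z = s.owner w →
      F.base z ≠ F.base w → s.owner z = some γ → s.work γ = some (s.root z) → False := by
    intro z w γ hz hw hadj ho hne hγ hwk
    refine h _ (.mk (α := γ) hadj (C.isWorkingAt_iff.2 ⟨hz, hγ, hwk⟩) (ho.symm.trans hγ) ?_
      (C.isOuter_iff.2 ⟨hw, ho.symm.trans hγ⟩))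
    intro h'
    have := C.root_eq_iff.1 h'
    rw [Forest.nd_of_mem hz, Forest.nd_of_mem hw] at this
    exact hne this.symm
  -- Two adjacent vertices of one structure cannot both be free, so the exception in `FreshPairs`
  -- does not apply and the working vertex at one end could be contracted.
  have hfr : mate M x ≠ x ∨ mate M y ≠ y := by
    by_contra hf
    push Not at hf
    obtain ⟨γ, hγ⟩ := C.owner_eq_some_of_ne_none hx
    have h1 := C.owner_eq x γ hγ hf.1
    have h2 := C.owner_eq y γ (ho ▸ hγ) hf.2
    exact hadj.ne (h1.trans h2.symm)
  obtain ⟨z, rfl | rfl, γ, h1, h2, _⟩ := J x hx y hy hadj hfr hne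
  · exact key _ y γ hx hy hadj ho hne h1 h2
  · exact key _ x γ hy hx hadj.symm ho.symm (Ne.symm hne) h1 h2

/-- Bases stay fixed and outer vertices only disappear, so what was checked for one arc remains true
during the rest of the pass. -/
theorem checkStep (J : FreshPairs M s F) {g : V × V} (h : PhaseState.CheckStep M g s s') :
    ∃ F', Progress M ℓ L s F s' F' ∧ F'.base = F.base ∧
      (∀ x ∈ F'.out, x ∈ F.out ∧ s'.owner x = s.owner x) ∧
      (g.1 ∈ F'.out → g.2 ∈ F'.out → s'.owner g.1 = s'.owner g.2) := by
  have C := H.core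
  cases h with
  | ignore hi =>
    refine ⟨F, .refl H J, rfl, fun x hx => ⟨hx, rfl⟩, fun h1 h2 => ?_⟩
    by_contra hne
    obtain ⟨α, hα⟩ := C.owner_eq_some_of_ne_none h1
    obtain ⟨β, hβ⟩ := C.owner_eq_some_of_ne_none h2
    exact hi α β ⟨fun h => hne (by rw [hα, hβ, h]), C.isOuter_iff.2 ⟨h1, hα⟩,
      C.isOuter_iff.2 ⟨h2, hβ⟩⟩
  | @augment α β _ hp hA =>
    have h1 := (C.isOuter_iff.1 hp.2.1).2
    have h2 := (C.isOuter_iff.1 hp.2.2).2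
    refine ⟨_, H.augment J h1 h2 hA, rfl, ?_, fun h => absurd (Or.inl h1) h.2⟩
    obtain ⟨P, rfl⟩ := AugmentStep.eq_remove hA
    rintro x ⟨hx, hxR⟩
    exact ⟨hx, C.remove_owner hxR⟩

theorem exists_checkStep {g : V × V} (hg : G.Adj g.1 g.2) :
    ∃ s', PhaseState.CheckStep M g s s' := by
  have C := H.core
  by_cases hi : ∃ α β, s.OuterPair α β g.1 g.2
  · obtain ⟨α, β, h⟩ := hi
    obtain ⟨h1, h2⟩ := C.isOuter_iff.1 h.2.1
    obtain ⟨h3, h4⟩ := C.isOuter_iff.1 h.2.2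
    obtain ⟨s', hs⟩ := C.exists_augmentStep H.blossom h.1 h1 h2 h3 h4 hg
    exact ⟨s', .augment h hs⟩
  · exact ⟨s, .ignore fun α β h => hi ⟨α, β, h⟩⟩

end Good

/-- Along a scan, the invariant `I D` with the set `D` of scanned items is maintained. -/
theorem Scan.invariant {σ ι : Type*} {R : ι → σ → σ → Prop} {I : Set ι → σ → Prop}
    {A : Set ι} (hstep : ∀ a ∈ A, ∀ D s s', I D s → R a s s' → I (insert a D) s') {l : List ι}
    {D : Set ι} {s s' : σ} (hl : ∀ a ∈ l, a ∈ A) (h : Scan R l s s') (hI : I D s) :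
    I (D ∪ {a | a ∈ l}) s' := by
  induction h generalizing D with
  | nil s => simpa using hI
  | @cons a l s s' s'' h _ ih =>
    have := ih (fun b hb => hl b (List.mem_cons_of_mem a hb))
      (hstep a (hl a List.mem_cons_self) D s s' hI h)
    convert this using 1
    ext b
    simp only [Set.mem_union, Set.mem_ofPred_eq, List.mem_cons, Set.mem_insert_iff]
    tauto

/-- A scan exists if an invariant guarantees the existence of its steps. -/
theorem Scan.exists {σ ι : Type*} {R : ι → σ → σ → Prop} {I : σ → Prop} {A : Set ι}
    (hstep : ∀ a ∈ A, ∀ s, I s → ∃ s', R a s s')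
    (hI : ∀ a ∈ A, ∀ s s', I s → R a s s' → I s') {l : List ι} {s : σ}
    (hl : ∀ a ∈ l, a ∈ A) (h : I s) : ∃ s', Scan R l s s' := by
  induction l generalizing s with
  | nil => exact ⟨s, .nil s⟩
  | cons a l ih =>
    have ha := hl a List.mem_cons_self
    obtain ⟨s₁, h1⟩ := hstep a ha s h
    obtain ⟨s', h2⟩ := ih (fun b hb => hl b (List.mem_cons_of_mem a hb)) (hI a ha s s₁ h h1)
    exact ⟨s', .cons h1 h2⟩

end

/-! ### Backtracking and pass-bundles -/

section

variable {V : Type*} [Fintype V] {G : SimpleGraph V}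
variable {M : G.Subgraph} {s s' : PhaseState G} {F F' : Forest V} {ℓ L : ℕ}

/-- The structures with a working vertex that are not marked as on hold. -/
def activeFree (s : PhaseState G) : Set V := {α | s.work α ≠ none ∧ α ∉ s.onHold}

/-- No edge joins different outer blossoms. -/
def Settled (G : SimpleGraph V) (F : Forest V) : Prop :=
  ∀ x ∈ F.out, ∀ y ∈ F.out, G.Adj x y → F.base x = F.base y

/-- Only edges between free vertices join different outer blossoms. -/
def AlmostSettled (M : G.Subgraph) (F : Forest V) : Prop :=
  ∀ x ∈ F.out, ∀ y ∈ F.out, G.Adj x y → (mate M x ≠ x ∨ mate M y ≠ y) → F.base x = F.base y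

theorem Core.congr (C : Core M s F ℓ) (w : V → Option (Set V)) (A B : Set V)
    (hw : ∀ α W, w α = some W → ∃ x ∈ F.out, s.owner x = some α ∧ W = s.root x) :
    Core M { s with work := w, onHold := A, modified := B } F ℓ :=
  { C with work_eq := hw }

theorem Good.congr (H : Good M s F ℓ L) (w : V → Option (Set V)) (A B : Set V)
    (hw : ∀ α W, w α = some W → ∃ x ∈ F.out, s.owner x = some α ∧ W = s.root x)
    (hE : Explored M { s with work := w, onHold := A, modified := B } F) :
    Good M { s with work := w, onHold := A, modified := B } F ℓ L :=
  ⟨H.core.congr w A B hw, hE, ⟨H.sizes.below, H.sizes.verts⟩, H.blossom, H.paths.congr rfl rfl⟩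

theorem Good.mark (H : Good M s F ℓ L) (h : ℝ) : Good M (s.mark h) F ℓ L :=
  H.congr s.work _ _ H.core.work_eq H.explored

namespace Core

variable (C : Core M s F ℓ)
include C

/-- In the third case `y` is the base of the working vertex: its parent in the tree is its mate, and
the grandparent is the blossom of the tail of the arc entering that mate. -/
theorem backtrackTo_cases {α : V} {W' : Option (Set V)} (h : s.BacktrackTo α W') :
    (W' = s.work α ∧ (α ∈ s.onHold ∨ α ∈ s.modified ∨ s.work α = none)) ∨
    (α ∉ s.onHold ∧ α ∉ s.modified ∧ s.work α = some (s.root α) ∧ W' = none) ∨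
    (α ∉ s.onHold ∧ α ∉ s.modified ∧ ∃ y ∈ F.out, s.owner y = some α ∧ F.base y = y ∧
      mate M y ≠ y ∧ s.work α = some (s.root y) ∧ W' = some (s.root (F.par (mate M y)))) := by
  cases h with
  | keep h => exact Or.inl ⟨rfl, h⟩
  | toEmpty h1 h2 h3 => exact Or.inr (Or.inl ⟨h1, h2, h3, rfl⟩)
  | @toGrandparent B D W h1 h2 h3 h4 h5 h6 =>
    obtain ⟨x, hx, hxo, rfl⟩ := C.work_eq α W h3
    have hr : s.root (F.base x) = s.root x := by rw [← Forest.nd_of_mem hx, C.root_nd]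
    have hyo : s.owner (F.base x) = some α := (C.base_owner x hx).trans hxo
    have hm : mate M (F.base x) ≠ F.base x := by
      intro h
      rw [← hr, C.owner_eq _ α hyo h] at h4
      exact h4 rfl
    have hv := C.mate_base _ (C.base_out x hx) (C.base_base x hx) hm
    refine Or.inr (Or.inr ⟨h1, h2, F.base x, C.base_out x hx, hyo, C.base_base x hx, hm,
      by rw [h3, hr], ?_⟩)
    obtain ⟨c, w, _, _, rfl, e2, _, e4⟩ := C.treeArc_iff.1 h6
    obtain ⟨b, c', _, _, rfl, e6, _, e8⟩ := C.treeArc_iff.1 h5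
    rw [← C.root_eq_iff.1 e2, Forest.nd_of_mem hx, Forest.up_of_mem (C.base_out x hx)] at e4
    rw [← C.root_eq_iff.1 e6, ← e4, Forest.up_of_notMem hv] at e8
    rw [Option.some_inj, C.root_eq_iff, ← e8,
      Forest.nd_of_mem (C.par_out _ hv (by rw [C.mate_owner, hyo]; simp)).1]

theorem exists_backtrackTo (α : V) : ∃ W, s.BacktrackTo α W := by
  by_cases h : α ∈ s.onHold ∨ α ∈ s.modified ∨ s.work α = none
  · exact ⟨_, .keep h⟩
  push Not at h
  obtain ⟨h1, h2, h3⟩ := h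
  obtain ⟨W, hW⟩ := Option.ne_none_iff_exists'.1 h3
  by_cases hr : W = s.root α
  · exact ⟨_, .toEmpty h1 h2 (hr ▸ hW)⟩
  · obtain ⟨x, hx, hxo, rfl⟩ := C.work_eq α W hW
    have hyo : s.owner (F.base x) = some α := (C.base_owner x hx).trans hxo
    have hr' : s.root (F.base x) = s.root x := by rw [← Forest.nd_of_mem hx, C.root_nd]
    have hm : mate M (F.base x) ≠ F.base x := by
      intro h
      rw [← hr', C.owner_eq _ α hyo h] at hr
      exact hr rfl
    have hv := C.mate_base _ (C.base_out x hx) (C.base_base x hx) hm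
    have hvo : s.owner (mate M (F.base x)) = some α := by rw [C.mate_owner, hyo]
    obtain ⟨p1, p2, _, _⟩ := C.par_out _ hv (by simp [hvo])
    refine ⟨_, .toGrandparent (B := s.root (F.par (mate M (F.base x))))
      (C := s.root (mate M (F.base x))) h1 h2 hW hr (C.treeArc_iff.2 ?_) (C.treeArc_iff.2 ?_)⟩
    · refine ⟨_, _, p2.trans hvo, hvo, rfl, rfl, ?_, ?_⟩
      · rw [Forest.nd_of_notMem hv, Forest.nd_of_mem p1]
        exact fun h => hv (h ▸ C.base_out _ p1)
      · rw [Forest.nd_of_notMem hv, Forest.nd_of_mem p1, Forest.up_of_notMem hv]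
    · refine ⟨_, x, hvo, hxo, rfl, rfl, ?_, ?_⟩
      · rw [Forest.nd_of_notMem hv, Forest.nd_of_mem hx]
        exact hm.symm
      · rw [Forest.nd_of_notMem hv, Forest.nd_of_mem hx, Forest.up_of_mem (C.base_out x hx)]

theorem exists_backtrack : ∃ s', s.Backtrack s' := by
  choose w hw using C.exists_backtrackTo
  exact ⟨_, w, hw, rfl⟩

/-- The base of the grandparent of the blossom with base `y`. -/
theorem up_up {y : V} (hy : y ∈ F.out) (hb : F.base y = y) (hm : mate M y ≠ y) :
    mate M y ∉ F.out ∧ F.par (mate M y) ∈ F.out ∧ s.owner (F.par (mate M y)) = s.owner y ∧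
      F.up M y = mate M y ∧ F.up M (mate M y) = F.base (F.par (mate M y)) := by
  have hv := C.mate_base y hy hb hm
  obtain ⟨p1, p2, _, _⟩ := C.par_out _ hv (by rw [C.mate_owner]; exact C.out_owner y hy)
  exact ⟨hv, p1, p2.trans (C.mate_owner y), Forest.up_of_mem hy, Forest.up_of_notMem hv⟩

theorem onPath_of_backtrack {w : V → Option (Set V)} (hw : ∀ α, s.BacktrackTo α (w α)) {b : V}
    (h : OnPath M { s with work := w } F b) : OnPath M s F b := by
  obtain ⟨α, z, h1, h2, h3, h4⟩ := h
  change w α = some (s.root z) at h3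
  rcases C.backtrackTo_cases (hw α) with ⟨h, _⟩ | ⟨_, _, _, h⟩ | ⟨_, _, y, e1, e2, e3, e4, e5, h⟩
  · exact ⟨α, z, h1, h2, h.symm.trans h3, h4⟩
  · rw [h] at h3; exact absurd h3 (by simp)
  · obtain ⟨_, p1, _, p3, p4⟩ := C.up_up e1 e3 e4
    rw [h, Option.some_inj, C.root_eq_iff, Forest.nd_of_mem p1] at h3
    refine ⟨α, y, h1, e2, e5, ?_⟩
    rw [Forest.nd_of_mem e1, e3]
    refine (Forest.desc_up y).trans ?_
    rw [p3]
    refine (Forest.desc_up _).trans ?_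
    rw [p4, h3]
    exact h4

/-- The only blossom to leave an active path is the former working vertex of a structure that is
neither on hold nor modified, and all its arcs were scanned without effect. -/
theorem backtrack_explored (hE : Explored M s F) (hS : ∀ x y, G.Adj x y → Scanned M s F x y)
    {w : V → Option (Set V)} (hw : ∀ α, s.BacktrackTo α (w α)) :
    Explored M { s with work := w } F := by
  intro x hx hnp y hadj hy hyr
  change lab M s y ≤ dist M s (F.base x) + 1
  by_cases hp : OnPath M s F (F.base x)
  · obtain ⟨α, z, h1, h2, h3, h4⟩ := hp
    have key : α ∉ s.onHold → α ∉ s.modified → F.base x = F.nd z →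
        lab M s y ≤ dist M s (F.base x) + 1 := by
      intro hh hm hb
      have hr : s.root z = s.root x := by
        rw [C.root_eq_iff, Forest.nd_of_mem hx, hb]
      -- The matched arc is ignored in the scan. Here `x` is the base and the label of `y` equals
      -- its distance.
      by_cases hmate : mate M x = y
      · have hbx : F.base x = x := by
          by_contra h
          exact hy (hmate ▸ (C.mate_out x hx h).1)
        rw [hbx, C.dist_eq (by rw [hmate]; exact hadj.ne'), hmate]
        omega
      · exact hS x y hadj α hx ((C.base_owner x hx).symm.trans h1) hm hh (by rw [h3, hr]) hy hyr
          hmate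
    rcases C.backtrackTo_cases (hw α) with ⟨h, _⟩ | ⟨hh, hm, h, _⟩ |
      ⟨hh, hm, y', e1, e2, e3, e4, e5, h⟩
    · exact absurd ⟨α, z, h1, h2, h.trans h3, h4⟩ hnp
    · refine key hh hm ?_
      rw [h, Option.some_inj] at h3
      have hα := C.rep_root h1
      rw [← C.root_eq_iff.1 h3, hα.1.2] at h4 ⊢
      exact C.desc_of_free (C.owner_free _ _ h1).1 hα.1.1 h4
    · refine key hh hm ?_
      rw [e5, Option.some_inj] at h3
      rw [← C.root_eq_iff.1 h3, Forest.nd_of_mem e1, e3] at h4 ⊢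
      obtain ⟨p0, p1, p2, p3, p4⟩ := C.up_up e1 e3 e4
      by_contra hne
      have h5 := h4.up_of_ne (Ne.symm hne)
      rw [p3] at h5
      have h6 := h5.up_of_ne fun h => p0 (h ▸ C.base_out x hx)
      rw [p4] at h6
      exact hnp ⟨α, _, h1, p2.trans e2, h, by rw [Forest.nd_of_mem p1]; exact h6⟩
  · exact hE x hx hp y hadj hy hyr

/-- A structure that is still active and not on hold either was modified, or was moved back and
thereby lost one critical base, the base of its former working vertex. -/
theorem backtrack_potential_le {w : V → Option (Set V)} (hw : ∀ α, s.BacktrackTo α (w α)) :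
    potential M { s with work := w } F + (activeFree { s with work := w }).ncard ≤
      potential M s F + (activeModified s).ncard := by
  set moved : Set V := {α | w α ≠ none ∧ α ∉ s.onHold ∧ α ∉ s.modified} with hmoved
  have hex : ∀ α ∈ moved, ∃ y ∈ F.out, s.owner y = some α ∧ F.base y = y ∧ mate M y ≠ y ∧
      s.work α = some (s.root y) ∧ w α = some (s.root (F.par (mate M y))) := by
    rintro α ⟨h1, h2, h3⟩
    rcases C.backtrackTo_cases (hw α) with ⟨h, h' | h' | h'⟩ | ⟨_, _, _, h⟩ | ⟨_, _, h⟩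
    · exact absurd h' h2
    · exact absurd h' h3
    · exact absurd (h.trans h') h1
    · exact absurd h h1
    · exact h
  choose! g g1 g2 g3 g4 g5 g6 using hex
  have hinj : Set.InjOn g moved := fun α hα β hβ h => by
    have := g2 α hα
    rw [h, g2 β hβ, Option.some_inj] at this
    exact this.symm
  have hsub : critical M { s with work := w } F ∪ g '' moved ⊆ critical M s F := by
    rintro b (⟨h1, h2, h3, h4⟩ | ⟨α, hα, rfl⟩)
    · exact ⟨h1, h2, h3, C.onPath_of_backtrack hw h4⟩
    · refine ⟨g1 α hα, g3 α hα, g4 α hα, α, g α, g2 α hα, g2 α hα, g5 α hα, ?_⟩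
      rw [Forest.nd_of_mem (g1 α hα), g3 α hα]
      exact .refl _
  -- The old working base is strictly below the new working vertex, hence off the new path.
  have hdisj : Disjoint (critical M { s with work := w } F) (g '' moved) := by
    rw [Set.disjoint_right]
    rintro _ ⟨α, hα, rfl⟩ ⟨_, _, _, β, z, h1, h2, h3, h4⟩
    have hβ : s.owner (g α) = some β := h1
    rw [g2 α hα, Option.some_inj] at hβ
    subst hβ
    change w α = some (s.root z) at h3
    obtain ⟨p0, p1, p2, p3, p4⟩ := C.up_up (g1 α hα) (g3 α hα) (g4 α hα)
    rw [g6 α hα, Option.some_inj, C.root_eq_iff, Forest.nd_of_mem p1] at h3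
    rw [← h3, ← p4] at h4
    have h5 : F.Desc M (g α) (mate M (g α)) := by
      have := Forest.desc_up (F := F) (M := M) (g α)
      rwa [p3] at this
    have hrep := C.rep_base (g1 α hα)
    rw [g3 α hα] at hrep
    exact g4 α hα (C.desc_antisymm h5 ((Forest.desc_up _).trans h4) hrep)
  have h1 := Set.ncard_le_ncard hsub
  rw [Set.ncard_union_eq hdisj, hinj.ncard_image] at h1
  have h2 : activeFree { s with work := w } ⊆ moved ∪ activeModified s := by
    rintro α ⟨h3, h4⟩
    by_cases h5 : α ∈ s.modified
    · refine Or.inr ⟨h5, ?_⟩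
      rcases C.backtrackTo_cases (hw α) with ⟨h, _⟩ | ⟨_, h, _⟩ | ⟨_, h, _⟩
      · exact fun h' => h3 (h.trans h')
      · exact absurd h5 h
      · exact absurd h5 h
    · exact Or.inl ⟨h3, h4, h5⟩
  have h3 := (Set.ncard_le_ncard h2).trans (Set.ncard_union_le _ _)
  have h4 : ∀ x, lab M { s with work := w } x = lab M s x := fun _ => rfl
  unfold potential
  simp only [h4]
  omega

theorem backtrack_work_eq {w : V → Option (Set V)} (hw : ∀ α, s.BacktrackTo α (w α)) (α : V)
    (W : Set V) (h : w α = some W) : ∃ x ∈ F.out, s.owner x = some α ∧ W = s.root x := by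
  rcases C.backtrackTo_cases (hw α) with ⟨h1, _⟩ | ⟨_, _, _, h1⟩ |
    ⟨_, _, y, e1, e2, e3, e4, e5, h1⟩
  · exact C.work_eq α W (h1.symm.trans h)
  · rw [h1] at h; exact absurd h (by simp)
  · obtain ⟨_, p1, p2, _⟩ := C.up_up e1 e3 e4
    rw [h1, Option.some_inj] at h
    exact ⟨_, p1, p2.trans e2, h.symm⟩

theorem backtrack_work_none {w : V → Option (Set V)} (hw : ∀ α, s.BacktrackTo α (w α)) (α : V)
    (h : s.work α = none) : w α = none := by
  rcases C.backtrackTo_cases (hw α) with ⟨h1, _⟩ | ⟨_, _, _, h1⟩ | ⟨_, _, _, _, _, _, _, h1, _⟩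
  · rw [h1, h]
  · exact h1
  · rw [h1] at h; exact absurd h (by simp)

/-- The number of large structures. -/
theorem ncard_large_le (hL : 1 ≤ L) :
    (L - 1) * {α | L ≤ (s.vertsOf α).ncard}.ncard ≤ {x | mate M x ≠ x}.ncard := by
  classical
  set A : Finset V := Finset.univ.filter fun α => L ≤ (s.vertsOf α).ncard with hA
  set f : V → Finset V := fun α => Finset.univ.filter fun x => s.owner x = some α ∧ mate M x ≠ x
    with hf
  have hcard : ∀ α ∈ A, L - 1 ≤ (f α).card := by
    intro α hα
    have h1 : L ≤ (s.vertsOf α).ncard := (Finset.mem_filter.1 hα).2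
    -- Apart from `α` all vertices of the structure are matched; this is the loss from `L` to `L -
    -- 1`.
    have h2 : s.vertsOf α ⊆ insert α (f α : Set V) := by
      intro x hx
      by_cases hm : mate M x = x
      · exact Or.inl (C.owner_eq x α hx hm)
      · exact Or.inr (by simpa [hf] using ⟨hx, hm⟩)
    have h3 := (Set.ncard_le_ncard h2).trans (Set.ncard_insert_le _ _)
    rw [Set.ncard_coe_finset] at h3
    omega
  have hdisj : (A : Set V).PairwiseDisjoint f := by
    intro α _ β _ hne
    rw [Function.onFun, Finset.disjoint_left]
    intro x hx hy
    have h1 := (Finset.mem_filter.1 hx).2.1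
    rw [(Finset.mem_filter.1 hy).2.1, Option.some_inj] at h1
    exact hne h1.symm
  have h1 := Finset.card_nsmul_le_sum A (fun α => (f α).card) (L - 1) hcard
  rw [← Finset.card_biUnion hdisj] at h1
  have h2 : A.biUnion f ⊆ Finset.univ.filter fun x => mate M x ≠ x := by
    intro x hx
    obtain ⟨α, _, h⟩ := Finset.mem_biUnion.1 hx
    simpa using (Finset.mem_filter.1 h).2.2
  have h3 := h1.trans (Finset.card_le_card h2)
  rw [smul_eq_mul, mul_comm] at h3
  have h4 : {α | L ≤ (s.vertsOf α).ncard} = (A : Set V) := by ext; simp [hA]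
  have h5 : {x | mate M x ≠ x} = ((Finset.univ.filter fun x => mate M x ≠ x : Finset V) : Set V) := by
    ext; simp
  rw [h4, h5, Set.ncard_coe_finset, Set.ncard_coe_finset]
  exact h3

end Core

theorem mark_onHold {h : ℝ} (hlim : limitSize h = L) :
    (s.mark h).onHold = {α | L ≤ (s.vertsOf α).ncard} := by
  ext α
  change limitSize h ≤ _ ↔ _
  rw [hlim, Nat.cast_le]
  rfl

theorem mark_fresh (Q : AlmostSettled M F) (h : ℝ) : FreshPairs M (s.mark h) F :=
  fun x hx y hy hadj hfr hne => absurd (Q x hx y hy hadj hfr) hne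

theorem mark_smallActive {h : ℝ} (hlim : limitSize h = L) : SmallActive (s.mark h) L := by
  intro α hα _
  rw [mark_onHold hlim] at hα
  exact (not_le.1 hα).le

theorem mark_activeModified (s : PhaseState G) (h : ℝ) : activeModified (s.mark h) = ∅ :=
  Set.eq_empty_iff_forall_notMem.2 fun _ h => h.1

namespace Good

variable (H : Good M s F ℓ L)
include H

/-- Every arc of `G` occurs in the stream, and `Scanned` persists once established, so at the end it
holds for all arcs together. -/
theorem scan_extend {h : ℝ} (hlim : limitSize h = L) (hL : 2 ≤ L) (Q : AlmostSettled M F)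
    {l : List (V × V)} (hl : IsStream G l)
    (h₁ : Scan (PhaseState.ExtendStep M) l (s.mark h) s') :
    ∃ F', Progress M ℓ L (s.mark h) F s' F' ∧ ∀ x y, G.Adj x y → Scanned M s' F' x y := by
  have := Scan.invariant (A := {g : V × V | G.Adj g.1 g.2}) (D := ∅)
    (I := fun D σ => ∃ F', Progress M ℓ L (s.mark h) F σ F' ∧ ∀ g ∈ D, Scanned M σ F' g.1 g.2)
    ?_ (fun a ha => (hl.2 a.1 a.2).1 ha) h₁
    ⟨F, .refl (H.mark h) (mark_fresh Q h), fun g hg => absurd hg (Set.notMem_empty g)⟩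
  · obtain ⟨F', h2, h3⟩ := this
    exact ⟨F', h2, fun x y hxy => h3 (x, y) (Or.inr ((hl.2 x y).2 hxy))⟩
  · rintro a ha D σ σ' ⟨F', h2, h3⟩ hR
    obtain ⟨F'', h4, h5⟩ := h2.good.extendStep hL ((mark_smallActive hlim).evolves h2.evolves)
      h2.fresh ha hR
    refine ⟨F'', h2.trans h4, ?_⟩
    rintro g (rfl | hg)
    · exact h5
    · exact (h3 g hg).evolves h4.evolves

/-- Contraction has settled the edges within a structure; this pass settles those between
structures, since at least one end of every offending arc gets removed. -/
theorem scan_check (J : FreshPairs M s F) (hb : ∀ x ∈ F.out, ∀ y ∈ F.out, G.Adj x y →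
    s.owner x = s.owner y → F.base x = F.base y) {l : List (V × V)} (hl : IsStream G l)
    (h₁ : Scan (PhaseState.CheckStep M) l s s') :
    ∃ F', Progress M ℓ L s F s' F' ∧ Settled G F' := by
  have := Scan.invariant (A := Set.univ) (D := ∅)
    (I := fun D σ => ∃ F', Progress M ℓ L s F σ F' ∧ F'.base = F.base ∧
      (∀ x ∈ F'.out, x ∈ F.out ∧ σ.owner x = s.owner x) ∧
      ∀ g ∈ D, g.1 ∈ F'.out → g.2 ∈ F'.out → σ.owner g.1 = σ.owner g.2)
    ?_ (fun _ _ => Set.mem_univ _) h₁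
    ⟨F, .refl H J, rfl, fun x hx => ⟨hx, rfl⟩, fun g hg => absurd hg (Set.notMem_empty g)⟩
  · obtain ⟨F', h2, h3, h4, h5⟩ := this
    refine ⟨F', h2, fun x hx y hy hxy => ?_⟩
    rw [h3]
    refine hb x (h4 x hx).1 y (h4 y hy).1 hxy ?_
    rw [← (h4 x hx).2, ← (h4 y hy).2]
    exact h5 (x, y) (Or.inr ((hl.2 x y).2 hxy)) hx hy
  · rintro a - D σ σ' ⟨F', h2, h3, h4, h5⟩ hR
    obtain ⟨F'', g1, g2, g3, g4⟩ := h2.good.checkStep h2.fresh hR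
    refine ⟨F'', h2.trans g1, g2.trans h3, fun x hx => ?_, ?_⟩
    · exact ⟨(h4 x (g3 x hx).1).1, (g3 x hx).2.trans (h4 x (g3 x hx).1).2⟩
    · rintro g (rfl | hg) hx hy
      · exact g4 hx hy
      · rw [(g3 _ hx).2, (g3 _ hy).2]
        exact h5 g hg (g3 _ hx).1 (g3 _ hy).1

theorem exists_bundle {h : ℝ} (hlim : limitSize h = L) (hL : 2 ≤ L) (Q : AlmostSettled M F)
    {l₁ l₂ : List (V × V)} (h₁ : IsStream G l₁) (h₂ : IsStream G l₂) :
    ∃ s', s.Bundle M h l₁ l₂ s' := by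
  obtain ⟨s₁, e1⟩ := Scan.exists (A := {g : V × V | G.Adj g.1 g.2}) (R := PhaseState.ExtendStep M)
    (I := fun σ => ∃ F', Progress M ℓ L (s.mark h) F σ F')
    (fun a ha σ ⟨F', h2⟩ => h2.good.exists_extendStep ha)
    (fun a ha σ σ' ⟨F', h2⟩ hR =>
      have ⟨F'', h4, _⟩ := h2.good.extendStep hL ((mark_smallActive hlim).evolves h2.evolves)
        h2.fresh ha hR
      ⟨F'', h2.trans h4⟩)
    (fun a ha => (h₁.2 a.1 a.2).1 ha) ⟨F, .refl (H.mark h) (mark_fresh Q h)⟩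
  obtain ⟨F₁, h3, _⟩ := H.scan_extend hlim hL Q h₁ e1
  obtain ⟨s₂, e2⟩ := h3.good.exists_contractAll h3.fresh
  obtain ⟨F₂, h4⟩ := h3.good.contractAll h3.fresh e2.1
  obtain ⟨s₃, e3⟩ := Scan.exists (A := {g : V × V | G.Adj g.1 g.2}) (R := PhaseState.CheckStep M)
    (I := fun σ => ∃ F', Progress M ℓ L s₂ F₂ σ F')
    (fun a ha σ ⟨F', h2⟩ => h2.good.exists_checkStep ha)
    (fun a ha σ σ' ⟨F', h2⟩ hR =>
      have ⟨F'', h4, _⟩ := h2.good.checkStep h2.fresh hR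
      ⟨F'', h2.trans h4⟩)
    (fun a ha => (h₂.2 a.1 a.2).1 ha) ⟨F₂, .refl h4.good h4.fresh⟩
  obtain ⟨F₃, h5, _⟩ := h4.good.scan_check h4.fresh
    (h4.good.base_eq_of_contractAll h4.fresh e2.2) h₂ e3
  obtain ⟨s', e4⟩ := h5.good.core.exists_backtrack
  exact ⟨s', s₁, s₂, s₃, e1, e2, e3, e4⟩

/-- Combines the operations, which do not raise the potential plus the number of active modified
structures, with backtracking, which turns that number into active structures not on hold.
Multiplication by `L - 1` admits the bound on the structures on hold without division. -/
theorem bundle {h : ℝ} (hlim : limitSize h = L) (hL : 2 ≤ L) (Q : AlmostSettled M F)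
    {l₁ l₂ : List (V × V)} (h₁ : IsStream G l₁) (h₂ : IsStream G l₂)
    (hB : s.Bundle M h l₁ l₂ s') :
    ∃ F', Good M s' F' ℓ L ∧ Settled G F' ∧ (∀ α, s.work α = none → s'.work α = none) ∧
      (L - 1) * (potential M s' F' + {α | s'.work α ≠ none}.ncard) ≤
        (L - 1) * potential M s F + {x | mate M x ≠ x}.ncard := by
  obtain ⟨s₁, s₂, s₃, e1, e2, e3, w, hw, rfl⟩ := hB
  obtain ⟨F₁, h3, hsc⟩ := H.scan_extend hlim hL Q h₁ e1
  obtain ⟨F₂, h4⟩ := h3.good.contractAll h3.fresh e2.1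
  obtain ⟨F₃, h5, hset⟩ := h4.good.scan_check h4.fresh
    (h4.good.base_eq_of_contractAll h4.fresh e2.2) h₂ e3
  have h6 := h3.trans (h4.trans h5)
  have C := h5.good.core
  have hsc' : ∀ x y, G.Adj x y → Scanned M s₃ F₃ x y := fun x y hxy =>
    (hsc x y hxy).evolves (h4.trans h5).evolves
  refine ⟨F₃, h5.good.congr w _ _ (C.backtrack_work_eq hw)
    (C.backtrack_explored h5.good.explored hsc' hw), hset,
    fun α hα => C.backtrack_work_none hw α (h6.evolves.work_none α hα), ?_⟩
  have h7 := (C.backtrack_potential_le hw).trans h6.potential_le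
  rw [mark_activeModified, Set.ncard_empty, add_zero] at h7
  have h8 : {α | w α ≠ none} ⊆
      activeFree { s₃ with work := w } ∪ {α | L ≤ (s.vertsOf α).ncard} := by
    intro α hα
    by_cases hh : α ∈ s₃.onHold
    · rw [h6.evolves.onHold, mark_onHold hlim] at hh
      exact Or.inr hh
    · exact Or.inl ⟨hα, hh⟩
  have h9 := (Set.ncard_le_ncard h8).trans (Set.ncard_union_le _ _)
  have h10 := H.core.ncard_large_le (by omega : 1 ≤ L)
  have h11 : potential M (s.mark h) F = potential M s F := rfl
  rw [h11] at h7
  calc _ ≤ (L - 1) * (potential M s F + {α | L ≤ (s.vertsOf α).ncard}.ncard) :=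
        Nat.mul_le_mul_left _ (by change _ + {α | w α ≠ none}.ncard ≤ _; omega)
    _ ≤ _ := by rw [mul_add]; omega

end Good

end

/-! ### Phases -/

section

variable {V : Type*} [Fintype V] {G : SimpleGraph V}
variable {M N : G.Subgraph} {s : PhaseState G} {F : Forest V} {ℓ L : ℕ}

/-- The forest at the beginning of a phase: every free vertex is a tree of its own. -/
def initForest (M : G.Subgraph) : Forest V := ⟨{x | mate M x = x}, id, id⟩

theorem init_owner_eq_some {ε : ℝ} {x α : V} :
    (PhaseState.init M ε).owner x = some α ↔ mate M x = x ∧ x = α := by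
  classical
  change (if IsFree M x then some x else none) = some α ↔ _
  rw [← isFree_iff_mate]
  split_ifs with h <;> simp [h]

theorem init_owner_ne_none {ε : ℝ} {x : V} :
    (PhaseState.init M ε).owner x ≠ none ↔ mate M x = x := by
  classical
  change (if IsFree M x then some x else none) ≠ none ↔ _
  rw [← isFree_iff_mate]
  split_ifs with h <;> simp [h]

theorem init_work {ε : ℝ} {α : V} {W : Set V} :
    (PhaseState.init M ε).work α = some W ↔ mate M α = α ∧ W = {α} := by
  classical
  change (if IsFree M α then some {α} else none) = some W ↔ _
  rw [← isFree_iff_mate]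
  split_ifs with h <;> simp [h, eq_comm]

theorem init_core (hM : M.IsMatching) {ε : ℝ} (hε : ⌊ellMax ε⌋₊ = ℓ) :
    Core M (PhaseState.init M ε) (initForest M) ℓ where
  isMatching := hM
  free_owner x hx _ := init_owner_eq_some.2 ⟨hx, rfl⟩
  owner_free x α h := by
    obtain ⟨h1, rfl⟩ := init_owner_eq_some.1 h
    exact ⟨h1, h⟩
  owner_eq x α h _ := (init_owner_eq_some.1 h).2
  free_out x hx _ := hx
  out_owner x hx := init_owner_ne_none.2 hx
  removed_owner x hx := absurd hx (Set.notMem_empty x)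
  mate_removed x hx := absurd hx (Set.notMem_empty x)
  mate_owner x := by
    by_cases h : mate M x = x
    · rw [h]
    · have h1 := mt (init_owner_ne_none (ε := ε)).1 h
      have h2 : mate M (mate M x) ≠ mate M x := by rw [mate_mate hM]; exact Ne.symm h
      have h3 := mt (init_owner_ne_none (ε := ε)).1 h2
      rw [not_not.1 h1, not_not.1 h3]
  base_out x hx := hx
  base_base x _ := rfl
  base_owner x _ := rfl
  mate_out x _ h := absurd rfl h
  mate_base x hx _ h := absurd hx h
  mate_inner v hv h := absurd (init_owner_ne_none.1 h) hv
  par_out v hv h := absurd (init_owner_ne_none.1 h) hv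
  root_out x hx := by
    ext y
    constructor
    · rintro rfl
      exact ⟨hx, rfl⟩
    · exact fun h => h.2
  root_notOut x _ := rfl
  arcs_adj x y h := absurd h (Set.notMem_empty _)
  arcs_owner x y h := absurd h (Set.notMem_empty _)
  arcs_char x y h := absurd h (Set.notMem_empty _)
  lab_lt v hv h := absurd (init_owner_ne_none.1 h) hv
  lab_le v hv h := absurd (init_owner_ne_none.1 h) hv
  lab_none v _ _ _ := by rw [← hε]; rfl
  work_eq α W h := by
    obtain ⟨h1, rfl⟩ := init_work.1 h
    exact ⟨α, h1, init_owner_eq_some.2 ⟨h1, rfl⟩, rfl⟩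

theorem init_good (hM : M.IsMatching) {ε : ℝ} (hε : ⌊ellMax ε⌋₊ = ℓ) (hL : 1 ≤ L) :
    Good M (PhaseState.init M ε) (initForest M) ℓ L where
  core := init_core hM hε
  explored x hx h := absurd ⟨x, x, init_owner_eq_some.2 ⟨hx, rfl⟩, init_owner_eq_some.2 ⟨hx, rfl⟩,
    init_work.2 ⟨hx, rfl⟩, by rw [Forest.nd_of_mem hx]; exact .refl _⟩ h
  sizes := by
    refine ⟨fun v hv h => absurd (init_owner_ne_none.1 h) hv, fun α => ?_⟩
    have : (PhaseState.init M ε).vertsOf α ⊆ {α} := fun x hx => (init_owner_eq_some.1 hx).2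
    refine (Set.ncard_le_ncard this).trans ?_
    rw [Set.ncard_singleton]
    exact Nat.one_le_iff_ne_zero.2 (by positivity)
  blossom x hx := HasAlt.nil ⟨hx, rfl⟩
  paths := ⟨fun p hp => absurd hp List.not_mem_nil, List.Pairwise.nil,
    fun p hp => absurd hp List.not_mem_nil, by
      change (∅ : Set V).ncard ≤ _
      simp⟩

/-- Before the first pass-bundle adjacent free vertices are different outer blossoms; the exception
for free pairs in `AlmostSettled` and `FreshPairs` serves this situation. -/
theorem init_almostSettled : AlmostSettled M (initForest M) := fun x hx y hy _ h =>
  absurd h (by rintro (h | h); exacts [h hx, h hy])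

theorem init_potential {ε : ℝ} (hε : ⌊ellMax ε⌋₊ = ℓ) :
    potential M (PhaseState.init M ε) (initForest M) =
      3 * ({x | mate M x ≠ x}.ncard * (ℓ + 1)) := by
  classical
  have h1 : critical M (PhaseState.init M ε) (initForest M) = ∅ :=
    Set.eq_empty_iff_forall_notMem.2 fun x h => h.2.2.1 h.1
  have h2 : ∀ x, lab M (PhaseState.init M ε) x = ℓ + 1 := fun x => by rw [← hε]; rfl
  have h3 : {x | mate M x ≠ x} =
      ((Finset.univ.filter fun x => ¬ mate M x = x : Finset V) : Set V) := by
    ext; simp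
  unfold potential
  simp only [h1, h2, Set.ncard_empty, add_zero]
  rw [Finset.sum_ite, Finset.sum_const_zero, zero_add, Finset.sum_const, smul_eq_mul, h3,
    Set.ncard_coe_finset]

/-- The invariants at the end of the first `τ` pass-bundles. -/
def AfterBundles (M : G.Subgraph) (ℓ L : ℕ) (τ : ℕ) (s : PhaseState G) : Prop :=
  ∃ F, Good M s F ℓ L ∧ AlmostSettled M F ∧ (0 < τ → Settled G F) ∧
    (L - 1) * (potential M s F + τ * {α | s.work α ≠ none}.ncard) ≤
      (L - 1) * (3 * ({x | mate M x ≠ x}.ncard * (ℓ + 1))) + τ * {x | mate M x ≠ x}.ncard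

theorem afterBundles_init (hM : M.IsMatching) {ε : ℝ} (hε : ⌊ellMax ε⌋₊ = ℓ) (hL : 1 ≤ L) :
    AfterBundles M ℓ L 0 (PhaseState.init M ε) :=
  ⟨_, init_good hM hε hL, init_almostSettled, fun h => absurd h (lt_irrefl 0), by
    rw [init_potential hε, zero_mul, zero_mul, add_zero, add_zero]⟩

theorem AfterBundles.succ {τ : ℕ} {s' : PhaseState G} (A : AfterBundles M ℓ L τ s) {h : ℝ}
    (hlim : limitSize h = L) (hL : 2 ≤ L) {l₁ l₂ : List (V × V)} (h₁ : IsStream G l₁)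
    (h₂ : IsStream G l₂) (hB : s.Bundle M h l₁ l₂ s') : AfterBundles M ℓ L (τ + 1) s' := by
  obtain ⟨F, H, Q, _, hp⟩ := A
  obtain ⟨F', H', S, hw, hp'⟩ := H.bundle hlim hL Q h₁ h₂ hB
  refine ⟨F', H', fun x hx y hy hxy _ => S x hx y hy hxy, fun _ => S, ?_⟩
  -- Structures never regain a working vertex, so the present number of active ones also bounds from
  -- below the number in each earlier pass-bundle.
  have hsub : {α | s'.work α ≠ none}.ncard ≤ {α | s.work α ≠ none}.ncard :=
    Set.ncard_le_ncard fun α hα h => hα (hw α h)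
  have h1 := Nat.mul_le_mul_left ((L - 1) * τ) hsub
  nlinarith

theorem AfterBundles.exists_bundle {τ : ℕ} (A : AfterBundles M ℓ L τ s) {h : ℝ}
    (hlim : limitSize h = L) (hL : 2 ≤ L) {l₁ l₂ : List (V × V)} (h₁ : IsStream G l₁)
    (h₂ : IsStream G l₂) : ∃ s', s.Bundle M h l₁ l₂ s' := by
  obtain ⟨F, H, Q, _⟩ := A
  exact H.exists_bundle hlim hL Q h₁ h₂

/-- A run exists if an invariant guarantees the existence of its steps. -/
theorem exists_run {σ : Type*} {I : ℕ → σ → Prop} {R : ℕ → σ → σ → Prop}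
    (h : ∀ n a, I n a → ∃ b, I (n + 1) b ∧ R n a b) {a : σ} (ha : I 0 a) :
    ∃ s : ℕ → σ, s 0 = a ∧ ∀ n, R n (s n) (s (n + 1)) := by
  choose! f h1 h2 using h
  have key : ∀ n, I n (Nat.rec a f n) := by
    intro n
    induction n with
    | zero => exact ha
    | succ n ih => exact h1 n _ ih
  exact ⟨fun n => Nat.rec a f n, rfl, fun n => h2 n _ (key n)⟩

/-! ### Short augmenting walks at the end of a phase -/

/-- The bases of the blossoms on the active paths. -/
def activeBases (M : G.Subgraph) (s : PhaseState G) (F : Forest V) : Set V :=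
  {x | x ∈ F.out ∧ F.base x = x ∧ OnPath M s F x}

theorem Core.dist_le (C : Core M s F ℓ) {x : V} (hx : x ∈ F.out) (hb : F.base x = x) :
    dist M s x ≤ ℓ := by
  by_cases h : mate M x = x
  · rw [dist, if_pos h]
    exact Nat.zero_le _
  · rw [C.dist_eq h]
    exact C.lab_le _ (C.mate_base x hx hb h) (by rw [C.mate_owner]; exact C.out_owner x hx)

/-- An active base is determined by its structure and its distance, which is one of 0, …, ℓ: two
bases on the same path are comparable, and the lower one has the larger distance. -/
theorem Core.ncard_activeBases_le (C : Core M s F ℓ) :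
    (activeBases M s F).ncard ≤ {α | s.work α ≠ none}.ncard * (ℓ + 1) := by
  classical
  have h1 : {α | s.work α ≠ none}.ncard * (ℓ + 1) =
      ({α | s.work α ≠ none} ×ˢ (Finset.range (ℓ + 1) : Set ℕ)).ncard := by
    rw [Set.ncard_prod, Set.ncard_coe_finset, Finset.card_range]
  rw [h1]
  refine Set.ncard_le_ncard_of_injOn (fun x => ((s.owner x).getD x, dist M s x)) ?_ ?_
    ((Set.toFinite _).prod (Finset.finite_toSet _))
  · rintro x ⟨hx, hb, α, y, h2, _, h3, _⟩
    refine ⟨?_, ?_⟩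
    · change s.work ((s.owner x).getD x) ≠ none
      rw [h2, Option.getD_some, h3]
      simp
    · rw [Finset.mem_coe, Finset.mem_range, Nat.lt_succ_iff]
      exact C.dist_le hx hb
  · rintro x ⟨hx, hb, α, y, h2, h3, h4, h5⟩ x' ⟨hx', hb', α', y', h2', h3', h4', h5'⟩ h
    obtain ⟨h6, h7⟩ := Prod.mk.inj h
    rw [h2, h2', Option.getD_some, Option.getD_some] at h6
    subst h6
    rw [h4, Option.some_inj, C.root_eq_iff] at h4'
    rw [← h4'] at h5'
    have key : ∀ z w, z ∈ F.out → F.base z = z → w ∈ F.out → dist M s z = dist M s w →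
        F.Desc M z w → z = w := by
      intro z w hz hzb hw hd hzw
      have hrep := C.rep_base hz
      rw [hzb] at hrep
      rcases C.desc_rk hzw hrep with h | h
      · exact h.symm
      · rw [rk, rk, if_pos hz, if_pos hw] at h
        omega
    rcases h5.total h5' with h | h
    · exact key x x' hx hb hx' h7 h
    · exact (key x' x hx' hb' hx h7.symm h).symm

/-- Suppose no vertex blocks the walk. By induction its i-th outer vertex lies in an outer blossom
of distance at most i whose base was visited by the walk. The final free vertex is the base of its
own blossom, and by `Settled` it shares that base with the last outer vertex; so the walk would
return to a vertex it has visited. -/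
theorem Good.exists_blocked (H : Good M s F ℓ L) (S : Settled G F) (hN : N.IsMatching) {f : V}
    {k : ℕ} (hk : k ≤ ℓ) (hf : mate M f = f) (hr : Running (mate M) (mate N) f k)
    (h1 : mate N (altIter (mate M) (mate N) f k) ≠ altIter (mate M) (mate N) f k)
    (h2 : mate M (mate N (altIter (mate M) (mate N) f k)) =
      mate N (altIter (mate M) (mate N) f k)) :
    ∃ i ≤ k, altIter (mate M) (mate N) f i ∈ activeBases M s F ∨
      altIter (mate M) (mate N) f i ∈ s.removed ∨
      mate N (altIter (mate M) (mate N) f i) ∈ s.removed := by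
  have C := H.core
  by_contra hcon
  push Not at hcon
  set t := altIter (mate M) (mate N) f with ht
  have hfree : ∀ x, mate M x = x → x ∉ s.removed → x ∈ F.out ∧ F.base x = x := by
    intro x hx hxr
    have hxo := C.free_out x hx (by rw [C.free_owner x hx hxr]; simp)
    refine ⟨hxo, ?_⟩
    by_contra h
    exact (C.mate_out x hxo h).2.2 hx
  have hne : ∀ i ≤ k, mate N (t i) ≠ t i := by
    intro i hi
    rcases hi.eq_or_lt with rfl | hi
    · exact h1
    · exact (hr i hi).1
  have hadj : ∀ i ≤ k, G.Adj (t i) (mate N (t i)) := fun i hi =>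
    N.adj_sub ((adj_iff_mate hN).2 ⟨rfl, hne i hi⟩)
  have hback : ∀ i ≤ k, ∀ j ≤ i, mate N (t i) ≠ t j := fun i hi j hj =>
    b_altIter_ne (mate_mate C.isMatching) (mate_mate hN) hj (fun l hl => hr l (hl.trans_le hi))
      (hne i hi)
  have key : ∀ i ≤ k, t i ∈ F.out ∧ dist M s (F.base (t i)) ≤ i ∧ ∃ j ≤ i, F.base (t i) = t j := by
    intro i
    induction i with
    | zero =>
      intro _
      obtain ⟨h3, h4⟩ := hfree f hf (hcon 0 (Nat.zero_le k)).2.1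
      refine ⟨h3, ?_, 0, le_rfl, h4⟩
      change dist M s (F.base f) ≤ 0
      rw [h4, dist, if_pos hf]
    | succ i ih =>
      intro hi
      have hi' : i ≤ k := by omega
      obtain ⟨h3, h4, j, hj, h5⟩ := ih hi'
      have hsucc : t (i + 1) = mate M (mate N (t i)) := altIter_succ f i
      rw [hsucc]
      -- If the next vertex is outer, it is in the same blossom. It is not the base, which was
      -- visited earlier, so its mate is in that blossom too.
      by_cases hy : mate N (t i) ∈ F.out
      · have h6 := S _ h3 _ hy (hadj i hi')
        have h7 : F.base (mate N (t i)) ≠ mate N (t i) := fun h =>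
          hback i hi' j hj (by rw [← h, ← h6, h5])
        obtain ⟨h8, h9, _⟩ := C.mate_out _ hy h7
        rw [h9, ← h6]
        exact ⟨h8, by omega, j, by omega, h5⟩
      -- Otherwise the blossom, being off the active paths, was explored. The label of the next
      -- vertex is then at most i + 1 ≤ ℓ, so the vertex is visited, and its mate is a base with
      -- this distance.
      · have h6 : ¬ OnPath M s F (F.base (t i)) := fun h =>
          (hcon j (by omega)).1 (h5 ▸ ⟨C.base_out _ h3, C.base_base _ h3, h⟩)
        have h7 := H.explored _ h3 h6 _ (hadj i hi') hy (hcon i hi').2.2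
        have h8 : s.owner (mate N (t i)) ≠ none := by
          intro h
          have := C.lab_none _ h (hcon i hi').2.2 (hr i (by omega)).2
          omega
        obtain ⟨h9, h10⟩ := C.mate_inner _ hy h8
        refine ⟨h9, ?_, i + 1, le_rfl, by rw [h10, hsucc]⟩
        rw [h10, C.dist_eq, C.mate_mate]
        · omega
        · rw [C.mate_mate]
          exact (hr i (by omega)).2.symm
  obtain ⟨h3, _, j, hj, h5⟩ := key k le_rfl
  obtain ⟨h6, h7⟩ := hfree _ h2 (hcon k le_rfl).2.2
  exact hback k le_rfl j hj (by rw [← h7, ← S _ h3 _ h6 (hadj k le_rfl), h5])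

/-- Short walks number at most the active bases plus twice the removed vertices, and both were
bounded; `card_starts_le` does the rest. -/
theorem Good.ncard_le (H : Good M s F ℓ L) (S : Settled G F) (hN : N.IsMatching) :
    (ℓ + 1) * N.edgeSet.ncard * 2 ≤ (ℓ + 1) * (2 * M.edgeSet.ncard +
      {α | s.work α ≠ none}.ncard * (ℓ + 1) + 2 * (2 * s.paths.length * ((ℓ + 1) * L))) +
      2 * M.edgeSet.ncard := by
  have hM := H.core.isMatching
  have h1 := card_starts_le (mate_mate hM) (mate_mate hN) ℓ
  have h2 := card_shortAug_le (mate_mate hM) (mate_mate hN) ℓ (activeBases M s F) s.removed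
    fun f k hk hf hr h1 h2 => H.exists_blocked S hN hk hf hr h1 h2
  have h3 := H.core.ncard_activeBases_le
  have h4 := H.paths.ncard
  rw [← two_mul_ncard_edgeSet hM, ← two_mul_ncard_edgeSet hN] at h1
  have h5 := Nat.mul_le_mul_left (ℓ + 1) (h2.trans (Nat.add_le_add h3 (Nat.mul_le_mul_left 2 h4)))
  calc _ = (ℓ + 1) * (2 * N.edgeSet.ncard) := by ring
    _ ≤ _ := h1
    _ ≤ _ := by rw [mul_add, add_assoc (2 * M.edgeSet.ncard), mul_add (ℓ + 1) (2 * _)]; omega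

end

/-! ### Scales -/

/-- The parameters as integers. -/
structure Params (ε h : ℝ) (E H : ℕ) : Prop where
  one_le : 1 ≤ E
  two_le : 2 ≤ H
  ellMax_eq : ellMax ε = 3 * E
  inv_h : h = 1 / H
  floor_ellMax : ⌊ellMax ε⌋₊ = 3 * E
  limitSize_eq : limitSize h = (6 * H + 1 : ℕ)
  numBundles_eq : numBundles ε h = 72 * H * E
  numPhases_eq : numPhases ε h = 144 * H * E

theorem exists_params {ε h : ℝ} {j k : ℕ} (hε : 1 / ε = 2 ^ k) (hh : h = (1 / 2) ^ (j + 1)) :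
    ∃ E H, Params ε h E H := by
  have hε' : ε = 1 / ((2 ^ k : ℕ) : ℝ) := by
    rw [Nat.cast_pow, Nat.cast_ofNat, ← hε, one_div_one_div]
  have hh' : h = 1 / ((2 ^ (j + 1) : ℕ) : ℝ) := by
    rw [hh, Nat.cast_pow, Nat.cast_ofNat, one_div_pow]
  have hE : 1 ≤ 2 ^ k := Nat.one_le_two_pow
  have hH : 2 ≤ 2 ^ (j + 1) := by
    rw [pow_succ]
    have : 1 ≤ 2 ^ j := Nat.one_le_two_pow
    omega
  refine ⟨2 ^ k, 2 ^ (j + 1), ?_⟩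
  generalize 2 ^ k = E at *
  generalize 2 ^ (j + 1) = H at *
  have hE0 : (E : ℝ) ≠ 0 := Nat.cast_ne_zero.2 (by omega)
  have hH0 : (H : ℝ) ≠ 0 := Nat.cast_ne_zero.2 (by omega)
  have h1 : ellMax ε = 3 * E := by rw [ellMax, hε']; field_simp
  refine ⟨hE, hH, h1, hh', ?_, ?_, ?_, ?_⟩
  · rw [h1]
    exact_mod_cast Nat.floor_natCast (R := ℝ) (3 * E)
  · rw [limitSize, hh']
    push_cast
    field_simp
  · have : 72 / (h * ε) = ((72 * H * E : ℕ) : ℝ) := by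
      rw [hε', hh']
      push_cast
      field_simp
    rw [numBundles, this, Nat.floor_natCast]
  · have : 144 / (h * ε) = ((144 * H * E : ℕ) : ℝ) := by
      rw [hε', hh']
      push_cast
      field_simp
    rw [numPhases, this, Nat.floor_natCast]

section

variable {V : Type*} [Fintype V] {G : SimpleGraph V} {M M' N : G.Subgraph} {ε h : ℝ} {E H : ℕ}

namespace Params

variable (p : Params ε h E H)
include p

theorem exists_phaseRun (hM : M.IsMatching) {str : ℕ → Fin 2 → List (V × V)}
    (hstr : ∀ τ i, IsStream G (str τ i)) : ∃ P, PhaseRun ε h str M P := by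
  have hH := p.two_le
  obtain ⟨s, h1, h2⟩ := exists_run (I := AfterBundles M (3 * E) (6 * H + 1))
    (R := fun τ s s' => s.Bundle M h (str τ 0) (str τ 1) s')
    (fun τ s A => by
      obtain ⟨s', hs⟩ := A.exists_bundle p.limitSize_eq (by omega) (hstr τ 0) (hstr τ 1)
      exact ⟨s', A.succ p.limitSize_eq (by omega) (hstr τ 0) (hstr τ 1) hs, hs⟩)
    (afterBundles_init hM p.floor_ellMax (by omega))
  exact ⟨_, s, h1, fun τ _ => h2 τ, rfl⟩

/-- `A` is the number of structures that still have a working vertex at the end of the phase. -/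
theorem phaseRun (hM : M.IsMatching) {str : ℕ → Fin 2 → List (V × V)}
    (hstr : ∀ τ i, IsStream G (str τ i)) {P : List (BundledPath G)}
    (h : PhaseRun ε h str M P) :
    (∀ p ∈ P, IsAugmentingPath M p.2) ∧ DisjointPaths P ∧ ∃ A : ℕ,
      3 * H * A ≤ 2 * M.edgeSet.ncard ∧ ∀ N : G.Subgraph, N.IsMatching →
        (3 * E + 1) * N.edgeSet.ncard * 2 ≤ (3 * E + 1) * (2 * M.edgeSet.ncard + A * (3 * E + 1) +
          2 * (2 * P.length * ((3 * E + 1) * (6 * H + 1)))) + 2 * M.edgeSet.ncard := by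
  have hE := p.one_le
  have hH := p.two_le
  obtain ⟨s, h0, h1, rfl⟩ := h
  have key : ∀ τ ≤ numBundles ε h, AfterBundles M (3 * E) (6 * H + 1) τ (s τ) := by
    intro τ
    induction τ with
    | zero => exact fun _ => h0 ▸ afterBundles_init hM p.floor_ellMax (by omega)
    | succ τ ih =>
      exact fun hτ => (ih (by omega)).succ p.limitSize_eq (by omega) (hstr τ 0) (hstr τ 1)
        (h1 τ (by omega))
  obtain ⟨F, K, _, hS, hp⟩ := key _ le_rfl
  have hT := p.numBundles_eq
  have hpos : 0 < numBundles ε h := by rw [hT]; positivity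
  refine ⟨K.paths.aug, K.paths.disjoint, _, ?_, fun N hN => K.ncard_le (hS hpos) hN⟩
  generalize hA : {α | (s (numBundles ε h)).work α ≠ none}.ncard = A at hp ⊢
  rw [hT, ← two_mul_ncard_edgeSet hM, Nat.add_sub_cancel] at hp
  generalize M.edgeSet.ncard = m at hp ⊢
  -- The final potential is dropped. With 3E + 1 ≤ 4E, the initial potential and the structures on
  -- hold contribute 144·H·E·m each on the right.
  have h2 : 6 * H * (72 * H * E * A) ≤
      6 * H * (3 * (2 * m * (3 * E + 1))) + 72 * H * E * (2 * m) :=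
    (Nat.mul_le_mul_left _ (Nat.le_add_left _ _)).trans hp
  have h3 : 6 * H * (3 * (2 * m * (3 * E + 1))) ≤ 6 * H * (3 * (2 * m * (4 * E))) := by
    gcongr; omega
  have h4 : (144 * H * E) * (3 * H * A) ≤ (144 * H * E) * (2 * m) := by linarith
  exact Nat.le_of_mul_le_mul_left h4 (by positivity)

/-- A phase finds many augmenting paths unless the matching is good already. -/
theorem phase_gain (hM : M.IsMatching) {str : ℕ → Fin 2 → List (V × V)}
    (hstr : ∀ τ i, IsStream G (str τ i)) {P : List (BundledPath G)} (hP : PhaseRun ε h str M P)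
    (hN : N.IsMatching) (hlt : (1 + 4 * h * ellMax ε) * (1 + 1 / ellMax ε) * M.edgeSet.ncard <
      (N.edgeSet.ncard : ℝ)) :
    (M.edgeSet.ncard : ℝ) ≤ 8 * (H : ℝ) ^ 2 * P.length := by
  obtain ⟨_, _, A, h1, h2⟩ := p.phaseRun hM hstr hP
  have h2 := h2 N hN
  rw [p.ellMax_eq, p.inv_h] at hlt
  have hE : (1 : ℝ) ≤ E := by exact_mod_cast p.one_le
  have hH : (2 : ℝ) ≤ H := by exact_mod_cast p.two_le
  have h1' : 3 * (H : ℝ) * A ≤ 2 * M.edgeSet.ncard := by exact_mod_cast h1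
  have h2' : (3 * (E : ℝ) + 1) * N.edgeSet.ncard * 2 ≤
      (3 * E + 1) * (2 * M.edgeSet.ncard + A * (3 * E + 1) +
        2 * (2 * P.length * ((3 * E + 1) * (6 * H + 1)))) + 2 * M.edgeSet.ncard := by
    exact_mod_cast h2
  have hm : (0 : ℝ) ≤ M.edgeSet.ncard := Nat.cast_nonneg _
  have hq : (0 : ℝ) ≤ P.length := Nat.cast_nonneg _
  generalize (M.edgeSet.ncard : ℝ) = m at *
  generalize (N.edgeSet.ncard : ℝ) = n at *
  generalize (P.length : ℝ) = q at *
  generalize (A : ℝ) = A at *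
  generalize (E : ℝ) = x at *
  generalize (H : ℝ) = y at *
  have e1 : n ≤ m + A * (3 * x + 1) / 2 + 2 * q * ((3 * x + 1) * (6 * y + 1)) + m / (3 * x + 1) := by
    have : (3 * x + 1) * (2 * (m + A * (3 * x + 1) / 2 + 2 * q * ((3 * x + 1) * (6 * y + 1)) +
        m / (3 * x + 1))) = (3 * x + 1) * (2 * m + A * (3 * x + 1) +
        2 * (2 * q * ((3 * x + 1) * (6 * y + 1)))) + 2 * m := by
      field_simp
    have h3 : (3 * x + 1) * (2 * n) ≤ (3 * x + 1) * (2 * (m + A * (3 * x + 1) / 2 +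
        2 * q * ((3 * x + 1) * (6 * y + 1)) + m / (3 * x + 1))) := by
      rw [this]; linarith
    have := le_of_mul_le_mul_left h3 (by positivity)
    linarith
  have e2 : m / (3 * x + 1) ≤ m / (3 * x) := by gcongr; linarith
  have e3 : m + m / (3 * x) + 12 * x / y * m ≤
      (1 + 4 * (1 / y) * (3 * x)) * (1 + 1 / (3 * x)) * m := by
    have : (1 + 4 * (1 / y) * (3 * x)) * (1 + 1 / (3 * x)) * m =
        m + m / (3 * x) + 12 * x / y * m + 4 / y * m := by
      field_simp
      ring
    rw [this]
    have : 0 ≤ 4 / y * m := by positivity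
    linarith
  -- The claimed factor exceeds 1 + 1/ℓ_max by at least 12E/H. This excess must come from active
  -- bases and removed vertices.
  have e4 : 12 * x / y * m < A * (3 * x + 1) / 2 + 2 * q * ((3 * x + 1) * (6 * y + 1)) := by
    linarith
  have e5 : 12 * x * m < y * A * (3 * x + 1) / 2 + 2 * (q * y) * ((3 * x + 1) * (6 * y + 1)) := by
    have h3 := mul_lt_mul_of_pos_left e4 (by linarith : 0 < y)
    have : y * (12 * x / y * m) = 12 * x * m := by field_simp
    rw [this] at h3
    linarith
  have e6 : y * A * (3 * x + 1) ≤ 2 / 3 * m * (4 * x) := by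
    apply mul_le_mul _ _ (by positivity) (by positivity) <;> linarith
  have e7 : 2 * (q * y) * ((3 * x + 1) * (6 * y + 1)) ≤ 2 * (q * y) * (4 * x * (13 / 2 * y)) := by
    gcongr <;> linarith
  -- Active bases absorb at most 4/3 of the 12 units, so more than 10 units remain for the removed
  -- vertices; finally 52/10 ≤ 8.
  have e8 : x * (10 * m) ≤ x * (52 * (q * y * y)) := by nlinarith
  have e9 := le_of_mul_le_mul_left e8 (by linarith)
  have : 0 ≤ q * y * y := by positivity
  nlinarith

theorem exists_scaleRun (hM : M.IsMatching) {str : ℕ → ℕ → Fin 2 → List (V × V)}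
    (hstr : ∀ t τ i, IsStream G (str t τ i)) : ∃ M', ScaleRun ε h str M M' := by
  obtain ⟨N, h1, h2⟩ := exists_run (I := fun _ (N : G.Subgraph) => N.IsMatching)
    (R := fun t N N' => ∃ P, PhaseRun ε h (str t) N P ∧ N' = augmentBy N P)
    (fun t N hN => by
      obtain ⟨P, hP⟩ := p.exists_phaseRun hN (hstr t)
      obtain ⟨h1, h2, _⟩ := p.phaseRun hN (hstr t) hP
      exact ⟨_, augmentBy_isMatching hN h1 h2, P, hP, rfl⟩)
    hM
  exact ⟨_, N, h1, fun t _ => h2 t, rfl⟩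

/-- A scale halves the excess of the approximation factor. -/
theorem scaleRun {str : ℕ → ℕ → Fin 2 → List (V × V)} (hstr : ∀ t τ i, IsStream G (str t τ i))
    (hM : IsApproxMaxMatching G ((1 + 8 * h * ellMax ε) * (1 + 1 / ellMax ε)) M)
    (hR : ScaleRun ε h str M M') :
    IsApproxMaxMatching G ((1 + 4 * h * ellMax ε) * (1 + 1 / ellMax ε)) M' := by
  obtain ⟨K, h0, h1, rfl⟩ := hR
  have hE : (1 : ℝ) ≤ E := by exact_mod_cast p.one_le
  have hH : (2 : ℝ) ≤ H := by exact_mod_cast p.two_le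
  have key : ∀ t ≤ numPhases ε h, (K t).IsMatching := by
    intro t
    induction t with
    | zero => exact fun _ => h0 ▸ hM.1
    | succ t ih =>
      intro ht
      obtain ⟨P, h2, h3⟩ := h1 t (by omega)
      have h4 := ih (by omega)
      obtain ⟨h5, h6, _⟩ := p.phaseRun h4 (hstr t) h2
      rw [h3]
      exact augmentBy_isMatching h4 h5 h6
  refine ⟨key _ le_rfl, fun N hN => ?_⟩
  by_contra hcon
  rw [not_le] at hcon
  have hmono : ∀ t < numPhases ε h, (K t).edgeSet.ncard ≤ (K (t + 1)).edgeSet.ncard := by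
    intro t ht
    obtain ⟨P, h2, h3⟩ := h1 t ht
    obtain ⟨h5, h6, _⟩ := p.phaseRun (key t ht.le) (hstr t) h2
    rw [h3, ncard_edgeSet_augmentBy (key t ht.le) h5 h6]
    omega
  have hle : ∀ d t, t + d = numPhases ε h →
      (K t).edgeSet.ncard ≤ (K (numPhases ε h)).edgeSet.ncard := by
    intro d
    induction d with
    | zero => rintro t rfl; exact le_rfl
    | succ d ih => exact fun t ht => (hmono t (by omega)).trans (ih (t + 1) (by omega))
  have hc : 0 ≤ (1 + 4 * h * ellMax ε) * (1 + 1 / ellMax ε) := by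
    rw [p.ellMax_eq, p.inv_h]
    positivity
  -- The gain is measured against the size at the beginning of the scale; linear growth is enough,
  -- no compounding is needed.
  have hgrow : ∀ t ≤ numPhases ε h, (M.edgeSet.ncard : ℝ) * (1 + t / (8 * (H : ℝ) ^ 2)) ≤
      (K t).edgeSet.ncard := by
    intro t
    induction t with
    | zero => intro _; simp [h0]
    | succ t ih =>
      intro ht
      have h7 := ih (by omega)
      obtain ⟨P, h2, h3⟩ := h1 t (by omega)
      have h4 := key t (by omega)
      obtain ⟨h5, h6, _⟩ := p.phaseRun h4 (hstr t) h2
      have h8 := p.phase_gain h4 (hstr t) h2 hN (lt_of_le_of_lt (mul_le_mul_of_nonneg_left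
        (Nat.cast_le.2 (hle (numPhases ε h - t) t (by omega))) hc) hcon)
      rw [h3, ncard_edgeSet_augmentBy h4 h5 h6, Nat.cast_add]
      have h9 : (M.edgeSet.ncard : ℝ) ≤ (K t).edgeSet.ncard := by
        refine le_trans ?_ h7
        exact le_mul_of_one_le_right (Nat.cast_nonneg _) (by
          have : 0 ≤ (t : ℝ) / (8 * (H : ℝ) ^ 2) := by positivity
          linarith)
      have h10 : (M.edgeSet.ncard : ℝ) / (8 * (H : ℝ) ^ 2) ≤ P.length := by
        rw [div_le_iff₀ (by positivity)]
        linarith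
      push_cast
      have h11 : (M.edgeSet.ncard : ℝ) * (1 + (t + 1) / (8 * (H : ℝ) ^ 2)) =
          M.edgeSet.ncard * (1 + t / (8 * (H : ℝ) ^ 2)) + M.edgeSet.ncard / (8 * (H : ℝ) ^ 2) := by
        ring
      rw [h11]
      linarith
  have h2 := hgrow _ le_rfl
  have h3 := hM.2 N hN
  rw [p.numPhases_eq] at h2 hcon
  rw [p.ellMax_eq, p.inv_h] at hcon h3
  have h4 : ((144 * H * E : ℕ) : ℝ) / (8 * (H : ℝ) ^ 2) = 18 * E / H := by
    push_cast
    field_simp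
    ring
  rw [h4] at h2
  have hm : (0 : ℝ) ≤ M.edgeSet.ncard := Nat.cast_nonneg _
  -- Already the linear terms suffice: 24E/H ≤ 12E/H + 18E/H.
  have h5 : (1 + 8 * (1 / (H : ℝ)) * (3 * E)) ≤
      (1 + 4 * (1 / (H : ℝ)) * (3 * E)) * (1 + 18 * E / H) := by
    have : (1 + 4 * (1 / (H : ℝ)) * (3 * E)) * (1 + 18 * E / H) =
        (1 + 8 * (1 / (H : ℝ)) * (3 * E)) + (6 * E / H + 216 * (E / H) ^ 2) := by
      field_simp
      ring
    rw [this]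
    have : 0 ≤ 6 * (E : ℝ) / H + 216 * (E / H) ^ 2 := by positivity
    linarith
  have h6 : (0 : ℝ) ≤ 1 + 1 / (3 * E) := by positivity
  refine absurd (h3.trans ?_) (not_le.2 hcon)
  calc (1 + 8 * (1 / (H : ℝ)) * (3 * E)) * (1 + 1 / (3 * E)) * M.edgeSet.ncard
      ≤ ((1 + 4 * (1 / (H : ℝ)) * (3 * E)) * (1 + 18 * E / H)) * (1 + 1 / (3 * E)) *
        M.edgeSet.ncard := by gcongr
    _ = (1 + 4 * (1 / (H : ℝ)) * (3 * E)) * (1 + 1 / (3 * E)) *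
        (M.edgeSet.ncard * (1 + 18 * E / H)) := by ring
    _ ≤ _ := by gcongr

end Params

/-- Induction over the scales with the factor written in terms of the scale just finished. For j = 0
the factor is at least 1 + 4ℓ_max, hence more than 2. -/
theorem afterScales_isApprox {k : ℕ} (hε : 1 / ε = 2 ^ k)
    {str : ℕ → ℕ → ℕ → Fin 2 → List (V × V)} (hstr : ∀ j t τ i, IsStream G (str j t τ i))
    {M₀ : G.Subgraph} (hM₀ : IsApproxMaxMatching G 2 M₀) {j : ℕ}
    (hM : AfterScales ε str M₀ j M) :
    IsApproxMaxMatching G ((1 + 4 * (1 / 2) ^ j * ellMax ε) * (1 + 1 / ellMax ε)) M := by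
  induction hM with
  | start =>
    obtain ⟨E, H, p⟩ := exists_params (j := 0) hε rfl
    refine ⟨hM₀.1, fun N hN => (hM₀.2 N hN).trans ?_⟩
    have hE : (1 : ℝ) ≤ E := by exact_mod_cast p.one_le
    have h1 : (0 : ℝ) ≤ 1 / (3 * E) := by positivity
    rw [p.ellMax_eq, pow_zero]
    gcongr
    nlinarith
  | @scale j M M' hM hR ih =>
    obtain ⟨E, H, p⟩ := exists_params (j := j) hε rfl
    refine p.scaleRun (hstr j) ?_ hR
    -- The factor 4 at the previous scale is the factor 8 at the present one, whose h is half as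
    -- large.
    convert ih using 4
    rw [pow_succ]
    ring

end

end StreamMatching

theorem mainTheorem8 {V : Type*} [Fintype V] (G : SimpleGraph V)
    (ε : ℝ) (hε0 : 0 < ε) (hε1 : ε ≤ 1) (hε2 : ∃ k : ℕ, 1 / ε = 2 ^ k)
    (str : ℕ → ℕ → ℕ → Fin 2 → List (V × V))
    (hstr : ∀ j t τ i, StreamMatching.IsStream G (str j t τ i))
    (M₀ : G.Subgraph) (hM₀ : StreamMatching.IsApproxMaxMatching G 2 M₀)
    (j : ℕ) (h : ℝ) (hh : h = (1 / 2) ^ (j + 1)) (hmin : ε ^ 2 / 64 ≤ h)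
    (M : G.Subgraph) (hM : StreamMatching.AfterScales ε str M₀ j M) :
    (∃ M' : G.Subgraph, StreamMatching.ScaleRun ε h (str j) M M') ∧
    ∀ M' : G.Subgraph, StreamMatching.ScaleRun ε h (str j) M M' →
      StreamMatching.IsApproxMaxMatching G
        ((1 + 4 * h * StreamMatching.ellMax ε) * (1 + 1 / StreamMatching.ellMax ε)) M' := by
  obtain ⟨k, hk⟩ := hε2
  have hA := StreamMatching.afterScales_isApprox hk hstr hM₀ hM
  obtain ⟨E, H, p⟩ := StreamMatching.exists_params hk hh
  refine ⟨p.exists_scaleRun hA.1 (hstr j), fun M' hR => ?_⟩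
  subst hh
  exact StreamMatching.afterScales_isApprox hk hstr hM₀ (.scale hM hR)
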